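/- Setting. Let $d\in\mathbb N$. A weight on $\mathbb R^{2d}$ is a locally integrable function $\mathbb R^{2d}\to[0,\infty)$. Let $v$ be a weight that is submultiplicative, $v(z_1+z_2)\le v(z_1)v(z_2)$, has polynomial growth, $v(z)\le C(1+|z|)^s$ for some $C,s\ge 0$, and is symmetric in each coordinate, i.e. invariant under changing the sign of any one coordinate. Let $w$ be a $v$-moderate weight, $w(z_1+z_2)\le C'\,v(z_1)w(z_2)$ for some constant $C'$ and all $z_1,z_2$, that is not identically zero (it is then strictly positive everywhere). Let $c$ be a permutation of $\{1,\dots,2d\}$ and $\mathfrak c(x_1,\dots,x_{2d})=(x_{c(1)},\dots,x_{c(2d)})$, and fix a window $\phi\in\mathcal S(\mathbb R^d)$, $\phi\neq 0$. For $f\in\mathcal S'(\mathbb R^d)$ the Gabor transform is $$V_\phi f(x,\xi)=\langle f, M_\xi T_x\phi\rangle,\qquad (M_\xi T_x\phi)(t)=e^{2\pi i t\cdot\xi}\phi(t-x),\qquad x,\xi\in\mathbb R^d,$$ where $\langle\cdot,\cdot\rangle$ extends the inner product of $L^2(\mathbb R^d)$, linear in the first and antilinear in the second variable. For $p_1,\dots,p_{2d}\in[1,\infty]$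 let $L_w^{p_1,\dots,p_{2d}}$ be the mixed norm space on $\mathbb R^{2d}$ with norm $$\|F\|_{L_w^{p_1,\dots,p_{2d}}}=\Bigl(\int_{\mathbb R}\cdots\Bigl(\int_{\mathbb R}|F(x_1,\dots,x_{2d})\,w(x_1,\dots,x_{2d})|^{p_1}\,dx_1\Bigr)^{p_2/p_1}\cdots\,dx_{2d}\Bigr)^{1/p_{2d}}$$ (essential suprema for exponents $\infty$). The mixed modulation space $M(c)_w^{p_1,\dots,p_{2d}}$ is the set of all $f\in\mathcal S'(\mathbb R^d)$ with $$\|f\|_{M(c)_w^{p_1,\dots,p_{2d}}}=\|V_\phi f\circ\mathfrak c\|_{L_w^{p_1,\dots,p_{2d}}}<\infty .$$ Theorem. (1) For all $p_1,\dots,p_{2d}\in[1,\infty]$, the expression $\|\cdot\|_{M(c)_w^{p_1,\dots,p_{2d}}}$ is a norm and $M(c)_w^{p_1,\dots,p_{2d}}$ is a Banach space with it. (2) Let $p_1,\dots,p_{2d}\in[1,\infty)$ and let $p_i'\in[1,\infty]$ satisfy $\frac1{p_i}+\frac1{p_i'}=1$. Then $M(c)_{1/w}^{p_1',\dots,p_{2d}'}$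 is the dual space of $M(c)_w^{p_1,\dots,p_{2d}}$ under the pairing $$\langle f,g\rangle=\int_{\mathbb R^{2d}}V_\phi f(z)\,\overline{V_\phi g(z)}\,dz .$$ That is, the integral converges absolutely for all $f\in M(c)_w^{p_1,\dots,p_{2d}}$ and $g\in M(c)_{1/w}^{p_1',\dots,p_{2d}'}$, and $g\mapsto\langle\cdot,g\rangle$ is an antilinear bijection of $M(c)_{1/w}^{p_1',\dots,p_{2d}'}$ onto the space of bounded linear functionals on $M(c)_w^{p_1,\dots,p_{2d}}$, continuous with continuous inverse for the norm topologies. -/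

import Mathlib

open MeasureTheory
open scoped ENNReal SchwartzMap ComplexConjugate

namespace MixedModulation

/-! ### Weights on `ℝⁿ` -/

/-- A weight: a locally integrable function `ℝⁿ → [0, ∞)`. -/
structure IsWeight {n : ℕ} (w : (Fin n → ℝ) → ℝ) : Prop where
  nonneg : ∀ z, 0 ≤ w z
  locallyIntegrable : LocallyIntegrable w volume

/-- A submultiplicative weight. -/
structure IsSubmultiplicativeWeight {n : ℕ} (v : (Fin n → ℝ) → ℝ) : Prop extends IsWeight v where
  map_add_le : ∀ z₁ z₂, v (z₁ + z₂) ≤ v z₁ * v z₂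

/-- Polynomial growth: `v z ≤ C (1 + |z|) ^ s`, where `|z|` is the Euclidean norm. -/
def HasPolynomialGrowth {n : ℕ} (v : (Fin n → ℝ) → ℝ) : Prop :=
  ∃ C s : ℝ, 0 ≤ C ∧ 0 ≤ s ∧ ∀ z, v z ≤ C * (1 + ‖WithLp.toLp 2 z‖) ^ s

/-- Symmetry in each coordinate: changing the sign of one coordinate does not change `v`. -/
def IsCoordinateSymmetric {n : ℕ} (v : (Fin n → ℝ) → ℝ) : Prop :=
  ∀ (z : Fin n → ℝ) (i : Fin n), v (Function.update z i (-z i)) = v z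

/-- A `v`-moderate weight. -/
structure IsModerateWeight {n : ℕ} (v w : (Fin n → ℝ) → ℝ) : Prop extends IsWeight w where
  exists_map_add_le : ∃ C : ℝ, ∀ z₁ z₂, w (z₁ + z₂) ≤ C * v z₁ * w z₂

/-! ### Mixed norms on `ℝⁿ` -/

/-- The iterated norm of a function `F : ℝⁿ → [0, ∞]`: the `L^{p₁}` norm in the first variable is
taken first (innermost) and the `L^{pₙ}` norm in the last variable is taken last (outermost), each
with respect to Lebesgue measure on `ℝ`; an exponent `∞` gives an essential supremum. -/
noncomputable def iteratedNorm :
    (n : ℕ) → (Fin n → ℝ≥0∞) → ((Fin n → ℝ) → ℝ≥0∞) → ℝ≥0∞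
  | 0, _, F => F Fin.elim0
  | n + 1, p, F =>
      eLpNorm
        (fun t : ℝ => iteratedNorm n (fun i => p i.castSucc)
          (fun x => F (Fin.snoc (α := fun _ => ℝ) x t)))
        (p (Fin.last n)) volume

/-- The weighted mixed norm `‖F‖_{L_w^{p₁,…,pₙ}}`, with values in `[0, ∞]`. -/
noncomputable def mixedNorm {n : ℕ} (p : Fin n → ℝ≥0∞) (w : (Fin n → ℝ) → ℝ)
    (F : (Fin n → ℝ) → ℂ) : ℝ≥0∞ :=
  iteratedNorm n p (fun z => ‖F z * (w z : ℂ)‖ₑ)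

/-! ### The Gabor transform -/

/-- The character `t ↦ e^{2πi t·ξ}` on `ℝᵈ`. -/
noncomputable def character {d : ℕ} (ξ t : EuclideanSpace ℝ (Fin d)) : ℂ :=
  Complex.exp (2 * Real.pi * Complex.I * (inner ℝ t ξ : ℝ))

theorem hasTemperateGrowth_character {d : ℕ} (ξ : EuclideanSpace ℝ (Fin d)) :
    (character ξ).HasTemperateGrowth := by
  have hE : (fun s : ℝ => Complex.exp (2 * Real.pi * Complex.I * s)).HasTemperateGrowth := by
    refine ⟨((contDiff_const.mul Complex.ofRealCLM.contDiff).cexp), fun n => ⟨0, ‖(2 * Real.pi * Complex.I : ℂ)‖ ^ n, fun s => ?_⟩⟩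
    have hD : ∀ m : ℕ, iteratedDeriv m (fun s : ℝ => Complex.exp (2 * Real.pi * Complex.I * s)) =
        fun s : ℝ => (2 * Real.pi * Complex.I) ^ m *
          Complex.exp (2 * Real.pi * Complex.I * s) := by
      intro m
      induction m with
      | zero => simp
      | succ m ih =>
        rw [iteratedDeriv_succ, ih]
        funext s
        have h1 : HasDerivAt (fun s : ℝ => (2 * Real.pi * Complex.I * s : ℂ))
            (2 * Real.pi * Complex.I * 1) s :=
          (Complex.ofRealCLM.hasDerivAt (x := s)).const_mul (2 * Real.pi * Complex.I)
        rw [(h1.cexp.const_mul _).deriv]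
        ring
    have h2 : ‖Complex.exp (2 * Real.pi * Complex.I * s)‖ = 1 := by
      rw [Complex.norm_exp]
      simp
    rw [norm_iteratedFDeriv_eq_norm_iteratedDeriv, hD, norm_mul, h2, norm_pow]
    simp
  exact hE.comp (Function.hasTemperateGrowth_inner_left ξ)

/-- The time-frequency shift `M_ξ T_x φ` of a Schwartz function. -/
noncomputable def timeFrequencyShift {d : ℕ} (x ξ : EuclideanSpace ℝ (Fin d))
    (φ : 𝓢(EuclideanSpace ℝ (Fin d), ℂ)) : 𝓢(EuclideanSpace ℝ (Fin d), ℂ) :=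
  SchwartzMap.smulLeftCLM ℂ (character ξ) (φ.compSubConstCLM ℂ x)

theorem timeFrequencyShift_apply {d : ℕ} (x ξ : EuclideanSpace ℝ (Fin d))
    (φ : 𝓢(EuclideanSpace ℝ (Fin d), ℂ)) (t : EuclideanSpace ℝ (Fin d)) :
    timeFrequencyShift x ξ φ t =
      Complex.exp (2 * Real.pi * Complex.I * (inner ℝ t ξ : ℝ)) * φ (t - x) := by
  simp [timeFrequencyShift, hasTemperateGrowth_character, character]

/-- The complex conjugate of a Schwartz function. -/
noncomputable def conjSchwartz {d : ℕ} (φ : 𝓢(EuclideanSpace ℝ (Fin d), ℂ)) :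
    𝓢(EuclideanSpace ℝ (Fin d), ℂ) :=
  φ.postcompCLM (𝕜 := ℝ) (Complex.conjCLE : ℂ →L[ℝ] ℂ)

theorem conjSchwartz_apply {d : ℕ} (φ : 𝓢(EuclideanSpace ℝ (Fin d), ℂ))
    (t : EuclideanSpace ℝ (Fin d)) : conjSchwartz φ t = conj (φ t) := by
  simp [conjSchwartz]

/-- The Gabor transform `V_φ f (x, ξ) = ⟨f, M_ξ T_x φ⟩`. The bracket is the extension of the inner
product of `L²` to `S' × S`, linear in `f` and antilinear in the Schwartz function, so that
`⟨f, g⟩` is the value of the tempered distribution `f` at the complex conjugate of `g`. -/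
noncomputable def gaborTransform {d : ℕ} (φ : 𝓢(EuclideanSpace ℝ (Fin d), ℂ))
    (f : 𝓢'(EuclideanSpace ℝ (Fin d), ℂ)) (x ξ : EuclideanSpace ℝ (Fin d)) : ℂ :=
  f (conjSchwartz (timeFrequencyShift x ξ φ))

/-- The Gabor transform as a function of `z = (x, ξ) ∈ ℝ²ᵈ`: the first `d` coordinates of `z` are
those of `x`, and the last `d` are those of `ξ`. -/
noncomputable def gaborTransform₂ {d : ℕ} (φ : 𝓢(EuclideanSpace ℝ (Fin d), ℂ))
    (f : 𝓢'(EuclideanSpace ℝ (Fin d), ℂ)) (z : Fin (d + d) → ℝ) : ℂ :=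
  gaborTransform φ f (WithLp.toLp 2 fun i => z (Fin.castAdd d i))
    (WithLp.toLp 2 fun i => z (Fin.natAdd d i))

/-! ### Mixed modulation spaces -/

/-- The mixed modulation norm `‖f‖_{M(c)_w^{p₁,…,p₂d}} = ‖V_φ f ∘ 𝔠‖_{L_w^{p₁,…,p₂d}}` of a tempered
distribution, with values in `[0, ∞]`, where `𝔠 (x₁, …, x₂d) = (x_{c(1)}, …, x_{c(2d)})`. The mixed
modulation space consists of the tempered distributions for which it is finite. -/
noncomputable def modulationNorm {d : ℕ} (φ : 𝓢(EuclideanSpace ℝ (Fin d), ℂ))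
    (c : Equiv.Perm (Fin (d + d))) (w : (Fin (d + d) → ℝ) → ℝ) (p : Fin (d + d) → ℝ≥0∞)
    (f : 𝓢'(EuclideanSpace ℝ (Fin d), ℂ)) : ℝ≥0∞ :=
  mixedNorm p w (fun z => gaborTransform₂ φ f (fun i => z (c i)))

/-! ### The normed space of the elements of finite norm -/

/-- `N : V → [0, ∞]` is an extended norm on the complex vector space `V`: subadditive, absolutely
homogeneous, and zero only at zero. -/
structure IsExtendedNorm {V : Type*} [AddCommGroup V] [Module ℂ V] (N : V → ℝ≥0∞) : Prop where
  map_add_le : ∀ f g, N (f + g) ≤ N f + N g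
  map_smul : ∀ (a : ℂ) f, N (a • f) = ‖a‖ₑ * N f
  eq_zero : ∀ f, N f = 0 → f = 0

namespace IsExtendedNorm

variable {V : Type*} [AddCommGroup V] [Module ℂ V] {N : V → ℝ≥0∞}

/-- The linear subspace on which an extended norm is finite. -/
def finiteSubmodule (h : IsExtendedNorm N) : Submodule ℂ V where
  carrier := {f | N f < ∞}
  add_mem' hf hg := (h.map_add_le _ _).trans_lt (ENNReal.add_lt_top.2 ⟨hf, hg⟩)
  zero_mem' := by
    have := h.map_smul 0 0
    simp_all
  smul_mem' a f hf := by
    have h1 : N (a • f) = ‖a‖ₑ * N f := h.map_smul a f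
    have h2 : N f < ∞ := hf
    change N (a • f) < ∞
    rw [h1]
    exact ENNReal.mul_lt_top (by simp) h2

/-- The space `{f | N f < ∞}`, normed by `N` (and with the topology of this norm, not with a
topology that `V` may have). -/
def Space (h : IsExtendedNorm N) : Type _ := h.finiteSubmodule

/-- An element of `{f | N f < ∞}`, as an element of `V`. -/
def Space.val {h : IsExtendedNorm N} (f : h.Space) : V := (f : h.finiteSubmodule).1

noncomputable instance (h : IsExtendedNorm N) : AddCommGroup h.Space :=
  inferInstanceAs (AddCommGroup h.finiteSubmodule)

noncomputable instance (h : IsExtendedNorm N) : Module ℂ h.Space :=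
  inferInstanceAs (Module ℂ h.finiteSubmodule)

noncomputable instance (h : IsExtendedNorm N) : Norm h.Space := ⟨fun f => (N f.val).toReal⟩

theorem Space.val_lt_top {h : IsExtendedNorm N} (f : h.Space) : N f.val < ∞ := f.2

theorem normedSpaceCore (h : IsExtendedNorm N) : NormedSpace.Core ℂ h.Space where
  norm_nonneg _ := ENNReal.toReal_nonneg
  norm_smul a f := by
    change (N (a • f.val)).toReal = ‖a‖ * (N f.val).toReal
    rw [h.map_smul, ENNReal.toReal_mul, toReal_enorm]
  norm_triangle f g := by
    change (N (f.val + g.val)).toReal ≤ (N f.val).toReal + (N g.val).toReal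
    rw [← ENNReal.toReal_add f.val_lt_top.ne g.val_lt_top.ne]
    exact ENNReal.toReal_mono (ENNReal.add_lt_top.2 ⟨f.val_lt_top, g.val_lt_top⟩).ne
      (h.map_add_le _ _)
  norm_eq_zero_iff f := by
    constructor
    · intro hf
      have h0 : (N f.val).toReal = 0 := hf
      have h1 : N f.val = 0 := by
        rcases (ENNReal.toReal_eq_zero_iff _).1 h0 with h1 | h1
        · exact h1
        · exact absurd h1 f.val_lt_top.ne
      exact Subtype.ext (h.eq_zero _ h1)
    · rintro rfl
      have h0 : N (0 : V) = 0 := by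
        have := h.map_smul 0 0
        simp_all
      change (N (0 : V)).toReal = 0
      simp [h0]

noncomputable instance (h : IsExtendedNorm N) : NormedAddCommGroup h.Space :=
  NormedAddCommGroup.ofCore h.normedSpaceCore

noncomputable instance (h : IsExtendedNorm N) : NormedSpace ℂ h.Space :=
  NormedSpace.ofCore h.normedSpaceCore

end IsExtendedNorm

end MixedModulation

open MixedModulation

/-! After the permutation of coordinates, the Gabor coefficients of `f` are its values at the atoms
`U z`, the complex conjugates of `M_ξ T_x φ`. Three properties of this family carry the proof
(`IsReproducingFamily`): `⟨ψ, U z⟩` decays rapidly in `z` for Schwartz `ψ`; the Gram kernel `⟨U u, U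
z⟩` decays rapidly in `u - z`; and `A f(ψ) = ∫ f(U z) ⟨ψ, U z⟩ dz` with `A = ‖φ‖₂²`. The last
formula is Fourier inversion in `ξ` followed by integration in `x`. It is obtained pointwise for
Schwartz functions and then passed through an arbitrary tempered distribution
(`IsSchwartzIntegral.apply_tempered`).

Completeness: Hölder's inequality in the reproducing formula embeds the space into the tempered
distributions (`exists_enorm_apply_le`). A Cauchy sequence therefore converges weakly, and Fatou's
lemma upgrades this to convergence in norm.

Duality: Hölder's inequality bounds the pairing. For surjectivity, a functional `l` defines a
tempered distribution `g` by its values on Schwartz functions. Superpositions `∫ G(z) U z dz` are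
controlled by the mixed norm of `G`, since moderateness of the weight reduces the Gram kernel to an
integrable convolution kernel (`exists_iteratedNorm_lintegral_mul_le`). Testing `l` on such
superpositions, the converse of Hölder's inequality puts `g` in the dual space. Finite exponents
enter only in the approximation of `A f` by superpositions with truncated coefficients, which gives
`A l(f) = ⟨f, g⟩`. The open mapping theorem yields the continuous inverse.

The facts on mixed norms follow by induction on the number of variables. Minkowski's and Young's
inequalities are needed only up to a constant, so they can be deduced from the converse of Hölder's
inequality, whose core is a measurable choice of norming functions (`exists_measurable_norming`). -/

namespace MixedModulation

/-! ### `L^p` norms of `[0, ∞]`-valued functions of one variable. -/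

section OneVariable

variable {α β : Type*} [MeasurableSpace α] [MeasurableSpace β] {μ : Measure α}

theorem eLpNorm_const_mul_ennreal (f : α → ℝ≥0∞) (p : ℝ≥0∞) {a : ℝ≥0∞} (ha : a ≠ ∞) :
    eLpNorm (fun x => a * f x) p μ = a * eLpNorm f p μ := by
  rcases eq_or_ne p 0 with rfl | hp0
  · simp
  rcases eq_or_ne p ∞ with rfl | hp
  · simp only [eLpNorm_exponent_top, eLpNormEssSup, enorm_eq_self]
    exact ENNReal.essSup_const_mul
  · have hpos : 0 < p.toReal := ENNReal.toReal_pos hp0 hp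
    rw [eLpNorm_eq_lintegral_rpow_enorm_toReal hp0 hp, eLpNorm_eq_lintegral_rpow_enorm_toReal hp0 hp]
    simp only [enorm_eq_self, ENNReal.mul_rpow_of_nonneg _ _ hpos.le]
    rw [lintegral_const_mul' _ _ (ENNReal.rpow_ne_top_of_nonneg hpos.le ha),
      ENNReal.mul_rpow_of_nonneg _ _ (by positivity), ← ENNReal.rpow_mul,
      mul_one_div_cancel hpos.ne', ENNReal.rpow_one]

/-- Fatou's lemma, transferred to `L^p`: a positive power is an order isomorphism of `[0, ∞]` and so
commutes with `liminf`. -/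
theorem eLpNorm_liminf_le (F : ℕ → α → ℝ≥0∞) (hF : ∀ k, Measurable (F k)) (p : ℝ≥0∞) :
    eLpNorm (fun x => Filter.liminf (fun k => F k x) Filter.atTop) p μ ≤
      Filter.liminf (fun k => eLpNorm (F k) p μ) Filter.atTop := by
  rcases eq_or_ne p 0 with rfl | hp0
  · simp
  rcases eq_or_ne p ∞ with rfl | hp
  · simp only [eLpNorm_exponent_top, eLpNormEssSup, enorm_eq_self]
    exact ENNReal.essSup_liminf_le F
  · have hpos : 0 < p.toReal := ENNReal.toReal_pos hp0 hp
    have key : ∀ (r : ℝ) (_ : 0 < r) (u : ℕ → ℝ≥0∞),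
        (Filter.liminf u Filter.atTop) ^ r = Filter.liminf (fun k => u k ^ r) Filter.atTop := by
      intro r hr u
      exact (ENNReal.orderIsoRpow r hr).liminf_apply
    simp only [eLpNorm_eq_lintegral_rpow_enorm_toReal hp0 hp, enorm_eq_self]
    rw [← key _ (by positivity)]
    refine ENNReal.rpow_le_rpow ?_ (by positivity)
    simp only [key _ hpos]
    exact lintegral_liminf_le fun k => (hF k).pow_const _

theorem lintegral_mul_le_eLpNorm_mul_eLpNorm {p q : ℝ≥0∞} (hpq : 1 / p + 1 / q = 1)
    {f g : α → ℝ≥0∞} (hf : AEMeasurable f μ) (hg : AEMeasurable g μ) :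
    ∫⁻ x, f x * g x ∂μ ≤ eLpNorm f p μ * eLpNorm g q μ := by
  have top_case : ∀ {f g : α → ℝ≥0∞}, AEMeasurable f μ → AEMeasurable g μ →
      ∫⁻ x, f x * g x ∂μ ≤ eLpNorm f 1 μ * eLpNorm g ∞ μ := by
    intro f g hf hg
    rw [eLpNorm_one_eq_lintegral_enorm, eLpNorm_exponent_top, eLpNormEssSup]
    simp only [enorm_eq_self]
    rw [← lintegral_mul_const'' _ hf]
    refine lintegral_mono_ae ?_
    filter_upwards [ENNReal.ae_le_essSup (μ := μ) g] with x hx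
    gcongr
  have hpq' : ENNReal.HolderConjugate p q := ENNReal.holderConjugate_iff.2 (by simpa using hpq)
  rcases eq_or_ne p ∞ with rfl | hp
  · have hq1 : q = 1 := by simpa using hpq
    subst hq1
    rw [mul_comm]
    simp only [mul_comm (f _)]
    exact top_case hg hf
  rcases eq_or_ne q ∞ with rfl | hq
  · have hp1 : p = 1 := by simpa using hpq
    subst hp1
    exact top_case hf hg
  have hp0 : p ≠ 0 := by rintro rfl; simp at hpq
  have hq0 : q ≠ 0 := by rintro rfl; simp at hpq
  have hr : p.toReal.HolderConjugate q.toReal := by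
    have h1 : 1 < p := by
      refine lt_of_le_of_ne hpq'.one_le ?_
      rintro rfl
      simp at hpq; exact hq hpq
    refine Real.holderConjugate_iff.2 ⟨?_, ?_⟩
    · simpa using (ENNReal.toReal_lt_toReal (by simp) hp).2 h1
    · have := congrArg ENNReal.toReal hpq
      rw [ENNReal.toReal_add (by simp [hp0]) (by simp [hq0])] at this
      simpa using this
  rw [eLpNorm_eq_lintegral_rpow_enorm_toReal hp0 hp, eLpNorm_eq_lintegral_rpow_enorm_toReal hq0 hq]
  simpa using ENNReal.lintegral_mul_le_Lp_mul_Lq μ hr hf hg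

theorem measurable_eLpNorm_prodMk {ν : Measure β} [SFinite ν] {F : α × β → ℝ≥0∞}
    (hF : Measurable F) (p : ℝ≥0∞) :
    Measurable fun a => eLpNorm (fun b => F (a, b)) p ν := by
  rcases eq_or_ne p 0 with rfl | hp0
  · simp
  rcases eq_or_ne p ∞ with rfl | hp
  · simp only [eLpNorm_exponent_top, eLpNormEssSup, enorm_eq_self]
    refine measurable_of_Iic fun c => ?_
    -- The essential supremum is at most `c` exactly when the section of `{F > c}` is null, and the
    -- measure of a section depends measurably on `a`.
    have : (fun a => essSup (fun b => F (a, b)) ν) ⁻¹' Set.Iic c =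
        (fun a => ν (Prod.mk a ⁻¹' (F ⁻¹' Set.Ioi c))) ⁻¹' {0} := by
      ext a
      have : essSup (fun b => F (a, b)) ν ≤ c ↔ ∀ᵐ b ∂ν, F (a, b) ≤ c :=
        ⟨fun h => (ENNReal.ae_le_essSup _).mono fun b hb => hb.trans h,
          fun h => essSup_le_of_ae_le c h⟩
      simp only [Set.mem_preimage, Set.mem_Iic, this, ae_iff, Set.mem_singleton_iff, not_le]
      rfl
    rw [this]
    exact measurable_measure_prodMk_left (hF measurableSet_Ioi) (measurableSet_singleton 0)
  · simp only [eLpNorm_eq_lintegral_rpow_enorm_toReal hp0 hp, enorm_eq_self]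
    exact ((hF.pow_const _).lintegral_prod_right').pow_const _

theorem tendsto_eLpNorm_zero_of_dominated {p : ℝ≥0∞} (hp0 : p ≠ 0) (hp : p ≠ ∞) {F : ℕ → α → ℝ≥0∞}
    {H : α → ℝ≥0∞} (hF : ∀ k, Measurable (F k)) (hle : ∀ k x, F k x ≤ H x)
    (hH : eLpNorm H p μ ≠ ∞)
    (hlim : ∀ᵐ x ∂μ, Filter.Tendsto (fun k => F k x) Filter.atTop (nhds 0)) :
    Filter.Tendsto (fun k => eLpNorm (F k) p μ) Filter.atTop (nhds 0) := by
  have hpos : 0 < p.toReal := ENNReal.toReal_pos hp0 hp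
  simp only [eLpNorm_eq_lintegral_rpow_enorm_toReal hp0 hp, enorm_eq_self] at hH ⊢
  have h1 : Filter.Tendsto (fun k => ∫⁻ x, F k x ^ p.toReal ∂μ) Filter.atTop
      (nhds (∫⁻ _, 0 ∂μ)) := by
    refine tendsto_lintegral_of_dominated_convergence (fun x => H x ^ p.toReal)
      (fun k => (hF k).pow_const _)
      (fun k => Filter.Eventually.of_forall fun x => ENNReal.rpow_le_rpow (hle k x) hpos.le) ?_ ?_
    · intro h
      rw [h, ENNReal.top_rpow_of_pos (by positivity)] at hH
      exact hH rfl
    · filter_upwards [hlim] with x hx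
      have := (ENNReal.continuous_rpow_const (y := p.toReal)).tendsto 0 |>.comp hx
      simpa [Function.comp_def, ENNReal.zero_rpow_of_pos hpos] using this
  have := (ENNReal.continuous_rpow_const (y := 1 / p.toReal)).tendsto _ |>.comp h1
  have h0 : (0 : ℝ) < 1 / p.toReal := by positivity
  rw [lintegral_zero, ENNReal.zero_rpow_of_pos h0] at this
  exact this

end OneVariable

/-- A measurable choice of almost norming functions in the duality of `L^p` and `L^q`. -/
theorem exists_measurable_norming {α : Type*} [MeasurableSpace α] {p q : ℝ≥0∞}
    (hpq : 1 / p + 1 / q = 1) {h : α × ℝ → ℝ≥0∞} (hm : Measurable h)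
    {s : Set ℝ} (hs : volume s ≠ ∞) (hsupp : ∀ a, ∀ t ∉ s, h (a, t) = 0)
    (hfin : ∀ a, eLpNorm (fun t => h (a, t)) q volume ≠ ∞) :
    ∃ k : α × ℝ → ℝ≥0∞, Measurable k ∧ (∀ a, eLpNorm (fun t => k (a, t)) p volume ≤ 1) ∧
      ∀ a, eLpNorm (fun t => h (a, t)) q volume ≤ 2 * ∫⁻ t, k (a, t) * h (a, t) := by
  set θ : α → ℝ≥0∞ := fun a => eLpNorm (fun t => h (a, t)) q volume with hθ
  have hθm : Measurable θ := measurable_eLpNorm_prodMk hm q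
  rcases eq_or_ne p ∞ with rfl | hp
  · have hq1 : q = 1 := by simpa using hpq
    subst hq1
    refine ⟨fun _ => 1, measurable_const, fun a => ?_, fun a => ?_⟩
    · rw [eLpNorm_exponent_top]
      exact essSup_le_of_ae_le 1 (Filter.Eventually.of_forall fun t => by simp)
    · simp only [eLpNorm_one_eq_lintegral_enorm, enorm_eq_self, one_mul]
      exact le_mul_of_one_le_left' (by norm_num)
  rcases eq_or_ne q ∞ with rfl | hq
  · have hp1 : p = 1 := by simpa using hpq
    subst hp1
    -- For `q = ∞` an exact norming function need not exist. Averaging `h` over the set where it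
    -- exceeds half its essential supremum costs the factor 2; the support condition makes this set
    -- of finite measure.
    set A : Set (α × ℝ) := {z | θ z.1 / 2 < h z} with hA
    have hAm : MeasurableSet A := measurableSet_lt ((hθm.comp measurable_fst).div_const 2) hm
    have hνm : Measurable fun a => volume (Prod.mk a ⁻¹' A) := measurable_measure_prodMk_left hAm
    have hAs : ∀ a, MeasurableSet (Prod.mk a ⁻¹' A) := fun a => measurable_prodMk_left hAm
    refine ⟨A.indicator fun z => (volume (Prod.mk z.1 ⁻¹' A))⁻¹,
      ((hνm.comp measurable_fst).inv).indicator hAm, fun a => ?_, fun a => ?_⟩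
    · rw [eLpNorm_one_eq_lintegral_enorm]
      simp only [enorm_eq_self]
      have : (fun t => A.indicator (fun z : α × ℝ => (volume (Prod.mk z.1 ⁻¹' A))⁻¹) (a, t)) =
          (Prod.mk a ⁻¹' A).indicator fun _ => (volume (Prod.mk a ⁻¹' A))⁻¹ := rfl
      rw [this, lintegral_indicator (hAs a), setLIntegral_const]
      exact ENNReal.inv_mul_le_one _
    · rcases eq_or_ne (θ a) 0 with h0 | h0
      · change θ a ≤ _
        rw [h0]; exact zero_le
      have hlt : θ a / 2 < θ a := ENNReal.half_lt_self h0 (hfin a)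
      have hν0 : volume (Prod.mk a ⁻¹' A) ≠ 0 := by
        intro hz
        have : θ a ≤ θ a / 2 := by
          change eLpNorm (fun t => h (a, t)) ∞ volume ≤ _
          rw [eLpNorm_exponent_top]
          refine essSup_le_of_ae_le _ ?_
          have : ∀ᵐ t ∂(volume : Measure ℝ), t ∉ Prod.mk a ⁻¹' A := measure_eq_zero_iff_ae_notMem.1 hz
          filter_upwards [this] with t ht
          simpa [hA] using ht
        exact absurd this (not_le.2 hlt)
      have hν : volume (Prod.mk a ⁻¹' A) ≠ ∞ := by
        refine ne_top_of_le_ne_top hs (measure_mono fun t ht => ?_)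
        by_contra hts
        have : θ a / 2 < h (a, t) := ht
        rw [hsupp a t hts] at this
        exact absurd this not_lt_zero
      have : (fun t => A.indicator (fun z : α × ℝ => (volume (Prod.mk z.1 ⁻¹' A))⁻¹) (a, t) * h (a, t)) =
          (Prod.mk a ⁻¹' A).indicator fun t => (volume (Prod.mk a ⁻¹' A))⁻¹ * h (a, t) := by
        funext t
        by_cases ht : (a, t) ∈ A
        · rw [Set.indicator_of_mem ht, Set.indicator_of_mem (show t ∈ Prod.mk a ⁻¹' A from ht)]
        · rw [Set.indicator_of_notMem ht, Set.indicator_of_notMem (show t ∉ Prod.mk a ⁻¹' A from ht),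
            zero_mul]
      rw [this, lintegral_indicator (hAs a)]
      change θ a ≤ _
      calc θ a = 2 * (θ a / 2) := (ENNReal.mul_div_cancel (by simp) (by simp)).symm
        _ = 2 * ∫⁻ t in Prod.mk a ⁻¹' A, (volume (Prod.mk a ⁻¹' A))⁻¹ * (θ a / 2) := by
          rw [setLIntegral_const, mul_right_comm, ENNReal.inv_mul_cancel hν0 hν, one_mul]
        _ ≤ _ := by
          gcongr 2 * ?_
          refine setLIntegral_mono' (hAs a) fun t ht => ?_
          have : θ a / 2 < h (a, t) := ht
          gcongr
  have hp0 : p ≠ 0 := by rintro rfl; simp at hpq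
  have hq0 : q ≠ 0 := by rintro rfl; simp at hpq
  have hppos : 0 < p.toReal := ENNReal.toReal_pos hp0 hp
  have hqpos : 0 < q.toReal := ENNReal.toReal_pos hq0 hq
  have hreal : 1 / p.toReal + 1 / q.toReal = 1 := by
    have := congrArg ENNReal.toReal hpq
    rw [ENNReal.toReal_add (by simp [hp0]) (by simp [hq0])] at this
    simpa using this
  have hq1 : 0 ≤ q.toReal - 1 := by
    have h1 : 0 < 1 / p.toReal := by positivity
    have h2 : 1 / q.toReal ≤ 1 := by linarith
    rw [div_le_one hqpos] at h2
    linarith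
  have hmul : (q.toReal - 1) * p.toReal = q.toReal := by
    field_simp at hreal
    linarith
  have hθq : ∀ a, θ a ^ q.toReal = ∫⁻ t, h (a, t) ^ q.toReal := by
    intro a
    simp only [hθ, eLpNorm_eq_lintegral_rpow_enorm_toReal hq0 hq, enorm_eq_self]
    rw [← ENNReal.rpow_mul, one_div_mul_cancel hqpos.ne', ENNReal.rpow_one]
  -- The extremal function in Hölder's inequality, which pairs with `h` to exactly `θ`. Where `θ =
  -- 0` the inverse is `∞`, but there `h = 0` almost everywhere and `0 * ∞ = 0`.
  refine ⟨fun z => (h z * (θ z.1)⁻¹) ^ (q.toReal - 1),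
    (hm.mul (hθm.comp measurable_fst).inv).pow_const _, fun a => ?_, fun a => ?_⟩
  · rcases eq_or_ne (θ a) 0 with h0 | h0
    · have hz : (fun t => h (a, t)) =ᵐ[volume] 0 :=
        (eLpNorm_eq_zero_iff (hm.comp measurable_prodMk_left).aestronglyMeasurable hq0).1 h0
      rw [eLpNorm_eq_lintegral_rpow_enorm_toReal hp0 hp]
      have : ∫⁻ t, ‖(h (a, t) * (θ a)⁻¹) ^ (q.toReal - 1)‖ₑ ^ p.toReal = 0 := by
        rw [← lintegral_zero (μ := (volume : Measure ℝ))]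
        refine lintegral_congr_ae ?_
        filter_upwards [hz] with t ht
        have ht' : h (a, t) = 0 := ht
        rw [enorm_eq_self, ← ENNReal.rpow_mul, hmul, ht', zero_mul, ENNReal.zero_rpow_of_pos hqpos]
      rw [this, ENNReal.zero_rpow_of_pos (by positivity)]
      exact zero_le
    · rw [eLpNorm_eq_lintegral_rpow_enorm_toReal hp0 hp]
      have : ∫⁻ t, ‖(h (a, t) * (θ a)⁻¹) ^ (q.toReal - 1)‖ₑ ^ p.toReal = 1 := by
        simp only [enorm_eq_self, ← ENNReal.rpow_mul, hmul,
          ENNReal.mul_rpow_of_nonneg _ _ hqpos.le]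
        rw [lintegral_mul_const' _ _ (ENNReal.rpow_ne_top_of_nonneg hqpos.le (ENNReal.inv_ne_top.2 h0)),
          ← hθq, ENNReal.inv_rpow, ENNReal.mul_inv_cancel]
        · simp [ENNReal.rpow_eq_zero_iff, hfin a, hθ]
          intro h; exact absurd h h0
        · exact ENNReal.rpow_ne_top_of_nonneg hqpos.le (hfin a)
      rw [this, ENNReal.one_rpow]
  · rcases eq_or_ne (θ a) 0 with h0 | h0
    · change θ a ≤ _
      rw [h0]; exact zero_le
    have hi : (θ a)⁻¹ ≠ ∞ := ENNReal.inv_ne_top.2 h0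
    have hadd : q.toReal = (q.toReal - 1) + 1 := by ring
    have : ∫⁻ t, (h (a, t) * (θ a)⁻¹) ^ (q.toReal - 1) * h (a, t) = θ a := by
      have e : ∀ t, (h (a, t) * (θ a)⁻¹) ^ (q.toReal - 1) * h (a, t) =
          (θ a)⁻¹ ^ (q.toReal - 1) * h (a, t) ^ q.toReal := by
        intro t
        rw [ENNReal.mul_rpow_of_nonneg _ _ hq1, mul_right_comm, mul_comm]
        congr 1
        conv_rhs => rw [hadd, ENNReal.rpow_add_of_nonneg _ _ hq1 zero_le_one, ENNReal.rpow_one]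
      simp only [e]
      rw [lintegral_const_mul' _ _ (ENNReal.rpow_ne_top_of_nonneg hq1 hi), ← hθq]
      conv_lhs => rw [hadd, ENNReal.rpow_add_of_nonneg _ _ hq1 zero_le_one, ENNReal.rpow_one]
      rw [add_sub_cancel_right, ← mul_assoc, ← ENNReal.mul_rpow_of_nonneg _ _ hq1,
        ENNReal.inv_mul_cancel h0 (hfin a), ENNReal.one_rpow, one_mul]
    rw [this]
    exact le_mul_of_one_le_left' (by norm_num)

/-! ### Iterated norms -/

theorem measurable_snoc {n : ℕ} :
    Measurable fun z : (Fin n → ℝ) × ℝ => Fin.snoc (α := fun _ => ℝ) z.1 z.2 := by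
  refine measurable_pi_lambda _ fun i => ?_
  refine Fin.lastCases ?_ (fun j => ?_) i
  · simpa using measurable_snd
  · simpa using! (measurable_pi_apply j).comp measurable_fst

theorem measurable_comp_snoc {n : ℕ} {F : (Fin (n + 1) → ℝ) → ℝ≥0∞} (hF : Measurable F) (t : ℝ) :
    Measurable fun x : Fin n → ℝ => F (Fin.snoc (α := fun _ => ℝ) x t) :=
  hF.comp (measurable_snoc.comp (measurable_id.prodMk measurable_const))

theorem measurePreserving_snoc {n : ℕ} :
    MeasurePreserving (fun z : ℝ × (Fin n → ℝ) => Fin.snoc (α := fun _ => ℝ) z.2 z.1)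
      (volume.prod volume) volume := by
  have h := (volume_preserving_piFinSuccAbove (fun _ : Fin (n + 1) => ℝ) (Fin.last n)).symm
  have e : (fun z : ℝ × (Fin n → ℝ) => Fin.snoc (α := fun _ => ℝ) z.2 z.1) =
      (MeasurableEquiv.piFinSuccAbove (fun _ : Fin (n + 1) => ℝ) (Fin.last n)).symm := by
    funext z
    simp [MeasurableEquiv.piFinSuccAbove]
    rfl
  rw [e]
  exact h

theorem lintegral_snoc {n : ℕ} {F : (Fin (n + 1) → ℝ) → ℝ≥0∞} (hF : Measurable F) :
    ∫⁻ z, F z = ∫⁻ t, ∫⁻ x, F (Fin.snoc (α := fun _ => ℝ) x t) := by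
  rw [← measurePreserving_snoc.lintegral_comp hF]
  exact lintegral_prod _ (hF.comp measurePreserving_snoc.measurable).aemeasurable

theorem ae_ae_snoc {n : ℕ} {P : (Fin (n + 1) → ℝ) → Prop} (h : ∀ᵐ z, P z) :
    ∀ᵐ t : ℝ, ∀ᵐ x : Fin n → ℝ, P (Fin.snoc (α := fun _ => ℝ) x t) :=
  Measure.ae_ae_of_ae_prod (measurePreserving_snoc.quasiMeasurePreserving.ae h)

/-- A null set has null sections at almost every last coordinate, so no measurability is needed.
This is what allows functions to be replaced by measurable representatives in the results below. -/
theorem iteratedNorm_mono_ae : ∀ {n : ℕ} (p : Fin n → ℝ≥0∞) {F G : (Fin n → ℝ) → ℝ≥0∞},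
    (∀ᵐ z, F z ≤ G z) → iteratedNorm n p F ≤ iteratedNorm n p G
  | 0, p, F, G, h => by
    have : ∃ z, F z ≤ G z := h.exists
    obtain ⟨z, hz⟩ := this
    simpa [iteratedNorm, Subsingleton.elim z Fin.elim0] using hz
  | n + 1, p, F, G, h => by
    refine eLpNorm_mono_enorm_ae ?_
    filter_upwards [ae_ae_snoc h] with t ht
    exact iteratedNorm_mono_ae _ ht

theorem iteratedNorm_mono {n : ℕ} (p : Fin n → ℝ≥0∞) {F G : (Fin n → ℝ) → ℝ≥0∞}
    (h : ∀ z, F z ≤ G z) : iteratedNorm n p F ≤ iteratedNorm n p G :=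
  iteratedNorm_mono_ae p (Filter.Eventually.of_forall h)

theorem iteratedNorm_congr_ae {n : ℕ} (p : Fin n → ℝ≥0∞) {F G : (Fin n → ℝ) → ℝ≥0∞}
    (h : F =ᵐ[volume] G) : iteratedNorm n p F = iteratedNorm n p G :=
  le_antisymm (iteratedNorm_mono_ae p h.le) (iteratedNorm_mono_ae p h.symm.le)

/-- The parameter space is arbitrary so that the induction can move the outermost variable into it.
-/
theorem measurable_iteratedNorm_prodMk : ∀ {n : ℕ} {α : Type} [MeasurableSpace α]
    (p : Fin n → ℝ≥0∞) {F : α × (Fin n → ℝ) → ℝ≥0∞}, Measurable F →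
    Measurable fun a => iteratedNorm n p fun x => F (a, x)
  | 0, _, _, p, F, hF => hF.comp measurable_prodMk_right
  | n + 1, α, _, p, F, hF => by
    have h1 : Measurable fun z : (α × ℝ) × (Fin n → ℝ) =>
        F (z.1.1, Fin.snoc (α := fun _ => ℝ) z.2 z.1.2) :=
      hF.comp ((measurable_fst.comp measurable_fst).prodMk
        (measurable_snoc.comp (measurable_snd.prodMk (measurable_snd.comp measurable_fst))))
    exact measurable_eLpNorm_prodMk
      (measurable_iteratedNorm_prodMk (fun i => p i.castSucc) h1) (p (Fin.last n))

theorem measurable_iteratedNorm_snoc {n : ℕ} (p : Fin n → ℝ≥0∞) {F : (Fin (n + 1) → ℝ) → ℝ≥0∞}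
    (hF : Measurable F) :
    Measurable fun t : ℝ => iteratedNorm n p fun x => F (Fin.snoc (α := fun _ => ℝ) x t) :=
  measurable_iteratedNorm_prodMk p (F := fun z : ℝ × (Fin n → ℝ) =>
    F (Fin.snoc (α := fun _ => ℝ) z.2 z.1)) (hF.comp measurePreserving_snoc.measurable)

theorem iteratedNorm_const_mul {a : ℝ≥0∞} (ha : a ≠ ∞) : ∀ {n : ℕ} (p : Fin n → ℝ≥0∞)
    (F : (Fin n → ℝ) → ℝ≥0∞), iteratedNorm n p (fun z => a * F z) = a * iteratedNorm n p F
  | 0, p, F => rfl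
  | n + 1, p, F => by
    simp only [iteratedNorm, iteratedNorm_const_mul ha]
    exact eLpNorm_const_mul_ennreal _ _ ha

theorem iteratedNorm_add_le : ∀ {n : ℕ} (p : Fin n → ℝ≥0∞), (∀ i, 1 ≤ p i) →
    ∀ {F G : (Fin n → ℝ) → ℝ≥0∞}, AEMeasurable F → AEMeasurable G →
    iteratedNorm n p (fun z => F z + G z) ≤ iteratedNorm n p F + iteratedNorm n p G := by
  have main : ∀ {n : ℕ} (p : Fin n → ℝ≥0∞), (∀ i, 1 ≤ p i) →
      ∀ {F G : (Fin n → ℝ) → ℝ≥0∞}, Measurable F → Measurable G →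
      iteratedNorm n p (fun z => F z + G z) ≤ iteratedNorm n p F + iteratedNorm n p G := by
    intro n
    induction n with
    | zero => intro p _ F G _ _; exact le_rfl
    | succ n ih =>
      intro p hp F G hF hG
      calc iteratedNorm (n + 1) p (fun z => F z + G z)
          ≤ eLpNorm ((fun t : ℝ => iteratedNorm n (fun i => p i.castSucc)
              fun x => F (Fin.snoc (α := fun _ => ℝ) x t)) +
              fun t : ℝ => iteratedNorm n (fun i => p i.castSucc)
              fun x => G (Fin.snoc (α := fun _ => ℝ) x t)) (p (Fin.last n)) volume :=
            eLpNorm_mono_enorm fun t => ih (fun i => p i.castSucc) (fun i => hp _)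
              (measurable_comp_snoc hF t) (measurable_comp_snoc hG t)
        _ ≤ _ := eLpNorm_add_le (measurable_iteratedNorm_snoc _ hF).aestronglyMeasurable
            (measurable_iteratedNorm_snoc _ hG).aestronglyMeasurable (hp _)
  intro n p hp F G hF hG
  have h1 : (fun z => F z + G z) =ᵐ[volume] fun z => hF.mk F z + hG.mk G z := by
    filter_upwards [hF.ae_eq_mk, hG.ae_eq_mk] with z h1 h2
    rw [h1, h2]
  rw [iteratedNorm_congr_ae p h1, iteratedNorm_congr_ae p hF.ae_eq_mk,
    iteratedNorm_congr_ae p hG.ae_eq_mk]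
  exact main p hp hF.measurable_mk hG.measurable_mk

theorem ae_eq_zero_of_iteratedNorm_eq_zero {n : ℕ} (p : Fin n → ℝ≥0∞) (hp : ∀ i, p i ≠ 0)
    {F : (Fin n → ℝ) → ℝ≥0∞} (hF : AEMeasurable F) (h : iteratedNorm n p F = 0) :
    F =ᵐ[volume] 0 := by
  have main : ∀ {n : ℕ} (p : Fin n → ℝ≥0∞), (∀ i, p i ≠ 0) → ∀ {F : (Fin n → ℝ) → ℝ≥0∞},
      Measurable F → iteratedNorm n p F = 0 → ∫⁻ z, F z = 0 := by
    intro n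
    induction n with
    | zero =>
      intro p _ F _ h
      have : F = 0 := by
        funext z
        rw [Subsingleton.elim z Fin.elim0]
        exact h
      simp [this]
    | succ n ih =>
      intro p hp F hF h
      have h1 := (eLpNorm_eq_zero_iff (measurable_iteratedNorm_snoc _ hF).aestronglyMeasurable
        (hp _)).1 h
      rw [lintegral_snoc hF, ← lintegral_zero (μ := (volume : Measure ℝ))]
      refine lintegral_congr_ae ?_
      filter_upwards [h1] with t ht
      exact ih _ (fun i => hp _) (measurable_comp_snoc hF t) ht
  rw [iteratedNorm_congr_ae p hF.ae_eq_mk] at h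
  have := main p hp hF.measurable_mk h
  rw [lintegral_eq_zero_iff hF.measurable_mk] at this
  exact hF.ae_eq_mk.trans this

theorem iteratedNorm_liminf_le : ∀ {n : ℕ} (p : Fin n → ℝ≥0∞) (F : ℕ → (Fin n → ℝ) → ℝ≥0∞),
    (∀ k, AEMeasurable (F k)) →
    iteratedNorm n p (fun z => Filter.liminf (fun k => F k z) Filter.atTop) ≤
      Filter.liminf (fun k => iteratedNorm n p (F k)) Filter.atTop := by
  have main : ∀ {n : ℕ} (p : Fin n → ℝ≥0∞) (F : ℕ → (Fin n → ℝ) → ℝ≥0∞),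
      (∀ k, Measurable (F k)) →
      iteratedNorm n p (fun z => Filter.liminf (fun k => F k z) Filter.atTop) ≤
        Filter.liminf (fun k => iteratedNorm n p (F k)) Filter.atTop := by
    intro n
    induction n with
    | zero => intro p F _; exact le_rfl
    | succ n ih =>
      intro p F hF
      exact (eLpNorm_mono_enorm fun t => ih (fun i => p i.castSucc) _
        fun k => measurable_comp_snoc (hF k) t).trans
        (eLpNorm_liminf_le _ (fun k => measurable_iteratedNorm_snoc _ (hF k)) _)
  intro n p F hF
  have h1 : (fun z => Filter.liminf (fun k => F k z) Filter.atTop) =ᵐ[volume]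
      fun z => Filter.liminf (fun k => (hF k).mk (F k) z) Filter.atTop := by
    filter_upwards [ae_all_iff.2 fun k => (hF k).ae_eq_mk] with z hz
    simp only [hz]
  rw [iteratedNorm_congr_ae p h1]
  simp only [fun k => iteratedNorm_congr_ae p (hF k).ae_eq_mk]
  exact main p _ fun k => (hF k).measurable_mk

/-- The form of Fatou's lemma that removes truncations in the converse of Hölder's inequality and
passes to the limit of a Cauchy sequence in the proof of completeness. -/
theorem iteratedNorm_le_of_tendsto {n : ℕ} (p : Fin n → ℝ≥0∞) {F : ℕ → (Fin n → ℝ) → ℝ≥0∞}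
    {G : (Fin n → ℝ) → ℝ≥0∞} (hF : ∀ k, AEMeasurable (F k))
    (hlim : ∀ z, Filter.Tendsto (fun k => F k z) Filter.atTop (nhds (G z))) {A : ℝ≥0∞}
    (hA : ∀ᶠ k in Filter.atTop, iteratedNorm n p (F k) ≤ A) : iteratedNorm n p G ≤ A := by
  have h1 : G = fun z => Filter.liminf (fun k => F k z) Filter.atTop :=
    funext fun z => (hlim z).liminf_eq.symm
  rw [h1]
  refine (iteratedNorm_liminf_le p F hF).trans ?_
  exact Filter.liminf_le_of_frequently_le' hA.frequently

theorem lintegral_mul_le_iteratedNorm {n : ℕ} {p q : Fin n → ℝ≥0∞}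
    (hpq : ∀ i, 1 / p i + 1 / q i = 1) {F G : (Fin n → ℝ) → ℝ≥0∞} (hF : AEMeasurable F)
    (hG : AEMeasurable G) : ∫⁻ z, F z * G z ≤ iteratedNorm n p F * iteratedNorm n q G := by
  have main : ∀ {n : ℕ} {p q : Fin n → ℝ≥0∞}, (∀ i, 1 / p i + 1 / q i = 1) →
      ∀ {F G : (Fin n → ℝ) → ℝ≥0∞}, Measurable F → Measurable G →
      ∫⁻ z, F z * G z ≤ iteratedNorm n p F * iteratedNorm n q G := by
    intro n
    induction n with
    | zero =>
      intro p q _ F G _ _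
      have e : (fun z => F z * G z) = fun _ => F Fin.elim0 * G Fin.elim0 := by
        funext z
        rw [Subsingleton.elim z Fin.elim0]
      rw [e, lintegral_const]
      simp [iteratedNorm, volume_pi]
    | succ n ih =>
      intro p q hpq F G hF hG
      rw [lintegral_snoc (F := fun z => F z * G z) (hF.mul hG)]
      calc _ ≤ ∫⁻ t : ℝ, iteratedNorm n (fun i => p i.castSucc)
              (fun x => F (Fin.snoc (α := fun _ => ℝ) x t)) *
            iteratedNorm n (fun i => q i.castSucc)
              (fun x => G (Fin.snoc (α := fun _ => ℝ) x t)) :=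
            lintegral_mono fun t => ih (fun i => hpq _) (measurable_comp_snoc hF t)
              (measurable_comp_snoc hG t)
        _ ≤ _ := lintegral_mul_le_eLpNorm_mul_eLpNorm (hpq _)
            (measurable_iteratedNorm_snoc _ hF).aemeasurable
            (measurable_iteratedNorm_snoc _ hG).aemeasurable
  have h1 : (fun z => F z * G z) =ᵐ[volume] fun z => hF.mk F z * hG.mk G z := by
    filter_upwards [hF.ae_eq_mk, hG.ae_eq_mk] with z h1 h2
    rw [h1, h2]
  rw [lintegral_congr_ae h1, iteratedNorm_congr_ae p hF.ae_eq_mk,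
    iteratedNorm_congr_ae q hG.ae_eq_mk]
  exact main hpq hF.measurable_mk hG.measurable_mk

theorem iteratedNorm_comp_sub : ∀ {n : ℕ} (p : Fin n → ℝ≥0∞) (F : (Fin n → ℝ) → ℝ≥0∞)
    (y : Fin n → ℝ), iteratedNorm n p (fun z => F (z - y)) = iteratedNorm n p F
  | 0, p, F, y => by simp [iteratedNorm, Subsingleton.elim _ (Fin.elim0 : Fin 0 → ℝ)]
  | n + 1, p, F, y => by
    have h1 : ∀ (x : Fin n → ℝ) (t : ℝ), Fin.snoc (α := fun _ => ℝ) x t - y =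
        Fin.snoc (α := fun _ => ℝ) (x - fun i => y i.castSucc) (t - y (Fin.last n)) := by
      intro x t
      funext i
      refine Fin.lastCases ?_ (fun j => ?_) i <;> simp
    simp only [iteratedNorm, h1]
    have h2 : ∀ t : ℝ, iteratedNorm n (fun i => p i.castSucc)
        (fun x => F (Fin.snoc (α := fun _ => ℝ) (x - fun i => y i.castSucc) (t - y (Fin.last n)))) =
        iteratedNorm n (fun i => p i.castSucc)
          (fun x => F (Fin.snoc (α := fun _ => ℝ) x (t - y (Fin.last n)))) := fun t =>
      iteratedNorm_comp_sub (fun i => p i.castSucc)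
        (fun x => F (Fin.snoc (α := fun _ => ℝ) x (t - y (Fin.last n)))) (fun i => y i.castSucc)
    simp only [h2]
    have h3 := (MeasurableEquiv.subRight (y (Fin.last n))).measurableEmbedding.eLpNorm_map_measure
      (μ := volume) (p := p (Fin.last n)) (g := fun t => iteratedNorm n (fun i => p i.castSucc)
          (fun x => F (Fin.snoc (α := fun _ => ℝ) x t)))
    rw [show Measure.map (MeasurableEquiv.subRight (y (Fin.last n))) volume = volume from
      (measurePreserving_sub_right volume (y (Fin.last n))).map_eq] at h3
    exact h3.symm

/-- Dominated convergence for iterated norms with finite exponents. -/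
theorem tendsto_iteratedNorm_zero_of_dominated {n : ℕ} (p : Fin n → ℝ≥0∞)
    (hp : ∀ i, p i ≠ 0 ∧ p i ≠ ∞) {F : ℕ → (Fin n → ℝ) → ℝ≥0∞} {H : (Fin n → ℝ) → ℝ≥0∞}
    (hF : ∀ k, Measurable (F k)) (hH : Measurable H) (hle : ∀ k z, F k z ≤ H z)
    (hfin : iteratedNorm n p H ≠ ∞)
    (hlim : ∀ z, Filter.Tendsto (fun k => F k z) Filter.atTop (nhds 0)) :
    Filter.Tendsto (fun k => iteratedNorm n p (F k)) Filter.atTop (nhds 0) := by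
  induction n with
  | zero => exact hlim _
  | succ n ih =>
    refine tendsto_eLpNorm_zero_of_dominated (hp _).1 (hp _).2
      (H := fun t : ℝ => iteratedNorm n (fun i => p i.castSucc)
        fun x => H (Fin.snoc (α := fun _ => ℝ) x t))
      (fun k => measurable_iteratedNorm_snoc _ (hF k))
      (fun k t => iteratedNorm_mono _ fun x => hle k _) hfin ?_
    -- The outer exponent is finite, so the inner norm of the majorant is finite for almost every
    -- `t`, and the induction hypothesis applies to those sections.
    have h1 : ∀ᵐ t : ℝ, iteratedNorm n (fun i => p i.castSucc)
        (fun x => H (Fin.snoc (α := fun _ => ℝ) x t)) < ∞ := by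
      have hpos : 0 < (p (Fin.last n)).toReal := ENNReal.toReal_pos (hp _).1 (hp _).2
      have h2 : eLpNorm _ _ _ ≠ ∞ := hfin
      rw [eLpNorm_eq_lintegral_rpow_enorm_toReal (hp _).1 (hp _).2] at h2
      have h3 : ∫⁻ t : ℝ, iteratedNorm n (fun i => p i.castSucc)
        (fun x => H (Fin.snoc (α := fun _ => ℝ) x t)) ^ (p (Fin.last n)).toReal ≠ ∞ := by
        intro h
        simp only [enorm_eq_self] at h2
        rw [h, ENNReal.top_rpow_of_pos (by positivity)] at h2
        exact h2 rfl
      filter_upwards [ae_lt_top ((measurable_iteratedNorm_snoc _ hH).pow_const _) h3] with t ht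
      exact (ENNReal.rpow_lt_top_iff_of_pos hpos).1 ht
    filter_upwards [h1] with t ht
    exact ih (fun i => p i.castSucc) (fun i => hp _) (fun k => measurable_comp_snoc (hF k) t)
      (measurable_comp_snoc hH t) (fun k x => hle k _) ht.ne (fun x => hlim _)

/-! ### The converse of Hölder's inequality, and Minkowski's integral inequality -/

theorem iteratedNorm_zero {n : ℕ} (p : Fin n → ℝ≥0∞) : iteratedNorm n p (fun _ => 0) = 0 := by
  simpa using iteratedNorm_const_mul (a := 0) (by simp) p (fun _ => 0)

/-- The factor may be `∞`, a value that norming functions can take on null sets; then `∞ * 0 = 0`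
has to be respected when the norm vanishes. -/
theorem iteratedNorm_const_mul_le {n : ℕ} {p : Fin n → ℝ≥0∞} (hp : ∀ i, p i ≠ 0) (a : ℝ≥0∞)
    {F : (Fin n → ℝ) → ℝ≥0∞} (hF : AEMeasurable F) :
    iteratedNorm n p (fun z => a * F z) ≤ a * iteratedNorm n p F := by
  rcases eq_or_ne a ∞ with rfl | ha
  · rcases eq_or_ne (iteratedNorm n p F) 0 with h0 | h0
    · have h1 : (fun z => ∞ * F z) =ᵐ[volume] fun _ => 0 := by
        filter_upwards [ae_eq_zero_of_iteratedNorm_eq_zero p hp hF h0] with z hz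
        have hz' : F z = 0 := hz
        simp [hz']
      rw [iteratedNorm_congr_ae p h1, iteratedNorm_zero]
      exact zero_le
    · rw [ENNReal.top_mul h0]
      exact le_top
  · exact (iteratedNorm_const_mul ha p F).le

/-- Supplies, for all exponents including `∞`, the finiteness under which one-variable norming
functions are available. -/
theorem exists_iteratedNorm_le_of_bounded : ∀ {n : ℕ} (p : Fin n → ℝ≥0∞) (R : ℝ) {M : ℝ≥0∞},
    M ≠ ∞ → ∃ C : ℝ≥0∞, C ≠ ∞ ∧ ∀ G : (Fin n → ℝ) → ℝ≥0∞, (∀ x, G x ≤ M) →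
      (∀ x, (∃ i, x i ∉ Set.Icc (-R) R) → G x = 0) → iteratedNorm n p G ≤ C
  | 0, p, R, M, hM => ⟨M, hM, fun G hG _ => hG _⟩
  | n + 1, p, R, M, hM => by
    obtain ⟨C, hC, h⟩ := exists_iteratedNorm_le_of_bounded (fun i => p i.castSucc) R hM
    refine ⟨_, ?_, fun G hG hs => (eLpNorm_mono_enorm
      (g := (Set.Icc (-R) R).indicator fun _ : ℝ => C) fun t => ?_).trans
      (eLpNorm_indicator_const_le C (p (Fin.last n)))⟩
    · refine ENNReal.mul_ne_top (by simpa using hC) (ENNReal.rpow_ne_top_of_nonneg (by positivity) ?_)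
      simp
    · simp only [enorm_eq_self]
      by_cases ht : t ∈ Set.Icc (-R) R
      · rw [Set.indicator_of_mem ht]
        refine h _ (fun x => hG _) fun x ⟨i, hi⟩ => hs _ ⟨i.castSucc, by simpa using hi⟩
      · have : (fun x => G (Fin.snoc (α := fun _ => ℝ) x t)) = fun _ => 0 :=
          funext fun x => hs _ ⟨Fin.last n, by simpa using ht⟩
        rw [this, iteratedNorm_zero]
        exact zero_le

/-- Induction on the number of variables. With the last variable `t` treated as a parameter, take a
norming function `F₁` for the inner variables and a one-variable norming function `k` for the inner
norm as a function of `t`; then `k * F₁` works. Each variable costs a factor 2, and the parameter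
keeps the choice measurable. -/
theorem exists_measurable_norming_iteratedNorm : ∀ {n : ℕ} {α : Type} [MeasurableSpace α]
    {p q : Fin n → ℝ≥0∞}, (∀ i, 1 / p i + 1 / q i = 1) → ∀ {G : α × (Fin n → ℝ) → ℝ≥0∞},
    Measurable G → ∀ {R : ℝ} {M : ℝ≥0∞}, M ≠ ∞ → (∀ z, G z ≤ M) →
    (∀ a x, (∃ i, x i ∉ Set.Icc (-R) R) → G (a, x) = 0) →
    ∃ F : α × (Fin n → ℝ) → ℝ≥0∞, Measurable F ∧ (∀ a, iteratedNorm n p (fun x => F (a, x)) ≤ 1) ∧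
      ∀ a, iteratedNorm n q (fun x => G (a, x)) ≤ 2 ^ n * ∫⁻ x, F (a, x) * G (a, x) := by
  intro n
  induction n with
  | zero =>
    intro α _ p q _ G hG R M hM hGM hs
    refine ⟨fun _ => 1, measurable_const, fun a => le_rfl, fun a => ?_⟩
    have e : (fun z => 1 * G (a, z)) = fun _ => G (a, Fin.elim0) := by
      funext z
      rw [Subsingleton.elim z Fin.elim0, one_mul]
    rw [e, lintegral_const]
    simp [iteratedNorm, volume_pi]
  | succ n ih =>
    intro α _ p q hpq G hG R M hM hGM hs
    have hp0 : ∀ i, p i ≠ 0 := fun i h => by have := hpq i; simp [h] at this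
    set G' : (α × ℝ) × (Fin n → ℝ) → ℝ≥0∞ :=
      fun z => G (z.1.1, Fin.snoc (α := fun _ => ℝ) z.2 z.1.2) with hG'
    have hG'm : Measurable G' :=
      hG.comp ((measurable_fst.comp measurable_fst).prodMk
        (measurable_snoc.comp (measurable_snd.prodMk (measurable_snd.comp measurable_fst))))
    have hG's : ∀ a x, (∃ i, x i ∉ Set.Icc (-R) R) → G' (a, x) = 0 := fun a x ⟨i, hi⟩ =>
      hs _ _ ⟨i.castSucc, by simpa using hi⟩
    obtain ⟨F₁, hF₁m, hF₁, hG₁⟩ := ih (p := fun i => p i.castSucc) (q := fun i => q i.castSucc)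
      (fun i => hpq _) hG'm hM (fun z => hGM _) hG's
    set h : α × ℝ → ℝ≥0∞ := fun b => iteratedNorm n (fun i => q i.castSucc) fun x => G' (b, x) with hh
    have hhm : Measurable h := measurable_iteratedNorm_prodMk _ hG'm
    obtain ⟨C, hC, hbound⟩ := exists_iteratedNorm_le_of_bounded q R hM
    obtain ⟨k, hkm, hk, hkh⟩ := exists_measurable_norming (hpq (Fin.last n)) hhm
      (s := Set.Icc (-R) R) (by simp) (fun a t ht => by
        have : (fun x => G' ((a, t), x)) = fun _ => 0 :=
          funext fun x => hs _ _ ⟨Fin.last n, by simpa using ht⟩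
        simp only [hh, this, iteratedNorm_zero])
      (fun a => ne_top_of_le_ne_top hC (hbound (fun x => G (a, x)) (fun x => hGM _) (hs a)))
    have hlast : Measurable fun z : α × (Fin (n + 1) → ℝ) => (z.1, z.2 (Fin.last n)) :=
      measurable_fst.prodMk ((measurable_pi_apply _).comp measurable_snd)
    have hinit : Measurable fun z : α × (Fin (n + 1) → ℝ) => fun i : Fin n => z.2 i.castSucc :=
      measurable_pi_lambda _ fun i => (measurable_pi_apply _).comp measurable_snd
    have hFm : Measurable fun z : α × (Fin (n + 1) → ℝ) => k (z.1, z.2 (Fin.last n)) *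
        F₁ ((z.1, z.2 (Fin.last n)), fun i => z.2 i.castSucc) :=
      (hkm.comp hlast).mul (hF₁m.comp (hlast.prodMk hinit))
    refine ⟨_, hFm, fun a => ?_, fun a => ?_⟩
    · refine le_trans (eLpNorm_mono_enorm fun t => ?_) (hk a)
      simp only [enorm_eq_self, Fin.snoc_last, Fin.snoc_castSucc]
      refine (iteratedNorm_const_mul_le (fun i => hp0 _) _
        (hF₁m.comp measurable_prodMk_left).aemeasurable).trans ?_
      exact mul_le_of_le_one_right' (hF₁ _)
    · have hFG : Measurable fun x : Fin (n + 1) → ℝ => k (a, x (Fin.last n)) *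
          F₁ ((a, x (Fin.last n)), fun i => x i.castSucc) * G (a, x) :=
        (hFm.mul hG).comp measurable_prodMk_left
      rw [lintegral_snoc hFG]
      simp only [Fin.snoc_last, Fin.snoc_castSucc, mul_assoc]
      calc iteratedNorm (n + 1) q (fun x => G (a, x)) ≤ 2 * ∫⁻ t, k (a, t) * h (a, t) := hkh a
        _ ≤ 2 * ∫⁻ t, k (a, t) * (2 ^ n * ∫⁻ x, F₁ ((a, t), x) * G' ((a, t), x)) := by
          gcongr with t
          exact hG₁ _
        _ = 2 ^ (n + 1) * ∫⁻ t, k (a, t) * ∫⁻ x, F₁ ((a, t), x) * G' ((a, t), x) := by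
          simp only [mul_left_comm _ ((2 : ℝ≥0∞) ^ n) _]
          rw [lintegral_const_mul' _ _ (by simp), pow_succ', mul_assoc]
        _ = _ := by
          congr 1
          refine lintegral_congr fun t => ?_
          rw [lintegral_const_mul]
          exact (show Measurable fun x => F₁ ((a, t), x) from hF₁m.comp measurable_prodMk_left).mul
            (show Measurable fun x => G' ((a, t), x) from hG'm.comp measurable_prodMk_left)

/-- The converse of Hölder's inequality: it is enough to test against bounded functions supported
in a box. -/
theorem iteratedNorm_le_of_forall_lintegral_le {n : ℕ} {p q : Fin n → ℝ≥0∞}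
    (hpq : ∀ i, 1 / p i + 1 / q i = 1) {G : (Fin n → ℝ) → ℝ≥0∞} (hG : AEMeasurable G) {A : ℝ≥0∞}
    (hA : ∀ F : (Fin n → ℝ) → ℝ≥0∞, Measurable F → ∀ k : ℕ, (∀ x, F x ≤ k) →
      (∀ x, (∃ i, x i ∉ Set.Icc (-k : ℝ) k) → F x = 0) → iteratedNorm n p F ≤ 1 →
      ∫⁻ x, F x * G x ≤ A) :
    iteratedNorm n q G ≤ 2 ^ n * A := by
  wlog hGm : Measurable G generalizing G
  · rw [iteratedNorm_congr_ae q hG.ae_eq_mk]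
    refine this hG.measurable_mk.aemeasurable (fun F hF k h1 h2 h3 => ?_) hG.measurable_mk
    refine le_trans (le_of_eq ?_) (hA F hF k h1 h2 h3)
    refine lintegral_congr_ae ?_
    filter_upwards [hG.ae_eq_mk] with x hx
    rw [hx]
  set box : ℕ → Set (Fin n → ℝ) := fun k => Set.univ.pi fun _ => Set.Icc (-k : ℝ) k with hbox
  have hboxm : ∀ k, MeasurableSet (box k) := fun k =>
    MeasurableSet.univ_pi fun _ => measurableSet_Icc
  have hmem : ∀ x, ∀ᶠ k : ℕ in Filter.atTop, x ∈ box k := by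
    intro x
    obtain ⟨k₀, hk₀⟩ := exists_nat_ge ‖x‖
    filter_upwards [Filter.eventually_ge_atTop k₀] with k hk i _
    have h1 : |x i| ≤ ‖x‖ := norm_le_pi_norm x i
    have h2 : (k₀ : ℝ) ≤ k := by exact_mod_cast hk
    exact abs_le.1 (h1.trans (hk₀.trans h2))
  have hnot : ∀ (k : ℕ) x, (∃ i, x i ∉ Set.Icc (-k : ℝ) k) → x ∉ box k := fun k x ⟨i, hi⟩ h =>
    hi (h i trivial)
  have htrunc : ∀ f : (Fin n → ℝ) → ℝ≥0∞, ∀ x, Filter.Tendsto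
      (fun k : ℕ => (box k).indicator (fun x => min (f x) k) x) Filter.atTop (nhds (f x)) := by
    intro f x
    have h1 : Filter.Tendsto (fun k : ℕ => min (f x) k) Filter.atTop (nhds (min (f x) ∞)) :=
      tendsto_const_nhds.min ENNReal.tendsto_nat_nhds_top
    rw [min_eq_left le_top] at h1
    refine h1.congr' ?_
    filter_upwards [hmem x] with k hk
    rw [Set.indicator_of_mem hk]
  refine iteratedNorm_le_of_tendsto q
    (F := fun k : ℕ => (box k).indicator fun x => min (G x) k)
    (fun k => ((hGm.min measurable_const).indicator (hboxm k)).aemeasurable) (htrunc G)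
    (Filter.Eventually.of_forall fun k => ?_)
  obtain ⟨F, hFm, hF, hFG⟩ := exists_measurable_norming_iteratedNorm (α := Unit) hpq
    (G := fun z => (box k).indicator (fun x => min (G x) k) z.2)
    (((hGm.min measurable_const).indicator (hboxm k)).comp measurable_snd) (R := k) (M := k)
    (by simp) (fun z => Set.indicator_le (fun x _ => min_le_right _ _) _ |>.trans le_rfl)
    (fun a x hx => Set.indicator_of_notMem (hnot k x hx) _)
  refine (hFG ()).trans ?_
  gcongr 2 ^ n * ?_
  have hFum : Measurable fun x => F ((), x) := hFm.comp measurable_prodMk_left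
  calc ∫⁻ x, F ((), x) * (box k).indicator (fun x => min (G x) k) x ≤ ∫⁻ x, F ((), x) * G x := by
        gcongr with x
        exact Set.indicator_le (fun x _ => min_le_left _ _) _
    -- The norming function need be neither bounded nor supported in a box, so it is truncated too
    -- before the hypothesis is applied.
    _ = ∫⁻ x, Filter.liminf (fun m : ℕ => (box m).indicator (fun x => min (F ((), x)) m) x * G x)
          Filter.atTop := by
        refine lintegral_congr fun x => ?_
        -- Multiplication by `∞` is not continuous at 0, so the points where `G = ∞` are treated
        -- separately.
        rcases eq_or_ne (G x) ∞ with h | h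
        · rcases eq_or_ne (F ((), x)) 0 with h0 | h0
          · have : ∀ m : ℕ, (box m).indicator (fun x => min (F ((), x)) (m : ℝ≥0∞)) x = 0 := fun m =>
              Set.indicator_apply_eq_zero.2 fun _ => by simp [h0]
            simp [h0, this]
          · rw [h, ENNReal.mul_top h0]
            refine (Filter.Tendsto.liminf_eq ?_).symm
            refine tendsto_const_nhds.congr' ?_
            filter_upwards [(htrunc (fun x => F ((), x)) x).eventually_ne h0] with m hm
            rw [ENNReal.mul_top hm]
        · exact (ENNReal.Tendsto.mul_const (htrunc (fun x => F ((), x)) x) (Or.inr h)).liminf_eq.symm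
    _ ≤ Filter.liminf (fun m : ℕ => ∫⁻ x, (box m).indicator (fun x => min (F ((), x)) m) x * G x)
          Filter.atTop :=
        lintegral_liminf_le fun m => ((hFum.min measurable_const).indicator (hboxm m)).mul hGm
    _ ≤ A := by
        refine Filter.liminf_le_of_frequently_le' (Filter.Frequently.of_forall fun m => ?_)
        refine hA _ ((hFum.min measurable_const).indicator (hboxm m)) m
          (fun x => Set.indicator_le (fun x _ => min_le_right _ _) _ |>.trans le_rfl)
          (fun x hx => Set.indicator_of_notMem (hnot m x hx) _) ?_
        exact (iteratedNorm_mono p fun x => Set.indicator_le (fun x _ => min_le_left _ _) _).trans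
          (hF ())

theorem exists_holderConjugate {p : ℝ≥0∞} (hp : 1 ≤ p) : ∃ q : ℝ≥0∞, 1 ≤ q ∧ 1 / q + 1 / p = 1 := by
  refine ⟨(1 - p⁻¹)⁻¹, ENNReal.one_le_inv.2 tsub_le_self, ?_⟩
  rw [one_div, one_div, inv_inv]
  exact tsub_add_cancel_of_le (ENNReal.inv_le_one.2 hp)

/-- Minkowski's integral inequality for iterated norms, up to a constant. -/
theorem iteratedNorm_lintegral_le {n : ℕ} {p : Fin n → ℝ≥0∞} (hp : ∀ i, 1 ≤ p i) {β : Type*}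
    [MeasurableSpace β] {ν : Measure β} [SFinite ν] {H : β → (Fin n → ℝ) → ℝ≥0∞}
    (hH : Measurable (Function.uncurry H)) :
    iteratedNorm n p (fun x => ∫⁻ y, H y x ∂ν) ≤ 2 ^ n * ∫⁻ y, iteratedNorm n p (H y) ∂ν := by
  choose q hq1 hq using fun i => exists_holderConjugate (hp i)
  -- Duality: Tonelli's theorem moves the test function inside, and Hölder's inequality bounds each
  -- slice. The factor `2 ^ n` is that of the converse of Hölder's inequality.
  refine iteratedNorm_le_of_forall_lintegral_le hq
    (Measurable.lintegral_prod_left hH).aemeasurable fun F hF k _ _ hF1 => ?_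
  calc ∫⁻ x, F x * ∫⁻ y, H y x ∂ν = ∫⁻ x, ∫⁻ y, F x * H y x ∂ν := by
        refine lintegral_congr fun x => ?_
        rw [lintegral_const_mul]
        exact hH.comp measurable_prodMk_right
    _ = ∫⁻ y, (∫⁻ x, F x * H y x) ∂ν := by
        refine lintegral_lintegral_swap ?_
        exact ((hF.comp measurable_fst).mul (hH.comp measurable_swap)).aemeasurable
    _ ≤ ∫⁻ y, iteratedNorm n p (H y) ∂ν := by
        refine lintegral_mono fun y => ?_
        refine (lintegral_mul_le_iteratedNorm hq hF.aemeasurable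
          (hH.comp measurable_prodMk_left).aemeasurable).trans ?_
        exact mul_le_of_le_one_left' hF1

/-- Young's inequality for iterated norms, up to a constant. -/
theorem iteratedNorm_convolution_le {n : ℕ} {p : Fin n → ℝ≥0∞} (hp : ∀ i, 1 ≤ p i)
    {H K : (Fin n → ℝ) → ℝ≥0∞} (hH : AEMeasurable H) (hK : Measurable K) :
    iteratedNorm n p (fun u => ∫⁻ z, H z * K (u - z)) ≤
      2 ^ n * (∫⁻ y, K y) * iteratedNorm n p H := by
  have hp0 : ∀ i, p i ≠ 0 := fun i h => by have := hp i; simp [h] at this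
  wlog hHm : Measurable H generalizing H
  · rw [iteratedNorm_congr_ae p hH.ae_eq_mk]
    refine le_trans (le_of_eq ?_) (this hH.measurable_mk.aemeasurable hH.measurable_mk)
    congr 1
    funext u
    refine lintegral_congr_ae ?_
    filter_upwards [hH.ae_eq_mk] with x hx
    rw [hx]
  -- The convolution becomes a superposition of translates of `H`, all of the same norm, to which
  -- Minkowski's inequality applies.
  have h1 : ∀ u, ∫⁻ z, H z * K (u - z) = ∫⁻ y, K y * H (u - y) := by
    intro u
    rw [← lintegral_sub_left_eq_self (fun y => K y * H (u - y)) u]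
    refine lintegral_congr fun z => ?_
    rw [sub_sub_cancel, mul_comm]
  simp only [h1]
  refine (iteratedNorm_lintegral_le hp (H := fun y u => K y * H (u - y)) ?_).trans ?_
  · exact (hK.comp measurable_fst).mul (hHm.comp (measurable_snd.sub measurable_fst))
  · rw [mul_assoc, ← lintegral_mul_const _ hK]
    gcongr 2 ^ n * ?_
    refine lintegral_mono fun y => ?_
    refine (iteratedNorm_const_mul_le hp0 (K y)
      (hHm.comp (measurable_id.sub_const y)).aemeasurable).trans (le_of_eq ?_)
    exact congrArg (K y * ·) (iteratedNorm_comp_sub p H y)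

/-! ### Finiteness of mixed norms of polynomially decaying functions. -/

theorem iteratedNorm_prod : ∀ {n : ℕ} (p : Fin n → ℝ≥0∞) {g : ℝ → ℝ≥0∞}, (∀ t, g t ≠ ∞) →
    (∀ i, eLpNorm g (p i) volume ≠ ∞) → iteratedNorm n p (fun x => ∏ i, g (x i)) ≠ ∞
  | 0, p, g, _, _ => by simp [iteratedNorm]
  | n + 1, p, g, hg, hfin => by
    have ih := iteratedNorm_prod (fun i => p i.castSucc) hg fun i => hfin _
    have : iteratedNorm (n + 1) p (fun x => ∏ i, g (x i)) =
        iteratedNorm n (fun i => p i.castSucc) (fun x => ∏ i, g (x i)) *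
          eLpNorm g (p (Fin.last n)) volume := by
      rw [← eLpNorm_const_mul_ennreal _ _ ih]
      refine congrArg (fun f => eLpNorm f (p (Fin.last n)) volume) (funext fun t => ?_)
      rw [mul_comm, ← iteratedNorm_const_mul (hg t)]
      congr 1
      funext x
      change ∏ i, g (Fin.snoc (α := fun _ => ℝ) x t i) = _
      rw [Fin.prod_univ_castSucc, mul_comm]
      simp
    rw [this]
    exact ENNReal.mul_ne_top ih (hfin _)

/-- The function is integrable and bounded by 1, hence lies in every `L^p` with `p ≥ 1`. -/
theorem eLpNorm_one_add_abs_ne_top {p : ℝ≥0∞} (hp : 1 ≤ p) :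
    eLpNorm (fun t : ℝ => ENNReal.ofReal ((1 + |t|) ^ (-2 : ℝ))) p volume ≠ ∞ := by
  have hp0 : p ≠ 0 := by rintro rfl; simp at hp
  have hle : ∀ t : ℝ, ENNReal.ofReal ((1 + |t|) ^ (-2 : ℝ)) ≤ 1 := by
    intro t
    rw [ENNReal.ofReal_le_one]
    exact Real.rpow_le_one_of_one_le_of_nonpos (by linarith [abs_nonneg t]) (by norm_num)
  rcases eq_or_ne p ∞ with rfl | hpt
  · rw [eLpNorm_exponent_top]
    refine ne_top_of_le_ne_top ENNReal.one_ne_top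
      (essSup_le_of_ae_le 1 (Filter.Eventually.of_forall fun t => ?_))
    simpa using hle t
  · have hpos : 0 < p.toReal := ENNReal.toReal_pos hp0 hpt
    have hp1 : 1 ≤ p.toReal := by simpa using ENNReal.toReal_mono hpt hp
    rw [eLpNorm_eq_lintegral_rpow_enorm_toReal hp0 hpt]
    refine ENNReal.rpow_ne_top_of_nonneg (by positivity) ?_
    refine ne_top_of_le_ne_top (finite_integral_one_add_norm (E := ℝ) (μ := volume) (r := 2)
      (by simp)).ne (lintegral_mono fun t => ?_)
    simp only [enorm_eq_self, Real.norm_eq_abs]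
    exact ENNReal.rpow_le_self_of_le_one (hle t) hp1

/-- `(1 + ‖z‖) ^ (-2n)` has finite iterated norms for all exponents. -/
theorem iteratedNorm_one_add_norm_ne_top {n : ℕ} {p : Fin n → ℝ≥0∞} (hp : ∀ i, 1 ≤ p i) {r : ℝ}
    (hr : 2 * n ≤ r) :
    iteratedNorm n p (fun z => ENNReal.ofReal ((1 + ‖z‖) ^ (-r))) ≠ ∞ := by
  refine ne_top_of_le_ne_top (iteratedNorm_prod p
    (g := fun t : ℝ => ENNReal.ofReal ((1 + |t|) ^ (-2 : ℝ))) (fun t => ENNReal.ofReal_ne_top)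
    fun i => eLpNorm_one_add_abs_ne_top (hp i)) (iteratedNorm_mono p fun z => ?_)
  rw [← ENNReal.ofReal_prod_of_nonneg fun i _ => by positivity]
  refine ENNReal.ofReal_le_ofReal ?_
  have h1 : (1 : ℝ) ≤ 1 + ‖z‖ := by linarith [norm_nonneg z]
  -- Two powers of decay are spent on each coordinate; the sup norm dominates every `|z i|`.
  calc (1 + ‖z‖) ^ (-r) ≤ (1 + ‖z‖) ^ (-2 * n : ℝ) :=
        Real.rpow_le_rpow_of_exponent_le h1 (by linarith)
    _ = ∏ i : Fin n, (1 + ‖z‖) ^ (-2 : ℝ) := by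
        rw [Finset.prod_const, Finset.card_univ, Fintype.card_fin, Real.rpow_mul (by positivity),
          Real.rpow_natCast]
    _ ≤ ∏ i, (1 + |z i|) ^ (-2 : ℝ) := by
        refine Finset.prod_le_prod (fun i _ => by positivity) fun i _ => ?_
        refine Real.rpow_le_rpow_of_nonpos (by positivity) ?_ (by norm_num)
        have : |z i| ≤ ‖z‖ := norm_le_pi_norm z i
        linarith

open scoped FourierTransform

theorem one_add_norm_le_mul {V : Type*} [NormedAddCommGroup V] (x y : V) :
    1 + ‖x‖ ≤ (1 + ‖y‖) * (1 + ‖x - y‖) := by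
  have h1 : ‖x‖ ≤ ‖y‖ + ‖x - y‖ := by
    have := norm_add_le y (x - y)
    rwa [add_sub_cancel] at this
  nlinarith [norm_nonneg y, norm_nonneg (x - y)]

/-! ### An increasing family of norms on the Schwartz space -/

section SchwartzNorm

variable {V : Type*} [NormedAddCommGroup V] [NormedSpace ℝ V]

/-- The maximum of the Schwartz seminorms with indices at most `N`. -/
noncomputable def schwartzNorm (N : ℕ) : Seminorm ℂ 𝓢(V, ℂ) :=
  (Finset.Iic ((N, N) : ℕ × ℕ)).sup (schwartzSeminormFamily ℂ V ℂ)

theorem seminorm_le_schwartzNorm {k l N : ℕ} (hk : k ≤ N) (hl : l ≤ N) (h : 𝓢(V, ℂ)) :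
    SchwartzMap.seminorm ℂ k l h ≤ schwartzNorm N h :=
  Seminorm.le_finset_sup_apply (p := schwartzSeminormFamily ℂ V ℂ) (i := (k, l))
    (by simp [hk, hl])

theorem schwartzNorm_le {N : ℕ} {h : 𝓢(V, ℂ)} {a : ℝ} (ha : 0 ≤ a)
    (hb : ∀ k l, k ≤ N → l ≤ N → ∀ x, ‖x‖ ^ k * ‖iteratedFDeriv ℝ l h x‖ ≤ a) :
    schwartzNorm N h ≤ a := by
  refine Seminorm.finset_sup_apply_le ha fun i hi => ?_
  have : i.1 ≤ N ∧ i.2 ≤ N := by simpa [Prod.le_def] using hi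
  exact SchwartzMap.seminorm_le_bound ℂ _ _ h ha (hb _ _ this.1 this.2)

theorem schwartzNorm_mono {N M : ℕ} (hNM : N ≤ M) (h : 𝓢(V, ℂ)) :
    schwartzNorm N h ≤ schwartzNorm M h :=
  schwartzNorm_le (apply_nonneg _ _) fun k l hk hl x =>
    (SchwartzMap.le_seminorm ℂ k l h x).trans
      (seminorm_le_schwartzNorm (hk.trans hNM) (hl.trans hNM) h)

theorem one_add_pow_mul_le_schwartzNorm {k l N : ℕ} (hk : k ≤ N) (hl : l ≤ N) (h : 𝓢(V, ℂ)) (x : V) :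
    (1 + ‖x‖) ^ k * ‖iteratedFDeriv ℝ l h x‖ ≤ 2 ^ N * schwartzNorm N h :=
  SchwartzMap.one_add_le_sup_seminorm_apply (m := ((N, N) : ℕ × ℕ)) hk hl h x

theorem one_add_pow_mul_norm_le_schwartzNorm {k N : ℕ} (hk : k ≤ N) (h : 𝓢(V, ℂ)) (x : V) :
    (1 + ‖x‖) ^ k * ‖h x‖ ≤ 2 ^ N * schwartzNorm N h := by
  simpa using one_add_pow_mul_le_schwartzNorm hk (Nat.zero_le N) h x

theorem norm_apply_le_schwartzNorm (h : 𝓢(V, ℂ)) (x : V) : ‖h x‖ ≤ schwartzNorm 0 h :=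
  (SchwartzMap.norm_le_seminorm ℂ h x).trans (seminorm_le_schwartzNorm le_rfl le_rfl h)

theorem continuous_schwartzNorm (N : ℕ) : Continuous (schwartzNorm (V := V) N) := by
  exact (schwartz_withSeminorms ℂ V ℂ).finset_sups.continuous_seminorm _

/-- The topology is generated by the Schwartz seminorms, and finitely many of them are dominated by
one member of the increasing family. Continuity thus turns into an estimate with a single index. -/
theorem exists_le_schwartzNorm (q : Seminorm ℂ 𝓢(V, ℂ)) (hq : Continuous q) :
    ∃ (N : ℕ) (C : ℝ), 0 ≤ C ∧ ∀ h, q h ≤ C * schwartzNorm N h := by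
  obtain ⟨s, C, -, hC⟩ := Seminorm.bound_of_continuous (schwartz_withSeminorms ℂ V ℂ) q hq
  refine ⟨s.sup (fun i => max i.1 i.2), C, C.2, fun h => (hC h).trans ?_⟩
  rw [smul_apply, NNReal.smul_def, smul_eq_mul]
  refine mul_le_mul_of_nonneg_left ?_ C.2
  refine Seminorm.finset_sup_apply_le (apply_nonneg _ _) fun i hi => ?_
  have : max i.1 i.2 ≤ s.sup (fun i => max i.1 i.2) := Finset.le_sup (f := fun i => max i.1 i.2) hi
  exact seminorm_le_schwartzNorm ((le_max_left _ _).trans this) ((le_max_right _ _).trans this) h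

theorem tendsto_schwartz_iff {ι : Type*} {F : Filter ι} {u : ι → 𝓢(V, ℂ)} {u₀ : 𝓢(V, ℂ)} :
    Filter.Tendsto u F (nhds u₀) ↔
      ∀ N, Filter.Tendsto (fun i => schwartzNorm N (u i - u₀)) F (nhds 0) := by
  constructor
  · intro h N
    have h1 : Filter.Tendsto (fun i => u i - u₀) F (nhds 0) := by
      simpa using h.sub_const u₀
    simpa [Function.comp_def] using ((continuous_schwartzNorm N).tendsto 0).comp h1
  · intro h
    rw [(schwartz_withSeminorms ℂ V ℂ).tendsto_nhds]
    intro i ε hε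
    filter_upwards [(h (max i.1 i.2)).eventually_lt_const hε] with a ha
    exact (seminorm_le_schwartzNorm (le_max_left _ _) (le_max_right _ _) _).trans_lt ha

theorem exists_norm_apply_le_schwartzNorm (f : 𝓢'(V, ℂ)) :
    ∃ (N : ℕ) (C : ℝ), 0 ≤ C ∧ ∀ h, ‖f h‖ ≤ C * schwartzNorm N h :=
  exists_le_schwartzNorm ((normSeminorm ℂ ℂ).comp f.toLinearMap) (continuous_norm.comp f.continuous)

theorem exists_schwartzNorm_map_le (A : 𝓢(V, ℂ) →L[ℂ] 𝓢(V, ℂ)) (N : ℕ) :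
    ∃ (M : ℕ) (C : ℝ), 0 ≤ C ∧ ∀ h, schwartzNorm N (A h) ≤ C * schwartzNorm M h :=
  exists_le_schwartzNorm ((schwartzNorm N).comp A.toLinearMap)
    ((continuous_schwartzNorm N).comp A.continuous)

/-- A linear functional dominated by a Schwartz norm, as a tempered distribution. -/
noncomputable def temperedOfBound (f : 𝓢(V, ℂ) →ₗ[ℂ] ℂ) (N : ℕ) (C : ℝ)
    (h : ∀ ψ, ‖f ψ‖ ≤ C * schwartzNorm N ψ) : 𝓢'(V, ℂ) :=
  { f with
    cont := by
      refine continuous_of_continuousAt_zero f.toAddMonoidHom ?_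
      change Filter.Tendsto f (nhds 0) (nhds (f 0))
      rw [map_zero]
      refine squeeze_zero_norm (fun ψ => h ψ) ?_
      have := (continuous_schwartzNorm (V := V) N).tendsto 0
      rw [map_zero] at this
      simpa using this.const_mul C }

/-! ### Translations -/

theorem schwartzNorm_translate_le (N : ℕ) (a : V) (h : 𝓢(V, ℂ)) :
    schwartzNorm N (h.compSubConstCLM ℂ a) ≤ 2 ^ N * (1 + ‖a‖) ^ N * schwartzNorm N h := by
  refine schwartzNorm_le (by positivity) fun k l hk hl x => ?_
  have e : ((h.compSubConstCLM ℂ a : 𝓢(V, ℂ)) : V → ℂ) = fun x => h (x - a) := by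
    funext x; simp
  rw [e, iteratedFDeriv_comp_sub]
  have h1 : ‖x‖ ^ k ≤ (1 + ‖a‖) ^ N * (1 + ‖x - a‖) ^ k := by
    calc ‖x‖ ^ k ≤ ((1 + ‖a‖) * (1 + ‖x - a‖)) ^ k := by
          gcongr
          linarith [one_add_norm_le_mul x a]
      _ = (1 + ‖a‖) ^ k * (1 + ‖x - a‖) ^ k := mul_pow _ _ _
      _ ≤ _ := by
          gcongr
          linarith [norm_nonneg a]
  calc ‖x‖ ^ k * ‖iteratedFDeriv ℝ l h (x - a)‖
      ≤ (1 + ‖a‖) ^ N * (1 + ‖x - a‖) ^ k * ‖iteratedFDeriv ℝ l h (x - a)‖ := by gcongr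
    _ ≤ (1 + ‖a‖) ^ N * (2 ^ N * schwartzNorm N h) := by
        rw [mul_assoc]
        exact mul_le_mul_of_nonneg_left (one_add_pow_mul_le_schwartzNorm hk hl h _) (by positivity)
    _ = _ := by ring

/-- The mean value inequality on the segment from `x` to `x - a` gains the factor `‖a‖` and costs
one derivative. -/
theorem schwartzNorm_translate_sub_le (N : ℕ) (a : V) (h : 𝓢(V, ℂ)) :
    schwartzNorm N (h.compSubConstCLM ℂ a - h) ≤
      2 ^ (N + 1) * (1 + ‖a‖) ^ N * ‖a‖ * schwartzNorm (N + 1) h := by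
  refine schwartzNorm_le (by positivity) fun k l hk hl x => ?_
  have e : ((h.compSubConstCLM ℂ a - h : 𝓢(V, ℂ)) : V → ℂ) = (fun x => h (x - a)) - h := by
    funext x; simp
  have hs : ContDiff ℝ l (fun x => h (x - a)) :=
    (h.smooth l).comp (contDiff_id.sub contDiff_const)
  have e2 : iteratedFDeriv ℝ l ((h.compSubConstCLM ℂ a - h : 𝓢(V, ℂ)) : V → ℂ) x =
      iteratedFDeriv ℝ l h (x - a) - iteratedFDeriv ℝ l h x := by
    rw [e, iteratedFDeriv_sub_apply hs.contDiffAt (h.smooth l).contDiffAt, iteratedFDeriv_comp_sub]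
  rw [e2]
  set A : ℝ := 2 ^ (N + 1) * (1 + ‖a‖) ^ N * schwartzNorm (N + 1) h with hA
  have hx : 0 < (1 + ‖x‖) ^ k := by positivity
  have h1 : ‖iteratedFDeriv ℝ l h (x - a) - iteratedFDeriv ℝ l h x‖ ≤
      A / (1 + ‖x‖) ^ k * ‖x - a - x‖ := by
    refine Convex.norm_image_sub_le_of_norm_fderiv_le (𝕜 := ℝ) (s := segment ℝ x (x - a))
      (fun y _ => ?_) (fun y hy => ?_) (convex_segment _ _) (left_mem_segment _ _ _)
      (right_mem_segment _ _ _)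
    · exact ((h.smooth (l + 1)).differentiable_iteratedFDeriv (m := l)
        (by exact_mod_cast Nat.lt_succ_self l)).differentiableAt
    · rw [norm_fderiv_iteratedFDeriv, le_div_iff₀ hx, mul_comm]
      have hxy : ‖x - y‖ ≤ ‖a‖ := by
        have := norm_sub_le_of_mem_segment hy
        rw [norm_sub_rev]
        simpa using this
      calc (1 + ‖x‖) ^ k * ‖iteratedFDeriv ℝ (l + 1) h y‖
          ≤ ((1 + ‖a‖) ^ N * (1 + ‖y‖) ^ k) * ‖iteratedFDeriv ℝ (l + 1) h y‖ := by
            gcongr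
            calc (1 + ‖x‖) ^ k ≤ ((1 + ‖y‖) * (1 + ‖x - y‖)) ^ k := by
                  gcongr
                  exact one_add_norm_le_mul x y
              _ ≤ ((1 + ‖a‖) * (1 + ‖y‖)) ^ k := by
                  rw [mul_comm]
                  gcongr
              _ = (1 + ‖a‖) ^ k * (1 + ‖y‖) ^ k := mul_pow _ _ _
              _ ≤ _ := by
                  gcongr
                  linarith [norm_nonneg a]
        _ ≤ (1 + ‖a‖) ^ N * (2 ^ (N + 1) * schwartzNorm (N + 1) h) := by
            rw [mul_assoc]
            exact mul_le_mul_of_nonneg_left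
              (one_add_pow_mul_le_schwartzNorm (by omega) (by omega) h _) (by positivity)
        _ = A := by rw [hA]; ring
  have h2 : ‖x - a - x‖ = ‖a‖ := by simp
  rw [h2] at h1
  calc ‖x‖ ^ k * ‖iteratedFDeriv ℝ l h (x - a) - iteratedFDeriv ℝ l h x‖
      ≤ (1 + ‖x‖) ^ k * (A / (1 + ‖x‖) ^ k * ‖a‖) := by
        gcongr
        linarith
    _ = A * ‖a‖ := by field_simp
    _ = _ := by rw [hA]; ring

/-- Joint continuity of translation. -/
theorem continuous_translate :
    Continuous fun z : V × 𝓢(V, ℂ) => (z.2.compSubConstCLM ℂ z.1 : 𝓢(V, ℂ)) := by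
  refine continuous_iff_continuousAt.2 fun ⟨a₀, h₀⟩ => ?_
  refine tendsto_schwartz_iff.2 fun N => ?_
  -- A translate of the small function `h - h₀`, plus the effect of the small translation `a - a₀`
  -- on a fixed function.
  have e : ∀ (a : V) (h : 𝓢(V, ℂ)), h.compSubConstCLM ℂ a - h₀.compSubConstCLM ℂ a₀ =
      (h - h₀).compSubConstCLM ℂ a +
        ((h₀.compSubConstCLM ℂ a₀).compSubConstCLM ℂ (a - a₀) - h₀.compSubConstCLM ℂ a₀) := by
    intro a h
    ext x
    simp
  refine squeeze_zero (fun _ => apply_nonneg _ _) (g := fun z : V × 𝓢(V, ℂ) =>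
    2 ^ N * (1 + ‖z.1‖) ^ N * schwartzNorm N (z.2 - h₀) +
      2 ^ (N + 1) * (1 + ‖z.1 - a₀‖) ^ N * ‖z.1 - a₀‖ *
        schwartzNorm (N + 1) (h₀.compSubConstCLM ℂ a₀)) (fun z => ?_) ?_
  · rw [e]
    exact (map_add_le_add _ _ _).trans
      (add_le_add (schwartzNorm_translate_le _ _ _) (schwartzNorm_translate_sub_le _ _ _))
  · have hc : Continuous fun z : V × 𝓢(V, ℂ) =>
        2 ^ N * (1 + ‖z.1‖) ^ N * schwartzNorm N (z.2 - h₀) +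
          2 ^ (N + 1) * (1 + ‖z.1 - a₀‖) ^ N * ‖z.1 - a₀‖ *
            schwartzNorm (N + 1) (h₀.compSubConstCLM ℂ a₀) := by
      have := (continuous_schwartzNorm (V := V) N).comp
        (continuous_snd.sub continuous_const : Continuous fun z : V × 𝓢(V, ℂ) => z.2 - h₀)
      have h2 : Continuous fun z : V × 𝓢(V, ℂ) => schwartzNorm N (z.2 - h₀) := this
      fun_prop
    have := hc.tendsto (a₀, h₀)
    simpa using this

end SchwartzNorm

/-! ### Time-frequency shifts of Schwartz functions -/

section TimeFrequency

variable {d : ℕ}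

local notation "𝔼" => EuclideanSpace ℝ (Fin d)

theorem norm_character (ξ t : 𝔼) : ‖character ξ t‖ = 1 := by
  rw [character, Complex.norm_exp]
  simp

theorem modulation_apply (ξ : 𝔼) (h : 𝓢(𝔼, ℂ)) (t : 𝔼) :
    SchwartzMap.smulLeftCLM ℂ (character ξ) h t = character ξ t * h t := by
  simp [hasTemperateGrowth_character]

theorem fourier_translate (a : 𝔼) (h : 𝓢(𝔼, ℂ)) :
    𝓕 (h.compSubConstCLM ℂ a : 𝓢(𝔼, ℂ)) = SchwartzMap.smulLeftCLM ℂ (character (-a)) (𝓕 h) := by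
  ext ξ
  rw [modulation_apply, SchwartzMap.fourier_coe, SchwartzMap.fourier_coe, Real.fourier_eq',
    Real.fourier_eq', ← integral_const_mul,
    ← integral_sub_right_eq_self (fun t => character (-a) ξ * _) a]
  refine integral_congr_ae (Filter.Eventually.of_forall fun t => ?_)
  simp only [SchwartzMap.compSubConstCLM_apply, smul_eq_mul, ← mul_assoc, character]
  rw [← Complex.exp_add]
  congr 2
  simp only [inner_sub_left, inner_neg_right, real_inner_comm a ξ]
  push_cast
  ring

/-- Modulation is translation conjugated by the Fourier transform. Since the latter is continuous on
the Schwartz space, all estimates for translations pass to modulations. -/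
theorem modulation_eq_fourier (ξ : 𝔼) (h : 𝓢(𝔼, ℂ)) :
    SchwartzMap.smulLeftCLM ℂ (character ξ) h =
      𝓕 ((𝓕⁻ h).compSubConstCLM ℂ (-ξ) : 𝓢(𝔼, ℂ)) := by
  rw [fourier_translate, neg_neg, FourierTransform.fourier_fourierInv_eq]

theorem fourier_modulation (ξ : 𝔼) (h : 𝓢(𝔼, ℂ)) (t : 𝔼) :
    𝓕 (SchwartzMap.smulLeftCLM ℂ (character ξ) h) t = 𝓕 h (t - ξ) := by
  rw [SchwartzMap.fourier_coe, SchwartzMap.fourier_coe, Real.fourier_eq', Real.fourier_eq']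
  refine integral_congr_ae (Filter.Eventually.of_forall fun s => ?_)
  simp only [modulation_apply, smul_eq_mul, ← mul_assoc, character]
  rw [← Complex.exp_add]
  congr 2
  simp only [inner_sub_right]
  push_cast
  ring

theorem continuous_timeFrequencyShift (φ : 𝓢(𝔼, ℂ)) :
    Continuous fun z : 𝔼 × 𝔼 => timeFrequencyShift z.1 z.2 φ := by
  have h1 : Continuous fun z : 𝔼 × 𝔼 => (φ.compSubConstCLM ℂ z.1 : 𝓢(𝔼, ℂ)) :=
    continuous_translate.comp (continuous_fst.prodMk continuous_const)
  have h2 : Continuous fun z : 𝔼 × 𝔼 => 𝓕⁻ (φ.compSubConstCLM ℂ z.1 : 𝓢(𝔼, ℂ)) :=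
    (FourierTransform.fourierInvCLM ℂ 𝓢(𝔼, ℂ)).continuous.comp h1
  have h3 := (FourierTransform.fourierCLM ℂ 𝓢(𝔼, ℂ)).continuous.comp
    (continuous_translate.comp (continuous_snd.neg.prodMk h2))
  convert h3 using 2 with z
  exact modulation_eq_fourier _ _

theorem exists_schwartzNorm_timeFrequencyShift_le (φ : 𝓢(𝔼, ℂ)) (N : ℕ) :
    ∃ (m : ℕ) (C : ℝ), 0 ≤ C ∧ ∀ x ξ : 𝔼,
      schwartzNorm N (timeFrequencyShift x ξ φ) ≤ C * ((1 + ‖x‖) * (1 + ‖ξ‖)) ^ m := by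
  obtain ⟨M₁, C₁, hC₁, h₁⟩ := exists_schwartzNorm_map_le (FourierTransform.fourierCLM ℂ 𝓢(𝔼, ℂ)) N
  obtain ⟨M₂, C₂, hC₂, h₂⟩ :=
    exists_schwartzNorm_map_le (FourierTransform.fourierInvCLM ℂ 𝓢(𝔼, ℂ)) M₁
  refine ⟨max M₁ M₂, C₁ * (2 ^ M₁ * (C₂ * (2 ^ M₂ * schwartzNorm M₂ φ))), by positivity,
    fun x ξ => ?_⟩
  have hx : 1 ≤ 1 + ‖x‖ := by linarith [norm_nonneg x]
  have hξ : 1 ≤ 1 + ‖ξ‖ := by linarith [norm_nonneg ξ]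
  calc schwartzNorm N (timeFrequencyShift x ξ φ)
      ≤ C₁ * schwartzNorm M₁ ((𝓕⁻ (φ.compSubConstCLM ℂ x : 𝓢(𝔼, ℂ))).compSubConstCLM ℂ (-ξ)) := by
        rw [timeFrequencyShift, modulation_eq_fourier]
        exact h₁ _
    _ ≤ C₁ * (2 ^ M₁ * (1 + ‖ξ‖) ^ M₁ * (C₂ * (2 ^ M₂ * (1 + ‖x‖) ^ M₂ * schwartzNorm M₂ φ))) := by
        gcongr
        refine (schwartzNorm_translate_le _ _ _).trans ?_
        rw [norm_neg]
        gcongr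
        refine (h₂ _).trans ?_
        gcongr
        exact schwartzNorm_translate_le _ _ _
    _ = C₁ * (2 ^ M₁ * (C₂ * (2 ^ M₂ * schwartzNorm M₂ φ))) * ((1 + ‖x‖) ^ M₂ * (1 + ‖ξ‖) ^ M₁) := by
        ring
    _ ≤ _ := by
        rw [mul_pow]
        gcongr
        · exact le_max_right _ _
        · exact le_max_left _ _

theorem norm_iteratedFDeriv_conjSchwartz (φ : 𝓢(𝔼, ℂ)) (l : ℕ) (x : 𝔼) :
    ‖iteratedFDeriv ℝ l (conjSchwartz φ) x‖ = ‖iteratedFDeriv ℝ l φ x‖ := by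
  have e : (conjSchwartz φ : 𝔼 → ℂ) = Complex.conjLIE ∘ φ := by
    funext t
    simp [conjSchwartz_apply]
  rw [e, LinearIsometryEquiv.norm_iteratedFDeriv_comp_left]

theorem schwartzNorm_conjSchwartz (N : ℕ) (φ : 𝓢(𝔼, ℂ)) :
    schwartzNorm N (conjSchwartz φ) = schwartzNorm N φ := by
  have main : ∀ φ : 𝓢(𝔼, ℂ), schwartzNorm N (conjSchwartz φ) ≤ schwartzNorm N φ := fun φ =>
    schwartzNorm_le (apply_nonneg _ _) fun k l hk hl x => by
      rw [norm_iteratedFDeriv_conjSchwartz]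
      exact (SchwartzMap.le_seminorm ℂ k l φ x).trans (seminorm_le_schwartzNorm hk hl φ)
  have hinv : conjSchwartz (conjSchwartz φ) = φ := by
    ext t
    simp [conjSchwartz_apply]
  refine le_antisymm (main φ) ?_
  conv_lhs => rw [← hinv]
  exact main _

theorem continuous_conjSchwartz : Continuous (conjSchwartz : 𝓢(𝔼, ℂ) → 𝓢(𝔼, ℂ)) :=
  (SchwartzMap.postcompCLM (𝕜 := ℝ) (Complex.conjCLE : ℂ →L[ℝ] ℂ)).continuous

/-! ### Decay of the Gabor transform of a Schwartz function -/

theorem integrable_one_add_pow_mul (N : ℕ) (χ : 𝓢(𝔼, ℂ)) :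
    Integrable fun t : 𝔼 => (1 + ‖t‖) ^ N * ‖χ t‖ := by
  have h1 : Integrable fun t : 𝔼 => 2 ^ (N - 1) * (‖χ t‖ + ‖t‖ ^ N * ‖χ t‖) :=
    (χ.integrable.norm.add (χ.integrable_pow_mul volume N)).const_mul _
  refine h1.mono' (by
    have := χ.continuous
    exact Continuous.aestronglyMeasurable (by fun_prop)) (Filter.Eventually.of_forall fun t => ?_)
  rw [Real.norm_of_nonneg (by positivity)]
  have := add_pow_le zero_le_one (norm_nonneg t) N
  rw [one_pow] at this
  calc (1 + ‖t‖) ^ N * ‖χ t‖ ≤ 2 ^ (N - 1) * (1 + ‖t‖ ^ N) * ‖χ t‖ := by gcongr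
    _ = _ := by ring

/-- One factor is concentrated near 0 and the other near `x`; `1 + ‖x‖ ≤ (1 + ‖t‖) (1 + ‖t - x‖)`
distributes the weight over both. -/
theorem norm_integral_mul_translate_le (N : ℕ) (ψ χ : 𝓢(𝔼, ℂ)) {F : 𝔼 → ℂ} {x : 𝔼}
    (hF : ∀ t, ‖F t‖ ≤ ‖ψ t‖ * ‖χ (t - x)‖) :
    (1 + ‖x‖) ^ N * ‖∫ t, F t‖ ≤
      2 ^ N * (∫ t : 𝔼, (1 + ‖t‖) ^ N * ‖χ t‖) * schwartzNorm N ψ := by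
  have hint : Integrable fun t : 𝔼 => 2 ^ N * schwartzNorm N ψ * ((1 + ‖t - x‖) ^ N * ‖χ (t - x)‖) :=
    ((integrable_one_add_pow_mul N χ).comp_sub_right x).const_mul _
  have h1 : ‖∫ t, (((1 + ‖x‖) ^ N : ℝ) : ℂ) * F t‖ ≤
      ∫ t, 2 ^ N * schwartzNorm N ψ * ((1 + ‖t - x‖) ^ N * ‖χ (t - x)‖) := by
    refine norm_integral_le_of_norm_le hint (Filter.Eventually.of_forall fun t => ?_)
    rw [norm_mul, Complex.norm_real, Real.norm_of_nonneg (by positivity)]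
    calc (1 + ‖x‖) ^ N * ‖F t‖
        ≤ ((1 + ‖t‖) * (1 + ‖t - x‖)) ^ N * (‖ψ t‖ * ‖χ (t - x)‖) := by
          gcongr
          · rw [norm_sub_rev]
            exact one_add_norm_le_mul x t
          · exact hF t
      _ = ((1 + ‖t‖) ^ N * ‖ψ t‖) * ((1 + ‖t - x‖) ^ N * ‖χ (t - x)‖) := by
          rw [mul_pow]
          ring
      _ ≤ _ := mul_le_mul_of_nonneg_right
          (one_add_pow_mul_norm_le_schwartzNorm le_rfl ψ t) (by positivity)
  rw [integral_const_mul, norm_mul, Complex.norm_real, Real.norm_of_nonneg (by positivity),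
    integral_const_mul, integral_sub_right_eq_self (fun t => (1 + ‖t‖) ^ N * ‖χ t‖) x] at h1
  linarith

theorem exists_norm_integral_mul_timeFrequencyShift_le (χ : 𝓢(𝔼, ℂ)) (N : ℕ) :
    ∃ (M : ℕ) (C : ℝ), 0 ≤ C ∧ ∀ (ψ : 𝓢(𝔼, ℂ)) (x ξ : 𝔼),
      ((1 + ‖x‖) * (1 + ‖ξ‖)) ^ N * ‖∫ t, ψ t * timeFrequencyShift x ξ χ t‖ ≤
        C * schwartzNorm M ψ := by
  obtain ⟨M₀, C₀, hC₀, h₀⟩ :=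
    exists_schwartzNorm_map_le (FourierTransform.fourierInvCLM ℂ 𝓢(𝔼, ℂ)) (2 * N)
  set A : ℝ := 2 ^ (2 * N) * ∫ t : 𝔼, (1 + ‖t‖) ^ (2 * N) * ‖χ t‖ with hA
  set B : ℝ := 2 ^ (2 * N) * ∫ t : 𝔼, (1 + ‖t‖) ^ (2 * N) * ‖𝓕 χ t‖ with hB
  have hA0 : 0 ≤ A := mul_nonneg (by positivity) (integral_nonneg fun t => by positivity)
  have hB0 : 0 ≤ B := mul_nonneg (by positivity) (integral_nonneg fun t => by positivity)
  refine ⟨max (2 * N) M₀, A + B * C₀, by positivity, fun ψ x ξ => ?_⟩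
  set I := ∫ t, ψ t * timeFrequencyShift x ξ χ t with hI
  have h1 : (1 + ‖x‖) ^ (2 * N) * ‖I‖ ≤ A * schwartzNorm (2 * N) ψ := by
    refine norm_integral_mul_translate_le (2 * N) ψ χ fun t => ?_
    rw [norm_mul, timeFrequencyShift, modulation_apply, norm_mul, norm_character, one_mul]
    simp
  have h2 : (1 + ‖ξ‖) ^ (2 * N) * ‖I‖ ≤ B * (C₀ * schwartzNorm M₀ ψ) := by
    -- Decay in `ξ` is decay in position on the Fourier side, where the modulation by `ξ` becomes a
    -- translation by `ξ`.
    have e : I = ∫ t, 𝓕⁻ ψ t * 𝓕 (timeFrequencyShift x ξ χ) t := by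
      rw [← SchwartzMap.integral_fourier_mul_eq, FourierTransform.fourier_fourierInv_eq]
    rw [e]
    refine (norm_integral_mul_translate_le (2 * N) (𝓕⁻ ψ) (𝓕 χ) fun t => ?_).trans
      (mul_le_mul_of_nonneg_left (h₀ ψ) hB0)
    rw [norm_mul, timeFrequencyShift, fourier_modulation, fourier_translate, modulation_apply,
      norm_mul, norm_character, one_mul]
  -- Joint decay follows from the two separate decays by `ab ≤ a² + b²`, hence the exponent `2 * N`
  -- above.
  have h3 : ((1 + ‖x‖) * (1 + ‖ξ‖)) ^ N ≤ (1 + ‖x‖) ^ (2 * N) + (1 + ‖ξ‖) ^ (2 * N) := by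
    rw [mul_pow, pow_mul', pow_mul']
    nlinarith [sq_nonneg ((1 + ‖x‖) ^ N - (1 + ‖ξ‖) ^ N), sq_nonneg ((1 + ‖x‖) ^ N),
      sq_nonneg ((1 + ‖ξ‖) ^ N)]
  calc ((1 + ‖x‖) * (1 + ‖ξ‖)) ^ N * ‖I‖
      ≤ ((1 + ‖x‖) ^ (2 * N) + (1 + ‖ξ‖) ^ (2 * N)) * ‖I‖ := by gcongr
    _ = (1 + ‖x‖) ^ (2 * N) * ‖I‖ + (1 + ‖ξ‖) ^ (2 * N) * ‖I‖ := by ring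
    _ ≤ A * schwartzNorm (2 * N) ψ + B * (C₀ * schwartzNorm M₀ ψ) := add_le_add h1 h2
    _ ≤ A * schwartzNorm (max (2 * N) M₀) ψ + B * (C₀ * schwartzNorm (max (2 * N) M₀) ψ) := by
        gcongr
        · exact schwartzNorm_mono (le_max_left _ _) ψ
        · exact schwartzNorm_mono (le_max_right _ _) ψ
    _ = _ := by ring

/-- The matrix coefficients of time-frequency shifts are shifts of a single function, up to a phase. -/
theorem norm_integral_conj_timeFrequencyShift_mul (φ : 𝓢(𝔼, ℂ)) (x ξ y η : 𝔼) :
    ‖∫ t, conjSchwartz (timeFrequencyShift y η φ) t * timeFrequencyShift x ξ φ t‖ =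
      ‖∫ t, conjSchwartz φ t * timeFrequencyShift (x - y) (ξ - η) φ t‖ := by
  rw [← integral_add_right_eq_self
    (fun t => conjSchwartz (timeFrequencyShift y η φ) t * timeFrequencyShift x ξ φ t) y]
  have e : ∀ t, conjSchwartz (timeFrequencyShift y η φ) (t + y) * timeFrequencyShift x ξ φ (t + y) =
      character (ξ - η) y * (conjSchwartz φ t * timeFrequencyShift (x - y) (ξ - η) φ t) := by
    intro t
    simp only [conjSchwartz_apply, timeFrequencyShift_apply, map_mul, character, ← Complex.exp_conj]
    have e1 : t + y - x = t - (x - y) := by abel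
    rw [add_sub_cancel_right, e1]
    have e2 : Complex.exp (conj (2 * Real.pi * Complex.I * (inner ℝ (t + y) η : ℝ))) *
        Complex.exp (2 * Real.pi * Complex.I * (inner ℝ (t + y) ξ : ℝ)) =
        Complex.exp (2 * Real.pi * Complex.I * (inner ℝ y (ξ - η) : ℝ)) *
          Complex.exp (2 * Real.pi * Complex.I * (inner ℝ t (ξ - η) : ℝ)) := by
      rw [← Complex.exp_add, ← Complex.exp_add]
      congr 1
      simp only [map_mul, Complex.conj_I, Complex.conj_ofReal, inner_add_left, inner_sub_right,
        map_ofNat]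
      push_cast
      ring
    simp only [map_mul] at e2
    linear_combination (conj (φ t) * φ (t - (x - y))) * e2
  simp only [e]
  rw [integral_const_mul, norm_mul, norm_character, one_mul]

end TimeFrequency

open scoped LineDeriv

/-! ### Weak integrals in the Schwartz space -/

/-- The space `X` need not be complete, so the Bochner integral `b` of `Φ` is formed in the
completion. The norming functionals `e j` agree on `h` and `b`, so an `s` in `X` close to `b` is
also close to `h`. Hence `f h`, `f s` and the value at `b` of the extension of `f` are all close. -/
theorem apply_eq_integral_of_norming {X : Type*} [SeminormedAddCommGroup X] [NormedSpace ℂ X]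
    {Z : Type*} [MeasurableSpace Z] {μ : Measure Z} {Φ : Z → X} (hΦ : AEStronglyMeasurable Φ μ)
    (hint : Integrable (fun z => ‖Φ z‖) μ) {h : X} {J : Type*} (e : J → X →L[ℂ] ℂ)
    (he : ∀ j x, ‖e j x‖ ≤ ‖x‖) (hnorm : ∀ x c, 0 ≤ c → (∀ j, ‖e j x‖ ≤ c) → ‖x‖ ≤ c)
    (heq : ∀ j, e j h = ∫ z, e j (Φ z) ∂μ) (f : X →L[ℂ] ℂ) : f h = ∫ z, f (Φ z) ∂μ := by
  set ι : X →L[ℂ] UniformSpace.Completion X := UniformSpace.Completion.toComplL with hι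
  have hιn : ∀ x, ‖ι x‖ = ‖x‖ := fun x => UniformSpace.Completion.norm_coe x
  have hdense : DenseRange ι := UniformSpace.Completion.denseRange_coe
  have hunif : IsUniformInducing ι := UniformSpace.Completion.isUniformInducing_coe X
  have hιΦ : Integrable (fun z => ι (Φ z)) μ := by
    refine ⟨ι.continuous.comp_aestronglyMeasurable hΦ, ?_⟩
    have := hint.2
    refine this.congr' (Filter.Eventually.of_forall fun z => ?_)
    rw [hιn, norm_norm]
  set b : UniformSpace.Completion X := ∫ z, ι (Φ z) ∂μ with hb
  have hext : ∀ g : X →L[ℂ] ℂ, (g.extend ι) b = ∫ z, g (Φ z) ∂μ := by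
    intro g
    rw [hb, ← ContinuousLinearMap.integral_comp_comm _ hιΦ]
    simp only [ContinuousLinearMap.extend_eq _ hdense hunif]
  have hbound : ∀ (g : X →L[ℂ] ℂ) (K : NNReal), (∀ x, ‖g x‖ ≤ K * ‖x‖) →
      ∀ y, ‖g.extend ι y‖ ≤ K * ‖y‖ := by
    intro g K hg y
    refine UniformSpace.Completion.induction_on y
      (isClosed_le (g.extend ι).continuous.norm (continuous_const.mul continuous_norm)) fun x => ?_
    have : g.extend ι (x : UniformSpace.Completion X) = g x :=
      ContinuousLinearMap.extend_eq g hdense hunif x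
    rw [this, UniformSpace.Completion.norm_coe]
    exact hg x
  have hclose : ∀ ε > 0, ‖f h - ∫ z, f (Φ z) ∂μ‖ ≤ 2 * ‖f‖ * ε := by
    intro ε hε
    obtain ⟨s, hs⟩ := hdense.exists_dist_lt b hε
    rw [dist_eq_norm] at hs
    have h1 : ∀ j, ‖e j (h - s)‖ ≤ ε := by
      intro j
      rw [map_sub, heq j, ← hext (e j), ← ContinuousLinearMap.extend_eq (e j) hdense hunif s,
        ← map_sub]
      refine (hbound (e j) 1 (fun x => by simpa using he j x) _).trans ?_
      simpa using hs.le
    have h2 : ‖h - s‖ ≤ ε := hnorm _ _ hε.le h1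
    have h3 : ‖f s - ∫ z, f (Φ z) ∂μ‖ ≤ ‖f‖ * ε := by
      rw [← hext f, ← ContinuousLinearMap.extend_eq f hdense hunif s, ← map_sub]
      refine (hbound f ‖f‖₊ (fun x => f.le_opNorm x) _).trans ?_
      rw [norm_sub_rev, coe_nnnorm]
      gcongr
    calc ‖f h - ∫ z, f (Φ z) ∂μ‖ = ‖f (h - s) + (f s - ∫ z, f (Φ z) ∂μ)‖ := by
          rw [map_sub]; congr 1; ring
      _ ≤ ‖f‖ * ε + ‖f‖ * ε := (norm_add_le _ _).trans (add_le_add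
          ((f.le_opNorm _).trans (by gcongr)) h3)
      _ = _ := by ring
  have h0 : ‖f h - ∫ z, f (Φ z) ∂μ‖ ≤ 0 := by
    refine le_of_forall_pos_le_add fun δ hδ => ?_
    have hK : 0 < 2 * ‖f‖ + 1 := by positivity
    have := hclose (δ / (2 * ‖f‖ + 1)) (by positivity)
    rw [zero_add]
    refine this.trans ?_
    rw [mul_div_assoc', div_le_iff₀ hK]
    nlinarith [norm_nonneg f]
  exact sub_eq_zero.1 (norm_le_zero_iff.1 h0)

/-- `X` carries no topology here: it is given that of `q` inside the proof, so the result applies to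
the Schwartz space with one norm at a time. -/
theorem apply_eq_integral_of_norming_seminorm {X : Type*} [AddCommGroup X] [Module ℂ X]
    (q : Seminorm ℂ X) {Z : Type*} [TopologicalSpace Z] [MeasurableSpace Z] [OpensMeasurableSpace Z]
    [SecondCountableTopology Z] {μ : Measure Z} {Φ : Z → X}
    (hΦ : ∀ z₀, Filter.Tendsto (fun z => q (Φ z - Φ z₀)) (nhds z₀) (nhds 0))
    (hint : Integrable (fun z => q (Φ z)) μ) {h : X} {J : Type*} (e : J → X →ₗ[ℂ] ℂ)
    (he : ∀ j x, ‖e j x‖ ≤ q x) (hnorm : ∀ x c, 0 ≤ c → (∀ j, ‖e j x‖ ≤ c) → q x ≤ c)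
    (heq : ∀ j, e j h = ∫ z, e j (Φ z) ∂μ) (f : X →ₗ[ℂ] ℂ) (C : ℝ) (hf : ∀ x, ‖f x‖ ≤ C * q x) :
    f h = ∫ z, f (Φ z) ∂μ := by
  let _ : SeminormedAddCommGroup X := q.toAddGroupSeminorm.toSeminormedAddCommGroup
  let _ : NormedSpace ℂ X := { norm_smul_le := fun a x => (map_smul_eq_mul q a x).le }
  have hcont : Continuous Φ := continuous_iff_continuousAt.2 fun z₀ =>
    tendsto_iff_norm_sub_tendsto_zero.2 (hΦ z₀)
  exact apply_eq_integral_of_norming hcont.aestronglyMeasurable hint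
    (fun j => (e j).mkContinuous 1 fun x => (he j x).trans_eq (one_mul _).symm) he hnorm heq
    (f.mkContinuous C hf)

section Schwartz

variable {V : Type*} [NormedAddCommGroup V] [NormedSpace ℝ V]

variable {Z : Type*} [TopologicalSpace Z] [MeasurableSpace Z] [OpensMeasurableSpace Z]
  {μ : Measure Z}

/-- `h` is the pointwise integral of the continuous family `Φ` of Schwartz functions, all of whose
Schwartz norms are integrable. -/
structure IsSchwartzIntegral (μ : Measure Z) (Φ : Z → 𝓢(V, ℂ)) (h : 𝓢(V, ℂ)) : Prop where
  continuous : Continuous Φ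
  integrable : ∀ N, Integrable (fun z => schwartzNorm N (Φ z)) μ
  apply_eq : ∀ t, h t = ∫ z, Φ z t ∂μ

theorem IsSchwartzIntegral.integrable_apply {Φ : Z → 𝓢(V, ℂ)} {h : 𝓢(V, ℂ)}
    (H : IsSchwartzIntegral μ Φ h) (t : V) : Integrable (fun z => Φ z t) μ :=
  (H.integrable 0).mono' ((TemperedDistribution.delta t).continuous.comp H.continuous).aestronglyMeasurable
    (Filter.Eventually.of_forall fun _ => norm_apply_le_schwartzNorm _ t)

/-- Differentiation under the integral sign, dominated by the integrable sup norm of the derivative.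
Iterated, this turns the pointwise integral into one for all derivatives. -/
theorem IsSchwartzIntegral.lineDeriv [SecondCountableTopology Z] {Φ : Z → 𝓢(V, ℂ)} {h : 𝓢(V, ℂ)}
    (H : IsSchwartzIntegral μ Φ h) (m : V) : IsSchwartzIntegral μ (fun z => ∂_{m} (Φ z)) (∂_{m} h) := by
  have hcont : Continuous fun z => (∂_{m} (Φ z) : 𝓢(V, ℂ)) :=
    (LineDeriv.lineDerivOpCLM ℂ 𝓢(V, ℂ) m).continuous.comp H.continuous
  have hint : ∀ N, Integrable (fun z => schwartzNorm N (∂_{m} (Φ z) : 𝓢(V, ℂ))) μ := by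
    intro N
    obtain ⟨M, C, hC, hM⟩ := exists_schwartzNorm_map_le (LineDeriv.lineDerivOpCLM ℂ 𝓢(V, ℂ) m) N
    refine ((H.integrable M).const_mul C).mono'
      ((continuous_schwartzNorm N).comp hcont).aestronglyMeasurable
      (Filter.Eventually.of_forall fun z => ?_)
    rw [Real.norm_of_nonneg (apply_nonneg _ _)]
    exact hM _
  refine ⟨hcont, hint, fun t => ?_⟩
  have hderiv : ∀ (g : 𝓢(V, ℂ)) (s : ℝ), HasDerivAt (fun s : ℝ => g (t + s • m))
      ((∂_{m} g : 𝓢(V, ℂ)) (t + s • m)) s := by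
    intro g s
    rw [SchwartzMap.lineDerivOp_apply_eq_fderiv]
    have h1 : HasDerivAt (fun s : ℝ => t + s • m) m s := by
      simpa using ((hasDerivAt_id s).smul_const m).const_add t
    exact (g.hasFDerivAt (t + s • m)).comp_hasDerivAt s h1
  have key := hasDerivAt_integral_of_dominated_loc_of_deriv_le (μ := μ) (x₀ := (0 : ℝ))
    (s := Set.univ) (F := fun s z => Φ z (t + s • m))
    (F' := fun s z => (∂_{m} (Φ z) : 𝓢(V, ℂ)) (t + s • m))
    (bound := fun z => schwartzNorm 0 (∂_{m} (Φ z) : 𝓢(V, ℂ))) Filter.univ_mem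
    (Filter.Eventually.of_forall fun s => (H.integrable_apply _).aestronglyMeasurable)
    (H.integrable_apply _)
    ((TemperedDistribution.delta _).continuous.comp hcont).aestronglyMeasurable
    (Filter.Eventually.of_forall fun z s _ => norm_apply_le_schwartzNorm _ _) (hint 0)
    (Filter.Eventually.of_forall fun z s _ => hderiv (Φ z) s)
  have h2 := key.2
  simp only [← H.apply_eq] at h2
  simpa using (hderiv h 0).unique h2

theorem IsSchwartzIntegral.iteratedLineDeriv [SecondCountableTopology Z] {Φ : Z → 𝓢(V, ℂ)} {h : 𝓢(V, ℂ)}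
    (H : IsSchwartzIntegral μ Φ h) {l : ℕ} (m : Fin l → V) :
    IsSchwartzIntegral μ (fun z => ∂^{m} (Φ z)) (∂^{m} h) := by
  induction l with
  | zero => simpa using H
  | succ l ih =>
    simp only [LineDeriv.iteratedLineDerivOp_succ_left]
    exact (ih (Fin.tail m)).lineDeriv (m 0)

/-- Tempered distributions commute with integrals in the Schwartz space. -/
theorem IsSchwartzIntegral.apply_tempered [SecondCountableTopology Z] {Φ : Z → 𝓢(V, ℂ)} {h : 𝓢(V, ℂ)}
    (H : IsSchwartzIntegral μ Φ h) (f : 𝓢'(V, ℂ)) : f h = ∫ z, f (Φ z) ∂μ := by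
  obtain ⟨N, C, -, hf⟩ := exists_norm_apply_le_schwartzNorm f
  let J := (Fin (N + 1)) × (Σ l : Fin (N + 1), Fin l → V) × V
  -- The functionals `g ↦ ‖t‖ ^ k * (∂^{m} g)(t) / ∏ ‖m i‖` with `k, l ≤ N` norm `schwartzNorm N`.
  -- When some `m i` is zero the inverse is 0, and the functional is zero.
  let e₀ : J → 𝓢(V, ℂ) →ₗ[ℂ] ℂ := fun j =>
    ((‖j.2.2‖ ^ (j.1 : ℕ) * (∏ i, ‖j.2.1.2 i‖)⁻¹ : ℝ) : ℂ) • (TemperedDistribution.delta j.2.2).toLinearMap.comp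
      (LineDeriv.iteratedLineDerivOpCLM ℂ 𝓢(V, ℂ) j.2.1.2).toLinearMap
  have he₀ : ∀ (k : Fin (N + 1)) (l : Fin (N + 1)) (m : Fin l → V) (t : V) (g : 𝓢(V, ℂ)),
      e₀ (k, ⟨l, m⟩, t) g =
        ((‖t‖ ^ (k : ℕ) * (∏ i, ‖m i‖)⁻¹ : ℝ) : ℂ) * (∂^{m} g : 𝓢(V, ℂ)) t := fun _ _ _ _ _ => rfl
  refine apply_eq_integral_of_norming_seminorm (schwartzNorm N)
    (fun z₀ => tendsto_schwartz_iff.1 (H.continuous.tendsto z₀) N) (H.integrable N) e₀ ?_ ?_ ?_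
    f.toLinearMap C hf
  · rintro ⟨k, ⟨l, m⟩, t⟩ g
    rw [he₀, norm_mul, Complex.norm_real, Real.norm_of_nonneg (by positivity),
      SchwartzMap.iteratedLineDerivOp_eq_iteratedFDeriv]
    have h1 := (iteratedFDeriv ℝ l g t).le_opNorm m
    have h2 := (SchwartzMap.le_seminorm ℂ k l g t).trans
      (seminorm_le_schwartzNorm (Nat.lt_succ_iff.1 k.2) (Nat.lt_succ_iff.1 l.2) g)
    calc _ ≤ ‖t‖ ^ (k : ℕ) * (∏ i, ‖m i‖)⁻¹ * (‖iteratedFDeriv ℝ l g t‖ * ∏ i, ‖m i‖) := by gcongr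
      _ = ‖t‖ ^ (k : ℕ) * ‖iteratedFDeriv ℝ l g t‖ * ((∏ i, ‖m i‖)⁻¹ * ∏ i, ‖m i‖) := by ring
      _ ≤ ‖t‖ ^ (k : ℕ) * ‖iteratedFDeriv ℝ l g t‖ * 1 := by
          gcongr
          exact inv_mul_le_one
      _ ≤ schwartzNorm N g := by rw [mul_one]; exact h2
  · intro x c hc hx
    refine schwartzNorm_le hc fun k l hk hl t => ?_
    rcases (pow_nonneg (norm_nonneg t) k).eq_or_lt with h0 | h0
    · rw [← h0, zero_mul]
      exact hc
    rw [mul_comm, ← le_div_iff₀ h0]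
    refine ContinuousMultilinearMap.opNorm_le_bound (by positivity) fun m => ?_
    rcases eq_or_ne (∏ i, ‖m i‖) 0 with hm | hm
    · obtain ⟨i, -, hi⟩ := Finset.prod_eq_zero_iff.1 hm
      rw [ContinuousMultilinearMap.map_coord_zero _ i (norm_eq_zero.1 hi), norm_zero, hm, mul_zero]
    · have hmpos : 0 < ∏ i, ‖m i‖ := lt_of_le_of_ne (by positivity) hm.symm
      have := hx (⟨k, Nat.lt_succ_of_le hk⟩, ⟨⟨l, Nat.lt_succ_of_le hl⟩, m⟩, t)
      rw [he₀, norm_mul, Complex.norm_real, Real.norm_of_nonneg (by positivity),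
        SchwartzMap.iteratedLineDerivOp_eq_iteratedFDeriv] at this
      rw [div_mul_eq_mul_div, le_div_iff₀ h0]
      calc ‖iteratedFDeriv ℝ l x t m‖ * ‖t‖ ^ k =
          (‖t‖ ^ k * (∏ i, ‖m i‖)⁻¹ * ‖iteratedFDeriv ℝ l x t m‖) * ∏ i, ‖m i‖ := by
            field_simp
        _ ≤ c * ∏ i, ‖m i‖ := by gcongr
  · rintro ⟨k, ⟨l, m⟩, t⟩
    simp only [he₀]
    rw [(H.iteratedLineDeriv m).apply_eq t, integral_const_mul]

end Schwartz

/-! ### The reproducing formula -/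

section Reproducing

variable {d : ℕ}

local notation "𝔼" => EuclideanSpace ℝ (Fin d)

/-- The value at `ψ` of the tempered distribution with density `conj χ`, that is `∫ ψ conj χ`. -/
noncomputable def schwartzInner (χ ψ : 𝓢(𝔼, ℂ)) : ℂ := ∫ t, ψ t * conj (χ t)

theorem schwartzInner_eq (χ ψ : 𝓢(𝔼, ℂ)) : schwartzInner χ ψ =
    SchwartzMap.toTemperedDistributionCLM 𝔼 ℂ volume (conjSchwartz χ) ψ := by
  refine Eq.trans ?_
    (SchwartzMap.toTemperedDistributionCLM_apply_apply volume (conjSchwartz χ) ψ).symm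
  simp only [schwartzInner, conjSchwartz_apply, smul_eq_mul]

theorem conj_schwartzInner (χ ψ : 𝓢(𝔼, ℂ)) : conj (schwartzInner χ ψ) = schwartzInner ψ χ := by
  rw [schwartzInner, schwartzInner, ← integral_conj]
  simp only [map_mul, RingHomCompTriple.comp_apply, RingHom.id_apply, mul_comm]

theorem continuous_schwartzInner_right (χ : 𝓢(𝔼, ℂ)) : Continuous fun ψ => schwartzInner χ ψ := by
  simp only [schwartzInner_eq]
  exact (SchwartzMap.toTemperedDistributionCLM 𝔼 ℂ volume (conjSchwartz χ)).continuous

theorem continuous_schwartzInner_left (ψ : 𝓢(𝔼, ℂ)) : Continuous fun χ => schwartzInner χ ψ := by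
  have : (fun χ => schwartzInner χ ψ) = fun χ => conj (schwartzInner ψ χ) :=
    funext fun χ => (conj_schwartzInner ψ χ).symm
  rw [this]
  exact Complex.continuous_conj.comp (continuous_schwartzInner_right ψ)

/-- A continuous family of Schwartz functions, indexed by `ℝⁿ`, with rapidly decreasing matrix
coefficients and a reproducing formula for tempered distributions. -/
structure IsReproducingFamily {n : ℕ} (U : (Fin n → ℝ) → 𝓢(𝔼, ℂ)) (A : ℝ) : Prop where
  continuous : Continuous U
  pos : 0 < A
  decay : ∀ N : ℕ, ∃ (M : ℕ) (C : ℝ), 0 ≤ C ∧ ∀ ψ z,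
    (1 + ‖z‖) ^ N * ‖schwartzInner (U z) ψ‖ ≤ C * schwartzNorm M ψ
  offDiagonal : ∀ N : ℕ, ∃ C : ℝ, 0 ≤ C ∧ ∀ u z,
    (1 + ‖u - z‖) ^ N * ‖schwartzInner (U z) (U u)‖ ≤ C
  reproducing : ∀ (f : 𝓢'(𝔼, ℂ)) (ψ : 𝓢(𝔼, ℂ)),
    (A : ℂ) * f ψ = ∫ z, f (U z) * schwartzInner (U z) ψ

/-- The pair of halves of a point of `ℝ²ᵈ`, after a permutation of the coordinates. -/
noncomputable def phaseEquiv (c : Equiv.Perm (Fin (d + d))) : (Fin (d + d) → ℝ) ≃ᵐ 𝔼 × 𝔼 :=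
  (((MeasurableEquiv.piCongrLeft (fun _ => ℝ) c.symm).trans
    (MeasurableEquiv.piCongrLeft (fun _ => ℝ) finSumFinEquiv.symm)).trans
    (MeasurableEquiv.sumPiEquivProdPi fun _ : Fin d ⊕ Fin d => ℝ)).trans
    ((MeasurableEquiv.toLp 2 (Fin d → ℝ)).prodCongr (MeasurableEquiv.toLp 2 (Fin d → ℝ)))

theorem phaseEquiv_apply (c : Equiv.Perm (Fin (d + d))) (z : Fin (d + d) → ℝ) :
    phaseEquiv c z = (WithLp.toLp 2 fun i => z (c (Fin.castAdd d i)),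
      WithLp.toLp 2 fun i => z (c (Fin.natAdd d i))) := by
  have h1 : ∀ i, MeasurableEquiv.piCongrLeft (fun _ => ℝ) c.symm z i = z (c i) := by
    intro i
    have := MeasurableEquiv.piCongrLeft_apply_apply (β := fun _ => ℝ) c.symm z (c i)
    simpa using this
  have h2 : ∀ (y : Fin (d + d) → ℝ) i,
      MeasurableEquiv.piCongrLeft (fun _ => ℝ) finSumFinEquiv.symm y i = y (finSumFinEquiv i) := by
    intro y i
    have := MeasurableEquiv.piCongrLeft_apply_apply (β := fun _ => ℝ)
      (finSumFinEquiv (m := d) (n := d)).symm y (finSumFinEquiv i)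
    simpa using this
  refine Prod.ext ?_ ?_ <;> ext i
  · exact (h2 _ (Sum.inl i)).trans (h1 _)
  · exact (h2 _ (Sum.inr i)).trans (h1 _)

theorem measurePreserving_phaseEquiv (c : Equiv.Perm (Fin (d + d))) :
    MeasurePreserving (phaseEquiv c) (volume : Measure (Fin (d + d) → ℝ))
      ((volume : Measure 𝔼).prod (volume : Measure 𝔼)) := by
  have h4 : MeasurePreserving (MeasurableEquiv.toLp 2 (Fin d → ℝ)) volume volume :=
    (EuclideanSpace.volume_preserving_symm_measurableEquiv_toLp (Fin d)).symm
  have h5 := h4.prod h4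
  exact (((volume_measurePreserving_piCongrLeft (fun _ => ℝ) c.symm).trans
    (volume_measurePreserving_piCongrLeft (fun _ => ℝ) finSumFinEquiv.symm)).trans
    (volume_measurePreserving_sumPiEquivProdPi fun _ : Fin d ⊕ Fin d => ℝ)).trans h5

/-- The complex conjugates of the time-frequency shifts of `φ`, with permuted coordinates. -/
noncomputable def gaborAtom (φ : 𝓢(𝔼, ℂ)) (c : Equiv.Perm (Fin (d + d))) (z : Fin (d + d) → ℝ) :
    𝓢(𝔼, ℂ) :=
  conjSchwartz (timeFrequencyShift (phaseEquiv c z).1 (phaseEquiv c z).2 φ)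

theorem gaborTransform₂_comp (φ : 𝓢(𝔼, ℂ)) (c : Equiv.Perm (Fin (d + d))) (f : 𝓢'(𝔼, ℂ))
    (z : Fin (d + d) → ℝ) : gaborTransform₂ φ f (fun i => z (c i)) = f (gaborAtom φ c z) := by
  rw [gaborAtom, phaseEquiv_apply]
  rfl

theorem schwartzInner_gaborAtom (φ : 𝓢(𝔼, ℂ)) (c : Equiv.Perm (Fin (d + d)))
    (z : Fin (d + d) → ℝ) (ψ : 𝓢(𝔼, ℂ)) : schwartzInner (gaborAtom φ c z) ψ =
      ∫ t, ψ t * timeFrequencyShift (phaseEquiv c z).1 (phaseEquiv c z).2 φ t := by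
  simp [schwartzInner, gaborAtom, conjSchwartz_apply]

theorem continuous_phaseEquiv (c : Equiv.Perm (Fin (d + d))) : Continuous (phaseEquiv c) := by
  have : (phaseEquiv c : (Fin (d + d) → ℝ) → 𝔼 × 𝔼) = fun z =>
      (WithLp.toLp 2 fun i => z (c (Fin.castAdd d i)), WithLp.toLp 2 fun i => z (c (Fin.natAdd d i))) :=
    funext (phaseEquiv_apply c)
  rw [this]
  exact ((PiLp.continuous_toLp 2 _).comp (by fun_prop)).prodMk
    ((PiLp.continuous_toLp 2 _).comp (by fun_prop))

theorem phaseEquiv_sub (c : Equiv.Perm (Fin (d + d))) (z u : Fin (d + d) → ℝ) :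
    phaseEquiv c (z - u) = phaseEquiv c z - phaseEquiv c u := by
  simp only [phaseEquiv_apply]
  refine Prod.ext ?_ ?_ <;> ext i <;> simp

theorem one_add_norm_le_phaseEquiv (c : Equiv.Perm (Fin (d + d))) (z : Fin (d + d) → ℝ) :
    1 + ‖z‖ ≤ (1 + ‖(phaseEquiv c z).1‖) * (1 + ‖(phaseEquiv c z).2‖) := by
  have h : ‖z‖ ≤ ‖(phaseEquiv c z).1‖ + ‖(phaseEquiv c z).2‖ := by
    refine (pi_norm_le_iff_of_nonneg (by positivity)).2 fun i => ?_
    obtain ⟨j, rfl⟩ := c.surjective i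
    rw [phaseEquiv_apply]
    refine Fin.addCases (fun k => ?_) (fun k => ?_) j
    · refine le_trans ?_ (le_add_of_nonneg_right (norm_nonneg _))
      exact PiLp.norm_apply_le (WithLp.toLp 2 fun i => z (c (Fin.castAdd d i)) : 𝔼) k
    · refine le_trans ?_ (le_add_of_nonneg_left (norm_nonneg _))
      exact PiLp.norm_apply_le (WithLp.toLp 2 fun i => z (c (Fin.natAdd d i)) : 𝔼) k
  nlinarith [norm_nonneg (phaseEquiv c z).1, norm_nonneg (phaseEquiv c z).2]

theorem euclidean_norm_le (y : Fin d → ℝ) {r : ℝ} (hr : ∀ i, |y i| ≤ r) :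
    ‖(WithLp.toLp 2 y : 𝔼)‖ ≤ d * r := by
  have : (WithLp.toLp 2 y : 𝔼) = ∑ i, EuclideanSpace.single i (y i) := by
    ext j
    simp
  rw [this]
  refine (norm_sum_le _ _).trans ?_
  calc ∑ i, ‖EuclideanSpace.single i (y i)‖ ≤ ∑ _i : Fin d, r :=
        Finset.sum_le_sum fun i _ => by simpa using hr i
    _ = d * r := by simp

theorem phaseEquiv_le_one_add_norm (c : Equiv.Perm (Fin (d + d))) (z : Fin (d + d) → ℝ) :
    (1 + ‖(phaseEquiv c z).1‖) * (1 + ‖(phaseEquiv c z).2‖) ≤ (d + 1) ^ 2 * (1 + ‖z‖) ^ 2 := by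
  have h1 : ‖(phaseEquiv c z).1‖ ≤ d * ‖z‖ := by
    rw [phaseEquiv_apply]
    exact euclidean_norm_le _ fun i => norm_le_pi_norm z _
  have h2 : ‖(phaseEquiv c z).2‖ ≤ d * ‖z‖ := by
    rw [phaseEquiv_apply]
    exact euclidean_norm_le _ fun i => norm_le_pi_norm z _
  have h3 : 1 + d * ‖z‖ ≤ (d + 1) * (1 + ‖z‖) := by
    nlinarith [norm_nonneg z, (Nat.cast_nonneg d : (0 : ℝ) ≤ d)]
  calc _ ≤ ((d + 1) * (1 + ‖z‖)) * ((d + 1) * (1 + ‖z‖)) :=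
        mul_le_mul (by linarith) (by linarith) (by positivity) (by positivity)
    _ = _ := by ring

theorem exists_schwartzNorm_gaborAtom_le (φ : 𝓢(𝔼, ℂ)) (c : Equiv.Perm (Fin (d + d))) (N : ℕ) :
    ∃ (m : ℕ) (C : ℝ), 0 ≤ C ∧ ∀ z, schwartzNorm N (gaborAtom φ c z) ≤ C * (1 + ‖z‖) ^ m := by
  obtain ⟨m, C, hC, h⟩ := exists_schwartzNorm_timeFrequencyShift_le φ N
  refine ⟨2 * m, C * ((d + 1) ^ 2) ^ m, by positivity, fun z => ?_⟩
  rw [gaborAtom, schwartzNorm_conjSchwartz]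
  refine (h _ _).trans ?_
  calc _ ≤ C * ((d + 1) ^ 2 * (1 + ‖z‖) ^ 2) ^ m := by
        exact mul_le_mul_of_nonneg_left
          (pow_le_pow_left₀ (by positivity) (phaseEquiv_le_one_add_norm c z) m) hC
    _ = _ := by rw [mul_pow, ← pow_mul (1 + ‖z‖), mul_assoc]

/-- For fixed `x` the coefficients, as a function of `ξ`, are the inverse Fourier transform of `ψ *
φ(· - x)`, so the integral over `ξ` is Fourier inversion. -/
theorem integral_fourier_reproducing (φ ψ : 𝓢(𝔼, ℂ)) (x t : 𝔼) :
    ∫ ξ, (∫ s, ψ s * timeFrequencyShift x ξ φ s) * conj (timeFrequencyShift x ξ φ t) =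
      ψ t * (‖φ (t - x)‖ ^ 2 : ℝ) := by
  set h : 𝓢(𝔼, ℂ) := SchwartzMap.pairing (ContinuousLinearMap.mul ℂ ℂ) ψ (φ.compSubConstCLM ℂ x)
    with hh
  have hval : ∀ s, h s = ψ s * φ (s - x) := fun s => by
    simp [hh, SchwartzMap.pairing_apply_apply]
  have h1 : ∀ ξ, ∫ s, ψ s * timeFrequencyShift x ξ φ s = 𝓕⁻ h ξ := by
    intro ξ
    rw [SchwartzMap.fourierInv_coe, Real.fourierInv_eq']
    refine integral_congr_ae (Filter.Eventually.of_forall fun s => ?_)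
    simp only [timeFrequencyShift_apply, hval, smul_eq_mul]
    have : (2 * Real.pi * Complex.I * (inner ℝ s ξ : ℝ) : ℂ) =
        ((2 * Real.pi * inner ℝ s ξ : ℝ) : ℂ) * Complex.I := by push_cast; ring
    rw [this]
    ring
  have h2 : ∀ ξ, conj (timeFrequencyShift x ξ φ t) =
      Complex.exp (((-2 * Real.pi * inner ℝ ξ t : ℝ) : ℂ) * Complex.I) * conj (φ (t - x)) := by
    intro ξ
    rw [timeFrequencyShift_apply, map_mul, ← Complex.exp_conj]
    congr 2
    simp only [map_mul, Complex.conj_I, Complex.conj_ofReal, map_ofNat, real_inner_comm ξ t]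
    push_cast
    ring
  simp only [h1, h2]
  have h3 : ∫ ξ, 𝓕⁻ h ξ * (Complex.exp (((-2 * Real.pi * inner ℝ ξ t : ℝ) : ℂ) * Complex.I) *
      conj (φ (t - x))) = 𝓕 (𝓕⁻ h) t * conj (φ (t - x)) := by
    rw [SchwartzMap.fourier_coe, Real.fourier_eq', ← integral_mul_const]
    refine integral_congr_ae (Filter.Eventually.of_forall fun ξ => ?_)
    simp only [smul_eq_mul]
    ring
  rw [h3, FourierTransform.fourier_fourierInv_eq, hval, mul_assoc, Complex.mul_conj,
    Complex.normSq_eq_norm_sq]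

theorem integrable_one_add_norm_pow {n : ℕ} (C : ℝ) :
    Integrable fun z : Fin n → ℝ => C * ((1 + ‖z‖) ^ (n + 1))⁻¹ := by
  have := (integrable_one_add_norm (E := Fin n → ℝ) (μ := volume) (r := n + 1) (by simp)).const_mul C
  refine this.congr (Filter.Eventually.of_forall fun z => ?_)
  simp only
  rw [Real.rpow_neg (by positivity)]
  norm_cast

/-- Integrating `ψ(t) |φ(t - x)|²` over `x` leaves `‖φ‖₂² ψ(t)`. All Schwartz norms of the integrand
are integrable, because the coefficients decay rapidly while the atoms grow polynomially. -/
theorem isSchwartzIntegral_gaborAtom (φ : 𝓢(𝔼, ℂ)) (c : Equiv.Perm (Fin (d + d))) (ψ : 𝓢(𝔼, ℂ))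
    (hcont : Continuous (gaborAtom φ c))
    (hdecay : ∀ N : ℕ, ∃ (M : ℕ) (C : ℝ), 0 ≤ C ∧ ∀ ψ z,
      (1 + ‖z‖) ^ N * ‖schwartzInner (gaborAtom φ c z) ψ‖ ≤ C * schwartzNorm M ψ) :
    IsSchwartzIntegral volume (fun z => schwartzInner (gaborAtom φ c z) ψ • gaborAtom φ c z)
      (((∫ t, ‖φ t‖ ^ 2 : ℝ) : ℂ) • ψ) := by
  have hΦ : Continuous fun z => schwartzInner (gaborAtom φ c z) ψ • gaborAtom φ c z :=
    ((continuous_schwartzInner_left ψ).comp hcont).smul hcont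
  have hint : ∀ N, Integrable
      (fun z => schwartzNorm N (schwartzInner (gaborAtom φ c z) ψ • gaborAtom φ c z)) := by
    intro N
    obtain ⟨m, C₁, hC₁, h₁⟩ := exists_schwartzNorm_gaborAtom_le φ c N
    -- The exponent `m` absorbs the growth of the atoms; `d + d + 1` gives integrability on `ℝ²ᵈ`.
    obtain ⟨M, C₂, hC₂, h₂⟩ := hdecay (m + (d + d + 1))
    refine (integrable_one_add_norm_pow (C₁ * (C₂ * schwartzNorm M ψ))).mono'
      ((continuous_schwartzNorm N).comp hΦ).aestronglyMeasurable
      (Filter.Eventually.of_forall fun z => ?_)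
    rw [Real.norm_of_nonneg (apply_nonneg _ _), map_smul_eq_mul]
    have hz : 0 < (1 + ‖z‖) ^ (d + d + 1) := by positivity
    rw [← div_eq_mul_inv, le_div_iff₀ hz]
    have h3 := h₂ ψ z
    rw [pow_add] at h3
    calc ‖schwartzInner (gaborAtom φ c z) ψ‖ * schwartzNorm N (gaborAtom φ c z) *
          (1 + ‖z‖) ^ (d + d + 1)
        ≤ ‖schwartzInner (gaborAtom φ c z) ψ‖ * (C₁ * (1 + ‖z‖) ^ m) * (1 + ‖z‖) ^ (d + d + 1) := by
          gcongr
          exact h₁ z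
      _ = C₁ * ((1 + ‖z‖) ^ m * (1 + ‖z‖) ^ (d + d + 1) *
            ‖schwartzInner (gaborAtom φ c z) ψ‖) := by ring
      _ ≤ _ := by gcongr
  refine ⟨hΦ, hint, fun t => ?_⟩
  set G : 𝔼 × 𝔼 → ℂ := fun p =>
    (∫ s, ψ s * timeFrequencyShift p.1 p.2 φ s) * conj (timeFrequencyShift p.1 p.2 φ t) with hG
  have e : ∀ z, (schwartzInner (gaborAtom φ c z) ψ • gaborAtom φ c z) t = G (phaseEquiv c z) := by
    intro z
    rw [smul_apply, schwartzInner_gaborAtom, smul_eq_mul, gaborAtom, conjSchwartz_apply]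
  have hGint : Integrable G ((volume : Measure 𝔼).prod (volume : Measure 𝔼)) := by
    rw [← (measurePreserving_phaseEquiv c).integrable_comp_emb (phaseEquiv c).measurableEmbedding]
    refine ((hint 0).mono' ((TemperedDistribution.delta t).continuous.comp hΦ).aestronglyMeasurable
      (Filter.Eventually.of_forall fun z => norm_apply_le_schwartzNorm
        (schwartzInner (gaborAtom φ c z) ψ • gaborAtom φ c z) t)).congr
      (Filter.Eventually.of_forall e)
  simp only [e]
  rw [(measurePreserving_phaseEquiv c).integral_comp', integral_prod _ hGint]
  simp only [hG, integral_fourier_reproducing]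
  rw [integral_const_mul, integral_complex_ofReal,
    integral_sub_left_eq_self (fun x => ‖φ x‖ ^ 2) volume t, smul_apply, smul_eq_mul, mul_comm]

theorem isReproducingFamily_gaborAtom (φ : 𝓢(𝔼, ℂ)) (hφ : φ ≠ 0) (c : Equiv.Perm (Fin (d + d))) :
    IsReproducingFamily (gaborAtom φ c) (∫ t, ‖φ t‖ ^ 2) := by
  have hcont : Continuous (gaborAtom φ c) :=
    continuous_conjSchwartz.comp ((continuous_timeFrequencyShift φ).comp (continuous_phaseEquiv c))
  have hdecay : ∀ N : ℕ, ∃ (M : ℕ) (C : ℝ), 0 ≤ C ∧ ∀ ψ z,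
      (1 + ‖z‖) ^ N * ‖schwartzInner (gaborAtom φ c z) ψ‖ ≤ C * schwartzNorm M ψ := by
    intro N
    obtain ⟨M, C, hC, h⟩ := exists_norm_integral_mul_timeFrequencyShift_le φ N
    refine ⟨M, C, hC, fun ψ z => le_trans ?_ (h ψ (phaseEquiv c z).1 (phaseEquiv c z).2)⟩
    rw [schwartzInner_gaborAtom]
    gcongr
    exact one_add_norm_le_phaseEquiv c z
  refine ⟨hcont, ?_, hdecay, fun N => ?_, fun f ψ => ?_⟩
  · have h1 : Integrable fun t => ‖φ t‖ ^ 2 := by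
      have := (φ.memLp 2 volume).integrable_norm_pow (by norm_num)
      simpa using this
    refine lt_of_le_of_ne (integral_nonneg fun t => by positivity) fun h0 => hφ ?_
    have hc : Continuous fun t => ‖φ t‖ ^ 2 := by
      have := φ.continuous
      fun_prop
    have h2 := (hc.ae_eq_iff_eq volume continuous_zero).1
      ((integral_eq_zero_iff_of_nonneg (fun t => by positivity) h1).1 h0.symm)
    ext t
    simpa using congrFun h2 t
  · obtain ⟨M, C, hC, h⟩ := hdecay N
    refine ⟨C * schwartzNorm M (conjSchwartz φ), by positivity, fun u z => ?_⟩
    -- Up to a phase the Gram kernel depends only on `z - u`, so its decay is that of the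
    -- coefficients of one Schwartz function.
    have e : ‖schwartzInner (gaborAtom φ c z) (gaborAtom φ c u)‖ =
        ‖schwartzInner (gaborAtom φ c (z - u)) (conjSchwartz φ)‖ := by
      rw [schwartzInner_gaborAtom, schwartzInner_gaborAtom, gaborAtom,
        norm_integral_conj_timeFrequencyShift_mul, phaseEquiv_sub]
      rfl
    rw [e, norm_sub_rev]
    exact h _ _
  · have := (isSchwartzIntegral_gaborAtom φ c ψ hcont hdecay).apply_tempered f
    rw [map_smul, smul_eq_mul] at this
    rw [this]
    refine integral_congr_ae (Filter.Eventually.of_forall fun z => ?_)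
    simp only
    rw [map_smul, smul_eq_mul, mul_comm]

end Reproducing

/-! ### Coorbit norms of a reproducing family -/

/-- A positive weight that is moderate with respect to a power of `1 + ‖z‖`. -/
structure IsTemperateWeight {n : ℕ} (w : (Fin n → ℝ) → ℝ) : Prop where
  aemeasurable : AEMeasurable w
  pos : ∀ z, 0 < w z
  moderate : ∃ (C : ℝ) (s : ℕ), 0 ≤ C ∧ ∀ u z, w u ≤ C * (1 + ‖u - z‖) ^ s * w z

/-- The moderateness bound is symmetric under exchanging `u` and `z`, which is what taking
reciprocals does to it. -/
theorem IsTemperateWeight.one_div {n : ℕ} {w : (Fin n → ℝ) → ℝ} (hw : IsTemperateWeight w) :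
    IsTemperateWeight fun z => 1 / w z := by
  obtain ⟨C, s, hC, h⟩ := hw.moderate
  refine ⟨hw.aemeasurable.const_div 1, fun z => one_div_pos.2 (hw.pos z), C, s, hC, fun u z => ?_⟩
  rw [mul_one_div, div_le_div_iff₀ (hw.pos u) (hw.pos z), one_mul, norm_sub_rev]
  exact h z u

theorem IsTemperateWeight.exists_le {n : ℕ} {w : (Fin n → ℝ) → ℝ} (hw : IsTemperateWeight w) :
    ∃ (C : ℝ) (s : ℕ), 0 ≤ C ∧ ∀ z, w z ≤ C * (1 + ‖z‖) ^ s := by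
  obtain ⟨C, s, hC, h⟩ := hw.moderate
  refine ⟨C * w 0, s, mul_nonneg hC (hw.pos 0).le, fun z => ?_⟩
  have := h z 0
  rw [sub_zero] at this
  linarith

section Coorbit

variable {d n : ℕ}

local notation "𝔼" => EuclideanSpace ℝ (Fin d)

/-- The weighted mixed norm of the coefficients of a tempered distribution. -/
noncomputable def coorbitNorm (U : (Fin n → ℝ) → 𝓢(𝔼, ℂ)) (w : (Fin n → ℝ) → ℝ) (p : Fin n → ℝ≥0∞)
    (f : 𝓢'(𝔼, ℂ)) : ℝ≥0∞ :=
  mixedNorm p w fun z => f (U z)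

variable {U : (Fin n → ℝ) → 𝓢(EuclideanSpace ℝ (Fin d), ℂ)} {A : ℝ} {w : (Fin n → ℝ) → ℝ} {p q : Fin n → ℝ≥0∞}

theorem mixedNorm_eq (p : Fin n → ℝ≥0∞) {w : (Fin n → ℝ) → ℝ} (hw : ∀ z, 0 < w z)
    (F : (Fin n → ℝ) → ℂ) :
    mixedNorm p w F = iteratedNorm n p fun z => ‖F z‖ₑ * ENNReal.ofReal (w z) := by
  refine congrArg (iteratedNorm n p) (funext fun z => ?_)
  rw [enorm_mul]
  congr 1
  rw [← ofReal_norm, Complex.norm_real, Real.norm_of_nonneg (hw z).le]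

theorem IsTemperateWeight.aemeasurable_mul (hw : IsTemperateWeight w) {F : (Fin n → ℝ) → ℂ}
    (hF : AEMeasurable F) : AEMeasurable fun z => ‖F z‖ₑ * ENNReal.ofReal (w z) :=
  hF.enorm.mul hw.aemeasurable.ennreal_ofReal

theorem IsReproducingFamily.continuous_apply (hU : IsReproducingFamily U A) (f : 𝓢'(𝔼, ℂ)) :
    Continuous fun z => f (U z) :=
  f.continuous.comp hU.continuous

theorem IsReproducingFamily.eq_zero (hU : IsReproducingFamily U A) {f : 𝓢'(𝔼, ℂ)}
    (h : ∀ z, f (U z) = 0) : f = 0 := by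
  ext ψ
  have h1 := hU.reproducing f ψ
  simp only [h, zero_mul, integral_zero] at h1
  have hA : (A : ℂ) ≠ 0 := by exact_mod_cast hU.pos.ne'
  simpa [hA] using h1

/-- For definiteness: zero norm makes the coefficients vanish almost everywhere, by continuity
everywhere, and the reproducing formula then recovers `f = 0`. -/
theorem isExtendedNorm_coorbitNorm (hU : IsReproducingFamily U A) (hw : IsTemperateWeight w)
    (hp : ∀ i, 1 ≤ p i) : IsExtendedNorm (coorbitNorm U w p) where
  map_add_le f g := by
    simp only [coorbitNorm, mixedNorm_eq p hw.pos]
    refine le_trans (iteratedNorm_mono p fun z => ?_) (iteratedNorm_add_le p hp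
      (hw.aemeasurable_mul (hU.continuous_apply f).measurable.aemeasurable)
      (hw.aemeasurable_mul (hU.continuous_apply g).measurable.aemeasurable))
    rw [← add_mul]
    gcongr
    exact enorm_add_le (f (U z)) (g (U z))
  map_smul a f := by
    simp only [coorbitNorm, mixedNorm_eq p hw.pos]
    rw [← iteratedNorm_const_mul (by simp)]
    congr 1
    funext z
    rw [← mul_assoc, ← enorm_mul]
    rfl
  eq_zero f hf := by
    simp only [coorbitNorm, mixedNorm_eq p hw.pos] at hf
    have h1 := ae_eq_zero_of_iteratedNorm_eq_zero p
      (fun i h => by have := hp i; simp [h] at this)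
      (hw.aemeasurable_mul (hU.continuous_apply f).measurable.aemeasurable) hf
    have h2 : (fun z => f (U z)) =ᵐ[volume] fun _ => 0 := by
      filter_upwards [h1] with z hz
      have hz' : ‖f (U z)‖ₑ * ENNReal.ofReal (w z) = 0 := hz
      have h0 : ENNReal.ofReal (w z) ≠ 0 := by simpa using hw.pos z
      simpa [h0] using hz'
    exact hU.eq_zero fun z => congrFun
      (((hU.continuous_apply f).ae_eq_iff_eq volume continuous_const).1 h2) z

/-- The weighted mixed norms of the coefficients of Schwartz functions are controlled by a Schwartz
norm. -/
theorem exists_iteratedNorm_schwartzInner_le (hU : IsReproducingFamily U A)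
    (hw : IsTemperateWeight w) (hp : ∀ i, 1 ≤ p i) :
    ∃ (M : ℕ) (C : ℝ), 0 ≤ C ∧ ∀ ψ : 𝓢(𝔼, ℂ),
      iteratedNorm n p (fun z => ‖schwartzInner (U z) ψ‖ₑ * ENNReal.ofReal (w z)) ≤
        ENNReal.ofReal (C * schwartzNorm M ψ) := by
  obtain ⟨C₁, s, hC₁, h₁⟩ := hw.exists_le
  -- The exponent `s` absorbs the growth of the weight, and `2 * n` makes the mixed norm finite for
  -- all exponents.
  obtain ⟨M, C₂, hC₂, h₂⟩ := hU.decay (s + 2 * n)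
  have hfin := iteratedNorm_one_add_norm_ne_top (n := n) hp (r := ((2 * n : ℕ) : ℝ)) (by simp)
  set I := iteratedNorm n p (fun z => ENNReal.ofReal ((1 + ‖z‖) ^ (-((2 * n : ℕ) : ℝ)))) with hI
  refine ⟨M, C₁ * C₂ * I.toReal, by positivity, fun ψ => ?_⟩
  have hle : ∀ z, ‖schwartzInner (U z) ψ‖ₑ * ENNReal.ofReal (w z) ≤
      ENNReal.ofReal (C₁ * C₂ * schwartzNorm M ψ) *
        ENNReal.ofReal ((1 + ‖z‖) ^ (-((2 * n : ℕ) : ℝ))) := by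
    intro z
    rw [← ofReal_norm, ← ENNReal.ofReal_mul (norm_nonneg _),
      ← ENNReal.ofReal_mul (by positivity)]
    refine ENNReal.ofReal_le_ofReal ?_
    rw [Real.rpow_neg (by positivity), Real.rpow_natCast, ← div_eq_mul_inv,
      le_div_iff₀ (by positivity)]
    have h3 := h₂ ψ z
    rw [pow_add] at h3
    calc ‖schwartzInner (U z) ψ‖ * w z * (1 + ‖z‖) ^ (2 * n)
        ≤ ‖schwartzInner (U z) ψ‖ * (C₁ * (1 + ‖z‖) ^ s) * (1 + ‖z‖) ^ (2 * n) := by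
          gcongr
          exact h₁ z
      _ = C₁ * ((1 + ‖z‖) ^ s * (1 + ‖z‖) ^ (2 * n) * ‖schwartzInner (U z) ψ‖) := by ring
      _ ≤ C₁ * (C₂ * schwartzNorm M ψ) := mul_le_mul_of_nonneg_left h3 hC₁
      _ = _ := by ring
  refine (iteratedNorm_mono p hle).trans ?_
  rw [iteratedNorm_const_mul ENNReal.ofReal_ne_top, ← hI, ← ENNReal.ofReal_toReal hfin,
    ← ENNReal.ofReal_mul (by positivity), ENNReal.toReal_ofReal (by positivity)]
  exact ENNReal.ofReal_le_ofReal (le_of_eq (by ring))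

/-- Coorbit spaces embed into the tempered distributions. -/
theorem exists_enorm_apply_le (hU : IsReproducingFamily U A) (hw : IsTemperateWeight w)
    (hp : ∀ i, 1 ≤ p i) :
    ∃ (M : ℕ) (C : ℝ), 0 ≤ C ∧ ∀ (f : 𝓢'(𝔼, ℂ)) (ψ : 𝓢(𝔼, ℂ)),
      ‖f ψ‖ₑ ≤ ENNReal.ofReal (C * schwartzNorm M ψ) * coorbitNorm U w p f := by
  choose q hq1 hq using fun i => exists_holderConjugate (hp i)
  obtain ⟨M, C, hC, h⟩ := exists_iteratedNorm_schwartzInner_le hU hw.one_div hq1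
  refine ⟨M, A⁻¹ * C, mul_nonneg (inv_nonneg.2 hU.pos.le) hC, fun f ψ => ?_⟩
  have hA : ENNReal.ofReal A ≠ 0 := by simpa using hU.pos
  -- Hölder's inequality in the reproducing formula, after inserting `(1 / w) * w = 1`.
  have h1 : ENNReal.ofReal A * ‖f ψ‖ₑ ≤
      ENNReal.ofReal (C * schwartzNorm M ψ) * coorbitNorm U w p f := by
    calc ENNReal.ofReal A * ‖f ψ‖ₑ = ‖(A : ℂ) * f ψ‖ₑ := by
          rw [enorm_mul, ← ofReal_norm (A : ℂ), Complex.norm_real,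
            Real.norm_of_nonneg hU.pos.le]
      _ ≤ ∫⁻ z, ‖f (U z) * schwartzInner (U z) ψ‖ₑ := by
          rw [hU.reproducing]
          exact enorm_integral_le_lintegral_enorm _
      _ = ∫⁻ z, (‖schwartzInner (U z) ψ‖ₑ * ENNReal.ofReal (1 / w z)) *
            (‖f (U z)‖ₑ * ENNReal.ofReal (w z)) := by
          refine lintegral_congr fun z => ?_
          have : ENNReal.ofReal (1 / w z) * ENNReal.ofReal (w z) = 1 := by
            rw [← ENNReal.ofReal_mul (one_div_nonneg.2 (hw.pos z).le),
              one_div_mul_cancel (hw.pos z).ne', ENNReal.ofReal_one]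
          rw [enorm_mul, mul_mul_mul_comm, this, mul_one, mul_comm]
      _ ≤ _ := lintegral_mul_le_iteratedNorm hq
          (hw.one_div.aemeasurable_mul
            ((continuous_schwartzInner_left ψ).comp hU.continuous).measurable.aemeasurable)
          (hw.aemeasurable_mul (hU.continuous_apply f).measurable.aemeasurable)
      _ ≤ _ := by
          rw [coorbitNorm, mixedNorm_eq p hw.pos]
          gcongr
          exact h ψ
  rw [mul_assoc, ENNReal.ofReal_mul (inv_nonneg.2 hU.pos.le), ENNReal.ofReal_inv_of_pos hU.pos,
    mul_assoc]
  calc ‖f ψ‖ₑ = (ENNReal.ofReal A)⁻¹ * (ENNReal.ofReal A * ‖f ψ‖ₑ) := by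
        rw [← mul_assoc, ENNReal.inv_mul_cancel hA ENNReal.ofReal_ne_top, one_mul]
    _ ≤ _ := by gcongr

theorem enorm_val {N : 𝓢'(𝔼, ℂ) → ℝ≥0∞} (h : IsExtendedNorm N) (f : h.Space) : ‖f‖ₑ = N f.val := by
  rw [← ofReal_norm]
  exact ENNReal.ofReal_toReal f.val_lt_top.ne

theorem val_sub {N : 𝓢'(𝔼, ℂ) → ℝ≥0∞} {h : IsExtendedNorm N} (f g : h.Space) :
    (f - g).val = f.val - g.val := rfl

/-- Evaluation at a Schwartz function is bounded, so a Cauchy sequence converges pointwise, and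
uniform boundedness makes the limit tempered. In particular the coefficients converge everywhere, so
Fatou's lemma gives the limit in norm. -/
theorem completeSpace_coorbit (hU : IsReproducingFamily U A) (hw : IsTemperateWeight w)
    (hp : ∀ i, 1 ≤ p i) : CompleteSpace (isExtendedNorm_coorbitNorm hU hw hp).Space := by
  set h := isExtendedNorm_coorbitNorm hU hw hp with hh
  obtain ⟨M, C, hC, hev⟩ := exists_enorm_apply_le hU hw hp
  have hev' : ∀ (f : h.Space) ψ, ‖f.val ψ‖ ≤ C * schwartzNorm M ψ * ‖f‖ := by
    intro f ψ
    have h1 := hev f.val ψ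
    rw [← enorm_val h f, ← ofReal_norm, ← ofReal_norm,
      ← ENNReal.ofReal_mul (by positivity)] at h1
    exact (ENNReal.ofReal_le_ofReal_iff (by positivity)).1 h1
  refine Metric.complete_of_cauchySeq_tendsto fun u hu => ?_
  have hcau : ∀ ψ, CauchySeq fun k => (u k).val ψ := by
    intro ψ
    refine Metric.cauchySeq_iff'.2 fun ε hε => ?_
    have hK : 0 < C * schwartzNorm M ψ + 1 := by positivity
    obtain ⟨N, hN⟩ := Metric.cauchySeq_iff'.1 hu (ε / (C * schwartzNorm M ψ + 1)) (by positivity)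
    refine ⟨N, fun k hk => ?_⟩
    have h1 := hev' (u k - u N) ψ
    have h2 := hN k hk
    rw [dist_eq_norm, lt_div_iff₀ hK] at h2
    rw [dist_eq_norm]
    refine lt_of_le_of_lt h1 (lt_of_le_of_lt ?_ h2)
    rw [mul_comm]
    gcongr
    linarith
  choose F hF using fun ψ => cauchySeq_tendsto_of_complete (hcau ψ)
  obtain ⟨R, hR⟩ := hu.isBounded_range.exists_norm_le
  let F₀ : 𝓢(𝔼, ℂ) →ₗ[ℂ] ℂ :=
    { toFun := F
      map_add' := fun ψ χ => by
        refine tendsto_nhds_unique (hF (ψ + χ)) ?_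
        simpa only [map_add] using (hF ψ).add (hF χ)
      map_smul' := fun a ψ => by
        refine tendsto_nhds_unique (hF (a • ψ)) ?_
        simpa only [map_smul, RingHom.id_apply] using (hF ψ).const_smul a }
  set g : 𝓢'(𝔼, ℂ) := temperedOfBound F₀ M (C * R) (fun ψ => by
    refine le_of_tendsto (hF ψ).norm (Filter.Eventually.of_forall fun k => (hev' (u k) ψ).trans ?_)
    rw [mul_right_comm]
    have := hR (u k) ⟨k, rfl⟩
    gcongr) with hg
  have hfatou : ∀ ε : ℝ≥0∞, ∀ N, (∀ k ≥ N, ‖u k - u N‖ₑ ≤ ε) →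
      coorbitNorm U w p (g - (u N).val) ≤ ε := by
    intro ε N hN
    rw [coorbitNorm, mixedNorm_eq p hw.pos]
    refine iteratedNorm_le_of_tendsto p
      (F := fun k z => ‖((u k).val - (u N).val) (U z)‖ₑ * ENNReal.ofReal (w z))
      (fun k => hw.aemeasurable_mul (hU.continuous_apply _).measurable.aemeasurable)
      (fun z => ?_) (Filter.eventually_atTop.2 ⟨N, fun k hk => ?_⟩)
    · refine ENNReal.Tendsto.mul_const ?_ (Or.inr ENNReal.ofReal_ne_top)
      exact (continuous_enorm.tendsto _).comp ((hF (U z)).sub_const _)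
    · rw [← mixedNorm_eq p hw.pos]
      refine le_trans (le_of_eq ?_) (hN k hk)
      rw [enorm_val, val_sub]
      rfl
  have hcau2 : ∀ ε : ℝ, 0 < ε → ∃ N, ∀ k ≥ N, ‖u k - u N‖ₑ ≤ ENNReal.ofReal ε := by
    intro ε hε
    obtain ⟨N, hN⟩ := Metric.cauchySeq_iff'.1 hu ε hε
    refine ⟨N, fun k hk => ?_⟩
    rw [← ofReal_norm, ← dist_eq_norm]
    exact ENNReal.ofReal_le_ofReal (hN k hk).le
  have hgfin : coorbitNorm U w p g < ∞ := by
    obtain ⟨N, hN⟩ := hcau2 1 one_pos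
    have h1 := h.map_add_le (g - (u N).val) (u N).val
    rw [sub_add_cancel] at h1
    exact h1.trans_lt (ENNReal.add_lt_top.2
      ⟨(hfatou _ N hN).trans_lt ENNReal.ofReal_lt_top, (u N).val_lt_top⟩)
  let g' : h.Space := ⟨g, hgfin⟩
  refine ⟨g', tendsto_iff_norm_sub_tendsto_zero.2 ?_⟩
  refine Metric.tendsto_atTop.2 fun ε hε => ?_
  obtain ⟨N₀, hN₀⟩ := Metric.cauchySeq_iff.1 hu (ε / 2) (by positivity)
  refine ⟨N₀, fun m hm => ?_⟩
  have h1 : ‖g' - u m‖ₑ ≤ ENNReal.ofReal (ε / 2) := by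
    rw [enorm_val, val_sub]
    refine hfatou _ m fun k hk => ?_
    rw [← ofReal_norm, ← dist_eq_norm]
    exact ENNReal.ofReal_le_ofReal (hN₀ k (hm.trans hk) m hm).le
  rw [← ofReal_norm, ENNReal.ofReal_le_ofReal_iff (by positivity)] at h1
  rw [dist_zero_right, norm_norm, norm_sub_rev]
  linarith

end Coorbit

/-! ### The Gram kernel, superpositions of atoms, and the pairing. -/

section Coorbit

variable {d n : ℕ}

local notation "𝔼" => EuclideanSpace ℝ (Fin d)

variable {U : (Fin n → ℝ) → 𝓢(EuclideanSpace ℝ (Fin d), ℂ)} {A : ℝ} {w : (Fin n → ℝ) → ℝ}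
  {p q : Fin n → ℝ≥0∞}

/-- The Gram kernel of a reproducing family is bounded on weighted mixed norm spaces. -/
theorem exists_iteratedNorm_lintegral_mul_le (hU : IsReproducingFamily U A)
    (hw : IsTemperateWeight w) (hp : ∀ i, 1 ≤ p i) :
    ∃ C : ℝ≥0∞, C ≠ ∞ ∧ ∀ H : (Fin n → ℝ) → ℝ≥0∞, AEMeasurable H →
      iteratedNorm n p
        (fun u => (∫⁻ z, H z * ‖schwartzInner (U z) (U u)‖ₑ) * ENNReal.ofReal (w u)) ≤
        C * iteratedNorm n p fun z => H z * ENNReal.ofReal (w z) := by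
  obtain ⟨C₁, s, hC₁, h₁⟩ := hw.moderate
  -- Replacing `w u` by `w z` costs `(1 + ‖u - z‖) ^ s`. The remaining `n + 1` powers of decay form
  -- an integrable convolution kernel, and Young's inequality applies.
  obtain ⟨C₂, hC₂, h₂⟩ := hU.offDiagonal (s + (n + 1))
  set K : (Fin n → ℝ) → ℝ≥0∞ := fun y => ENNReal.ofReal (C₁ * C₂ * ((1 + ‖y‖) ^ (n + 1))⁻¹) with hK
  have hKm : Measurable K := by
    refine (Continuous.measurable ?_).ennreal_ofReal
    refine continuous_const.mul (Continuous.inv₀ (by fun_prop) fun y => by positivity)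
  have hKfin : ∫⁻ y, K y ≠ ∞ := (integrable_one_add_norm_pow (n := n) (C₁ * C₂)).lintegral_lt_top.ne
  refine ⟨2 ^ n * ∫⁻ y, K y, ENNReal.mul_ne_top (by simp) hKfin, fun H hH => ?_⟩
  have hH' : AEMeasurable fun z => H z * ENNReal.ofReal (w z) :=
    hH.mul hw.aemeasurable.ennreal_ofReal
  refine (iteratedNorm_mono p fun u => ?_).trans (iteratedNorm_convolution_le hp hH' hKm)
  rw [← lintegral_mul_const' _ _ ENNReal.ofReal_ne_top]
  refine lintegral_mono fun z => ?_
  rw [mul_assoc, mul_assoc]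
  refine mul_le_mul_right ?_ _
  rw [hK, ← ofReal_norm, ← ENNReal.ofReal_mul (norm_nonneg _),
    ← ENNReal.ofReal_mul (hw.pos z).le]
  refine ENNReal.ofReal_le_ofReal ?_
  have h3 := h₂ u z
  rw [pow_add, mul_comm (_ * _)] at h3
  have hwz := hw.pos z
  rw [← mul_assoc, ← div_eq_mul_inv, le_div_iff₀ (by positivity)]
  calc ‖schwartzInner (U z) (U u)‖ * w u * (1 + ‖u - z‖) ^ (n + 1)
      ≤ ‖schwartzInner (U z) (U u)‖ * (C₁ * (1 + ‖u - z‖) ^ s * w z) * (1 + ‖u - z‖) ^ (n + 1) := by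
        refine mul_le_mul_of_nonneg_right ?_ (by positivity)
        exact mul_le_mul_of_nonneg_left (h₁ u z) (norm_nonneg _)
    _ = C₁ * w z *
          (‖schwartzInner (U z) (U u)‖ * ((1 + ‖u - z‖) ^ s * (1 + ‖u - z‖) ^ (n + 1))) := by ring
    _ ≤ C₁ * w z * C₂ := mul_le_mul_of_nonneg_left h3 (by positivity)
    _ = w z * (C₁ * C₂) := by ring

/-! ### Schwartz functions as elements of a coorbit space -/

/-- The tempered distribution with density `conj ψ`. -/
noncomputable def schwartzDual (ψ : 𝓢(𝔼, ℂ)) : 𝓢'(𝔼, ℂ) :=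
  SchwartzMap.toTemperedDistributionCLM 𝔼 ℂ volume (conjSchwartz ψ)

theorem schwartzDual_apply (ψ χ : 𝓢(𝔼, ℂ)) : schwartzDual ψ χ = schwartzInner ψ χ :=
  (schwartzInner_eq ψ χ).symm

theorem schwartzDual_add (ψ χ : 𝓢(𝔼, ℂ)) :
    schwartzDual (ψ + χ) = schwartzDual ψ + schwartzDual χ := by
  rw [schwartzDual, schwartzDual, schwartzDual, ← map_add]
  congr 1
  ext t
  simp [conjSchwartz_apply]

theorem schwartzDual_smul (a : ℂ) (ψ : 𝓢(𝔼, ℂ)) :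
    schwartzDual (a • ψ) = conj a • schwartzDual ψ := by
  rw [schwartzDual, schwartzDual, ← map_smul]
  congr 1
  ext t
  simp [conjSchwartz_apply]

theorem exists_coorbitNorm_schwartzDual_le (hU : IsReproducingFamily U A)
    (hw : IsTemperateWeight w) (hp : ∀ i, 1 ≤ p i) :
    ∃ (M : ℕ) (C : ℝ), 0 ≤ C ∧ ∀ ψ : 𝓢(𝔼, ℂ),
      coorbitNorm U w p (schwartzDual ψ) ≤ ENNReal.ofReal (C * schwartzNorm M ψ) := by
  obtain ⟨M, C, hC, h⟩ := exists_iteratedNorm_schwartzInner_le hU hw hp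
  refine ⟨M, C, hC, fun ψ => le_trans (le_of_eq ?_) (h ψ)⟩
  rw [coorbitNorm, mixedNorm_eq p hw.pos]
  congr 1
  funext z
  rw [schwartzDual_apply, ← conj_schwartzInner, RCLike.enorm_conj]

/-- The space of the tempered distributions of finite coorbit norm. -/
abbrev CoorbitSpace (hU : IsReproducingFamily U A) (hw : IsTemperateWeight w)
    (hp : ∀ i, 1 ≤ p i) : Type :=
  (isExtendedNorm_coorbitNorm hU hw hp).Space

variable (hU : IsReproducingFamily U A) (hw : IsTemperateWeight w) (hp : ∀ i, 1 ≤ p i)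

/-- The tempered distribution with density `conj ψ`, as an element of a coorbit space. -/
noncomputable def CoorbitSpace.ofSchwartz (ψ : 𝓢(𝔼, ℂ)) : CoorbitSpace hU hw hp :=
  ⟨schwartzDual ψ, by
    obtain ⟨M, C, -, h⟩ := exists_coorbitNorm_schwartzDual_le hU hw hp
    exact (h ψ).trans_lt ENNReal.ofReal_lt_top⟩

namespace CoorbitSpace

theorem val_ofSchwartz (ψ : 𝓢(𝔼, ℂ)) : (ofSchwartz hU hw hp ψ).val = schwartzDual ψ := rfl

theorem ofSchwartz_add (ψ χ : 𝓢(𝔼, ℂ)) :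
    ofSchwartz hU hw hp (ψ + χ) = ofSchwartz hU hw hp ψ + ofSchwartz hU hw hp χ :=
  Subtype.ext (schwartzDual_add ψ χ)

theorem ofSchwartz_smul (a : ℂ) (ψ : 𝓢(𝔼, ℂ)) :
    ofSchwartz hU hw hp (a • ψ) = conj a • ofSchwartz hU hw hp ψ :=
  Subtype.ext (schwartzDual_smul a ψ)

theorem exists_norm_ofSchwartz_le :
    ∃ (M : ℕ) (C : ℝ), 0 ≤ C ∧ ∀ ψ : 𝓢(𝔼, ℂ),
      ‖ofSchwartz hU hw hp ψ‖ ≤ C * schwartzNorm M ψ := by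
  obtain ⟨M, C, hC, h⟩ := exists_coorbitNorm_schwartzDual_le hU hw hp
  refine ⟨M, C, hC, fun ψ => ?_⟩
  rw [← ENNReal.ofReal_le_ofReal_iff (by positivity), ofReal_norm, enorm_val]
  exact h ψ

theorem continuous_ofSchwartz : Continuous (ofSchwartz hU hw hp) := by
  obtain ⟨M, C, hC, h⟩ := exists_norm_ofSchwartz_le hU hw hp
  let L : 𝓢(𝔼, ℂ) →+ CoorbitSpace hU hw hp :=
    AddMonoidHom.mk' (ofSchwartz hU hw hp) (ofSchwartz_add hU hw hp)
  refine continuous_iff_continuousAt.2 fun ψ => tendsto_iff_norm_sub_tendsto_zero.2 ?_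
  have h1 : Filter.Tendsto (fun χ => C * schwartzNorm M (χ - ψ)) (nhds ψ) (nhds 0) := by
    simpa using (tendsto_schwartz_iff.1 (Filter.tendsto_id (x := nhds ψ)) M).const_mul C
  refine squeeze_zero (fun _ => norm_nonneg _) (fun χ => ?_) h1
  have : ofSchwartz hU hw hp χ - ofSchwartz hU hw hp ψ = ofSchwartz hU hw hp (χ - ψ) :=
    (map_sub L χ ψ).symm
  rw [this]
  exact h _

theorem exists_norm_val_apply_le :
    ∃ (M : ℕ) (C : ℝ), 0 ≤ C ∧ ∀ (f : CoorbitSpace hU hw hp) (ψ : 𝓢(𝔼, ℂ)),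
      ‖f.val ψ‖ ≤ C * schwartzNorm M ψ * ‖f‖ := by
  obtain ⟨M, C, hC, h⟩ := exists_enorm_apply_le hU hw hp
  refine ⟨M, C, hC, fun f ψ => ?_⟩
  have h1 := h f.val ψ
  rw [← enorm_val (isExtendedNorm_coorbitNorm hU hw hp), ← ofReal_norm, ← ofReal_norm, ← ENNReal.ofReal_mul (by positivity)] at h1
  exact (ENNReal.ofReal_le_ofReal_iff (by positivity)).1 h1

/-- Evaluation at a Schwartz function, as a bounded linear functional. -/
theorem exists_strongDual_apply (ψ : 𝓢(𝔼, ℂ)) :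
    ∃ L : StrongDual ℂ (CoorbitSpace hU hw hp), ∀ f, L f = f.val ψ := by
  obtain ⟨M, C, hC, h⟩ := exists_norm_val_apply_le hU hw hp
  let L : CoorbitSpace hU hw hp →ₗ[ℂ] ℂ :=
    { toFun := fun f => f.val ψ
      map_add' := fun f g => rfl
      map_smul' := fun a f => rfl }
  exact ⟨L.mkContinuous _ fun f => h f ψ, fun f => rfl⟩

/-- Superposition of the atoms of a reproducing family. -/
theorem exists_synthesis :
    ∃ C : ℝ≥0∞, C ≠ ∞ ∧ ∀ G : (Fin n → ℝ) → ℂ, AEMeasurable G → ∀ R B : ℝ, (∀ z, ‖G z‖ ≤ B) →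
      (∀ z, R < ‖z‖ → G z = 0) → ∃ b : CoorbitSpace hU hw hp,
        (∀ L : StrongDual ℂ (CoorbitSpace hU hw hp),
          Integrable (fun z => G z * L (ofSchwartz hU hw hp (U z))) ∧
          L b = ∫ z, G z * L (ofSchwartz hU hw hp (U z))) ∧
        (∀ ψ, Integrable (fun z => G z * schwartzInner (U z) ψ) ∧
          b.val ψ = ∫ z, G z * schwartzInner (U z) ψ) ∧
        ‖b‖ₑ ≤ C * iteratedNorm n p fun z => ‖G z‖ₑ * ENNReal.ofReal (w z) := by
  obtain ⟨C, hC, h⟩ := exists_iteratedNorm_lintegral_mul_le hU hw hp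
  refine ⟨C, hC, fun G hG R B hB hR => ?_⟩
  -- Completeness allows the superposition to be a Bochner integral in the coorbit space itself,
  -- which commutes with every bounded functional, evaluations included.
  have := completeSpace_coorbit hU hw hp
  have he : Continuous fun z => ofSchwartz hU hw hp (U z) :=
    (continuous_ofSchwartz hU hw hp).comp hU.continuous
  obtain ⟨E, hE⟩ := (isCompact_closedBall (0 : Fin n → ℝ) R).exists_bound_of_continuousOn
    he.continuousOn
  have hint : Integrable fun z => G z • ofSchwartz hU hw hp (U z) := by
    refine Integrable.mono' (g := (Metric.closedBall (0 : Fin n → ℝ) R).indicator fun _ => B * E)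
      ((integrable_indicator_iff measurableSet_closedBall).2
        (integrableOn_const (measure_closedBall_lt_top.ne)))
      (hG.aestronglyMeasurable.smul he.aestronglyMeasurable)
      (Filter.Eventually.of_forall fun z => ?_)
    by_cases hz : ‖z‖ ≤ R
    · have hz' : z ∈ Metric.closedBall (0 : Fin n → ℝ) R := by simpa using hz
      rw [Set.indicator_of_mem hz', norm_smul]
      exact mul_le_mul (hB z) (hE z hz') (norm_nonneg _) ((norm_nonneg _).trans (hB z))
    · have hz' : z ∉ Metric.closedBall (0 : Fin n → ℝ) R := by simpa using hz
      rw [Set.indicator_of_notMem hz', hR z (not_le.1 hz), zero_smul, norm_zero]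
  have hL : ∀ L : StrongDual ℂ (CoorbitSpace hU hw hp),
      Integrable (fun z => G z * L (ofSchwartz hU hw hp (U z))) ∧
      L (∫ z, G z • ofSchwartz hU hw hp (U z)) = ∫ z, G z * L (ofSchwartz hU hw hp (U z)) := by
    intro L
    refine ⟨?_, ?_⟩
    · simpa only [map_smul, smul_eq_mul] using L.integrable_comp hint
    · rw [← L.integral_comp_comm hint]
      simp only [map_smul, smul_eq_mul]
  have hψ : ∀ ψ, Integrable (fun z => G z * schwartzInner (U z) ψ) ∧
      (∫ z, G z • ofSchwartz hU hw hp (U z)).val ψ = ∫ z, G z * schwartzInner (U z) ψ := by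
    intro ψ
    obtain ⟨L, hLψ⟩ := exists_strongDual_apply hU hw hp ψ
    have := hL L
    simpa only [hLψ, val_ofSchwartz, schwartzDual_apply] using this
  refine ⟨_, hL, hψ, ?_⟩
  -- The coefficient at `u` is the integral of `G` against the Gram kernel.
  rw [enorm_val, coorbitNorm, mixedNorm_eq p hw.pos]
  refine (iteratedNorm_mono p fun u => ?_).trans (h _ hG.enorm)
  refine mul_le_mul_left ?_ _
  rw [(hψ (U u)).2]
  refine (enorm_integral_le_lintegral_enorm _).trans (le_of_eq ?_)
  simp only [enorm_mul]

end CoorbitSpace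

/-! ### The pairing -/

theorem lintegral_enorm_mul_le (hU : IsReproducingFamily U A) (hw : IsTemperateWeight w)
    (hpq : ∀ i, 1 / p i + 1 / q i = 1) (f g : 𝓢'(𝔼, ℂ)) :
    ∫⁻ z, ‖f (U z) * conj (g (U z))‖ₑ ≤
      coorbitNorm U w p f * coorbitNorm U (fun z => 1 / w z) q g := by
  rw [coorbitNorm, mixedNorm_eq p hw.pos, coorbitNorm, mixedNorm_eq q hw.one_div.pos]
  refine le_trans (le_of_eq ?_) (lintegral_mul_le_iteratedNorm hpq
    (hw.aemeasurable_mul (hU.continuous_apply f).measurable.aemeasurable)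
    (hw.one_div.aemeasurable_mul (hU.continuous_apply g).measurable.aemeasurable))
  refine lintegral_congr fun z => ?_
  have : ENNReal.ofReal (w z) * ENNReal.ofReal (1 / w z) = 1 := by
    rw [← ENNReal.ofReal_mul (hw.pos z).le, mul_one_div_cancel (hw.pos z).ne', ENNReal.ofReal_one]
  rw [mul_mul_mul_comm, this, mul_one, enorm_mul, RCLike.enorm_conj]

theorem integrable_mul_conj (hU : IsReproducingFamily U A) (hw : IsTemperateWeight w)
    (hpq : ∀ i, 1 / p i + 1 / q i = 1) {f g : 𝓢'(𝔼, ℂ)}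
    (hf : coorbitNorm U w p f < ∞) (hg : coorbitNorm U (fun z => 1 / w z) q g < ∞) :
    Integrable fun z => f (U z) * conj (g (U z)) := by
  refine ⟨Continuous.aestronglyMeasurable ?_,
    (lintegral_enorm_mul_le hU hw hpq f g).trans_lt (ENNReal.mul_lt_top hf hg)⟩
  exact (hU.continuous_apply f).mul (Complex.continuous_conj.comp (hU.continuous_apply g))

end Coorbit

/-! ### Duality of coorbit spaces -/

section CoorbitDuality

variable {d n : ℕ}

local notation "𝔼" => EuclideanSpace ℝ (Fin d)

variable {U : (Fin n → ℝ) → 𝓢(EuclideanSpace ℝ (Fin d), ℂ)} {A : ℝ} {w : (Fin n → ℝ) → ℝ}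
  {p q : Fin n → ℝ≥0∞}

theorem eq_zero_of_forall_integral_eq_zero (hU : IsReproducingFamily U A) {g : 𝓢'(𝔼, ℂ)}
    (h : ∀ ψ, ∫ z, schwartzDual ψ (U z) * conj (g (U z)) = 0) : g = 0 := by
  ext ψ
  have h1 : conj ((A : ℂ) * g ψ) = 0 := by
    rw [hU.reproducing, ← integral_conj, ← h ψ]
    refine integral_congr_ae (Filter.Eventually.of_forall fun z => ?_)
    simp only [map_mul, schwartzDual_apply, conj_schwartzInner]
    exact mul_comm _ _
  have hA : (A : ℂ) ≠ 0 := by exact_mod_cast hU.pos.ne'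
  simpa [hA] using h1

/-- A phase factor: `u * conj a = ‖a‖` and `‖u‖ ≤ 1`. -/
theorem mul_conj_div_norm (a : ℂ) : a / (‖a‖ : ℂ) * conj a = (‖a‖ : ℂ) := by
  rcases eq_or_ne a 0 with rfl | ha
  · simp
  · have : (‖a‖ : ℂ) ≠ 0 := by simpa using ha
    rw [div_mul_eq_mul_div, Complex.mul_conj, Complex.normSq_eq_norm_sq]
    field_simp
    push_cast
    ring

theorem norm_div_norm_le (a : ℂ) : ‖a / (‖a‖ : ℂ)‖ ≤ 1 := by
  rw [norm_div, Complex.norm_real, norm_norm]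
  exact div_self_le_one _

/-- A tempered distribution that represents a bounded functional on the atoms of a coorbit space
lies in the dual coorbit space. -/
theorem coorbitNorm_lt_top_of_strongDual (hU : IsReproducingFamily U A)
    (hw : IsTemperateWeight w) (hp : ∀ i, 1 ≤ p i) (hpq : ∀ i, 1 / p i + 1 / q i = 1)
    {l : StrongDual ℂ (CoorbitSpace hU hw hp)} {g : 𝓢'(𝔼, ℂ)}
    (hl : ∀ z, l (CoorbitSpace.ofSchwartz hU hw hp (U z)) = conj (g (U z))) :
    coorbitNorm U (fun z => 1 / w z) q g < ∞ := by
  obtain ⟨C, hC, hsyn⟩ := CoorbitSpace.exists_synthesis hU hw hp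
  have hgc := hU.continuous_apply g
  rw [coorbitNorm, mixedNorm_eq q hw.one_div.pos]
  refine (iteratedNorm_le_of_forall_lintegral_le hpq (A := ‖l‖ₑ * C)
    (hw.one_div.aemeasurable_mul hgc.measurable.aemeasurable)
    fun F hF k hFk hFs hF1 => ?_).trans_lt
    (ENNReal.mul_lt_top (by simp) (ENNReal.mul_lt_top enorm_lt_top hC.lt_top))
  have hFtop : ∀ z, F z ≠ ∞ := fun z => ne_top_of_le_ne_top (by simp) (hFk z)
  have hFk' : ∀ z, (F z).toReal ≤ k := fun z => by
    simpa using ENNReal.toReal_mono (by simp) (hFk z)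
  obtain ⟨C₁, s, hC₁, h₁⟩ := hw.one_div.exists_le
  -- `G` is `F / w` times the phase of `g (U z)`: the phase makes `l b` the integral of `F ‖g (U z)‖
  -- / w`, while `‖G‖ w ≤ F` keeps the norm of the superposition bounded by `C`.
  set G : (Fin n → ℝ) → ℂ := fun z =>
    (((F z).toReal * (1 / w z) : ℝ) : ℂ) * (g (U z) / (‖g (U z)‖ : ℂ)) with hG
  have hGn : ∀ z, ‖G z‖ ≤ (F z).toReal * (1 / w z) := by
    intro z
    have h0 : 0 ≤ (F z).toReal * (1 / w z) :=
      mul_nonneg ENNReal.toReal_nonneg (hw.one_div.pos z).le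
    rw [hG, norm_mul, Complex.norm_real, Real.norm_of_nonneg h0]
    exact mul_le_of_le_one_right h0 (norm_div_norm_le _)
  have hGs : ∀ z, (k : ℝ) < ‖z‖ → G z = 0 := by
    intro z hz
    have : F z = 0 := by
      refine hFs z ?_
      by_contra! hcon
      refine absurd hz (not_lt.2 ((pi_norm_le_iff_of_nonneg k.cast_nonneg).2 fun i => ?_))
      exact abs_le.2 (hcon i)
    simp [hG, this]
  have hGB : ∀ z, ‖G z‖ ≤ k * (C₁ * (1 + k) ^ s) := by
    intro z
    by_cases hz : (k : ℝ) < ‖z‖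
    · rw [hGs z hz, norm_zero]
      positivity
    · refine (hGn z).trans (mul_le_mul (hFk' z) ((h₁ z).trans ?_) (hw.one_div.pos z).le (by simp))
      have := not_lt.1 hz
      gcongr
  have hGm : AEMeasurable G := by
    refine AEMeasurable.mul ?_ ?_
    · exact Complex.measurable_ofReal.comp_aemeasurable
        (hF.ennreal_toReal.aemeasurable.mul hw.one_div.aemeasurable)
    · exact (hgc.measurable.div (Complex.measurable_ofReal.comp hgc.norm.measurable)).aemeasurable
  obtain ⟨b, hbl, -, hbn⟩ := hsyn G hGm k _ hGB hGs
  obtain ⟨hint, hlb⟩ := hbl l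
  have hval : ∀ z, G z * l (CoorbitSpace.ofSchwartz hU hw hp (U z)) =
      (((F z).toReal * (1 / w z) * ‖g (U z)‖ : ℝ) : ℂ) := by
    intro z
    rw [hl, hG, mul_assoc, mul_conj_div_norm]
    push_cast
    rfl
  simp only [hval] at hint hlb
  have hnn : ∀ z, 0 ≤ (F z).toReal * (1 / w z) * ‖g (U z)‖ := fun z =>
    mul_nonneg (mul_nonneg ENNReal.toReal_nonneg (hw.one_div.pos z).le) (norm_nonneg _)
  have hint' : Integrable fun z => (F z).toReal * (1 / w z) * ‖g (U z)‖ := by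
    simpa using hint.re
  rw [integral_complex_ofReal] at hlb
  calc ∫⁻ z, F z * (‖g (U z)‖ₑ * ENNReal.ofReal (1 / w z))
      = ∫⁻ z, ENNReal.ofReal ((F z).toReal * (1 / w z) * ‖g (U z)‖) := by
        refine lintegral_congr fun z => ?_
        rw [ENNReal.ofReal_mul (mul_nonneg ENNReal.toReal_nonneg (hw.one_div.pos z).le),
          ENNReal.ofReal_mul ENNReal.toReal_nonneg, ENNReal.ofReal_toReal (hFtop z), ofReal_norm,
          mul_assoc, mul_comm ‖g (U z)‖ₑ]
    _ = ENNReal.ofReal (∫ z, (F z).toReal * (1 / w z) * ‖g (U z)‖) :=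
        (ofReal_integral_eq_lintegral_ofReal hint' (Filter.Eventually.of_forall hnn)).symm
    _ = ‖l b‖ₑ := by
        rw [hlb, ← ofReal_norm, Complex.norm_real, Real.norm_of_nonneg (integral_nonneg hnn)]
    _ ≤ ‖l‖ₑ * ‖b‖ₑ := l.le_opENorm b
    _ ≤ ‖l‖ₑ * (C * 1) := by
        refine mul_le_mul_right (hbn.trans (mul_le_mul_right ?_ _)) _
        refine (iteratedNorm_mono p fun z => ?_).trans hF1
        rw [← ofReal_norm, ← ENNReal.ofReal_mul (norm_nonneg _)]
        refine ENNReal.ofReal_le_of_le_toReal ?_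
        calc ‖G z‖ * w z ≤ (F z).toReal * (1 / w z) * w z :=
              mul_le_mul_of_nonneg_right (hGn z) (hw.pos z).le
          _ = (F z).toReal := by rw [mul_assoc, one_div_mul_cancel (hw.pos z).ne', mul_one]
    _ = ‖l‖ₑ * C := by rw [mul_one]

/-- A bounded functional on a coorbit space with finite exponents is determined by its values on the
atoms. -/
theorem mul_strongDual_apply_eq_integral (hU : IsReproducingFamily U A)
    (hw : IsTemperateWeight w) (hp : ∀ i, 1 ≤ p i) (hp' : ∀ i, p i ≠ ∞)
    (hpq : ∀ i, 1 / p i + 1 / q i = 1) (hq : ∀ i, 1 ≤ q i)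
    {l : StrongDual ℂ (CoorbitSpace hU hw hp)} {g : 𝓢'(𝔼, ℂ)}
    (hl : ∀ z, l (CoorbitSpace.ofSchwartz hU hw hp (U z)) = conj (g (U z)))
    (f : CoorbitSpace hU hw hp) :
    (A : ℂ) * l f = ∫ z, f.val (U z) * conj (g (U z)) := by
  have hg := coorbitNorm_lt_top_of_strongDual hU hw hp hpq hl
  obtain ⟨C, hC, hsyn⟩ := CoorbitSpace.exists_synthesis hU hw hp
  obtain ⟨C', hC', hyoung⟩ := exists_iteratedNorm_lintegral_mul_le hU hw hp
  have hfc := hU.continuous_apply f.val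
  have hint := integrable_mul_conj hU hw hpq f.val_lt_top hg
  set B : ℕ → Set (Fin n → ℝ) := fun k => Metric.closedBall 0 k with hB
  have hBm : ∀ k, MeasurableSet (B k) := fun k => measurableSet_closedBall
  have hBmem : ∀ z, ∀ᶠ k in Filter.atTop, z ∈ B k := by
    intro z
    obtain ⟨m, hm⟩ := exists_nat_ge ‖z‖
    filter_upwards [Filter.eventually_ge_atTop m] with k hk
    have : (m : ℝ) ≤ k := by exact_mod_cast hk
    simpa [hB] using hm.trans this
  -- The coefficients of `f` cut off to balls. Their superpositions `b k` are shown to tend to `A •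
  -- f`, while `l (b k)` tends to the pairing.
  set G : ℕ → (Fin n → ℝ) → ℂ := fun k => (B k).indicator fun z => f.val (U z) with hG
  have hGm : ∀ k, Measurable (G k) := fun k => hfc.measurable.indicator (hBm k)
  have hex : ∀ k, ∃ b : CoorbitSpace hU hw hp,
      l b = ∫ z, G k z * conj (g (U z)) ∧
      ∀ ψ, Integrable (fun z => G k z * schwartzInner (U z) ψ) ∧
        b.val ψ = ∫ z, G k z * schwartzInner (U z) ψ := by
    intro k
    obtain ⟨E, hE⟩ := (isCompact_closedBall (0 : Fin n → ℝ) k).exists_bound_of_continuousOn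
      hfc.continuousOn
    obtain ⟨b, hbl, hbv, -⟩ := hsyn (G k) (hGm k).aemeasurable k (max E 0) (fun z => by
      by_cases hz : z ∈ B k
      · rw [hG]
        simp only [Set.indicator_of_mem hz]
        exact (hE z hz).trans (le_max_left _ _)
      · rw [hG]
        simp only [Set.indicator_of_notMem hz, norm_zero]
        exact le_max_right _ _) (fun z hz => Set.indicator_of_notMem (by simpa [hB] using hz) _)
    refine ⟨b, ?_, hbv⟩
    simpa only [hl] using (hbl l).2
  choose b hbl hbv using hex
  have hlim : Filter.Tendsto (fun k => l (b k)) Filter.atTop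
      (nhds (∫ z, f.val (U z) * conj (g (U z)))) := by
    simp only [hbl]
    refine tendsto_integral_of_dominated_convergence (fun z => ‖f.val (U z) * conj (g (U z))‖)
      (fun k => ?_) hint.norm (fun k => Filter.Eventually.of_forall fun z => ?_)
      (Filter.Eventually.of_forall fun z => ?_)
    · exact (hGm k).aestronglyMeasurable.mul
        (Complex.continuous_conj.comp (hU.continuous_apply g)).aestronglyMeasurable
    · rw [norm_mul, norm_mul]
      exact mul_le_mul_of_nonneg_right (norm_indicator_le_norm_self _ _) (norm_nonneg _)
    · refine tendsto_const_nhds.congr' ?_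
      filter_upwards [hBmem z] with k hk
      rw [hG]
      simp only [Set.indicator_of_mem hk]
  have hrest : ∀ k z, f.val (U z) - G k z = (B k)ᶜ.indicator (fun z => f.val (U z)) z := by
    intro k z
    by_cases hz : z ∈ B k
    · simp [hG, hz]
    · simp [hG, hz]
  -- By the reproducing formula the difference is the superposition of the coefficients outside the
  -- ball, so the Gram kernel bound controls it by the norm of this tail.
  have hdiff : ∀ k, ‖(A : ℂ) • f - b k‖ₑ ≤ C' * iteratedNorm n p fun z =>
      ‖(B k)ᶜ.indicator (fun z => f.val (U z)) z‖ₑ * ENNReal.ofReal (w z) := by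
    intro k
    rw [enorm_val, coorbitNorm, mixedNorm_eq p hw.pos]
    refine (iteratedNorm_mono p fun u => ?_).trans
      (hyoung _ (hfc.measurable.indicator (hBm k).compl).enorm.aemeasurable)
    refine mul_le_mul_left ?_ _
    have hfψ : Integrable fun z => f.val (U z) * schwartzInner (U z) (U u) := by
      obtain ⟨M, K, -, hK⟩ := exists_coorbitNorm_schwartzDual_le hU hw.one_div hq
      have := integrable_mul_conj hU hw hpq f.val_lt_top
        ((hK (U u)).trans_lt ENNReal.ofReal_lt_top)
      simpa only [schwartzDual_apply, conj_schwartzInner] using this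
    have h1 : ((A : ℂ) • f - b k).val (U u) =
        ∫ z, (B k)ᶜ.indicator (fun z => f.val (U z)) z * schwartzInner (U z) (U u) := by
      change (A : ℂ) * f.val (U u) - (b k).val (U u) = _
      rw [hU.reproducing, (hbv k (U u)).2, ← integral_sub hfψ (hbv k (U u)).1]
      simp only [← sub_mul, hrest]
    rw [h1]
    refine (enorm_integral_le_lintegral_enorm _).trans (le_of_eq ?_)
    simp only [enorm_mul]
  have hzero : Filter.Tendsto (fun k => iteratedNorm n p fun z =>
      ‖(B k)ᶜ.indicator (fun z => f.val (U z)) z‖ₑ * ENNReal.ofReal (w z)) Filter.atTop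
      (nhds 0) := by
    have hwm : Measurable (hw.aemeasurable.mk w) := hw.aemeasurable.measurable_mk
    have hcongr : ∀ F : (Fin n → ℝ) → ℂ, iteratedNorm n p (fun z => ‖F z‖ₑ * ENNReal.ofReal (w z)) =
        iteratedNorm n p fun z => ‖F z‖ₑ * ENNReal.ofReal (hw.aemeasurable.mk w z) := by
      intro F
      refine iteratedNorm_congr_ae p ?_
      filter_upwards [hw.aemeasurable.ae_eq_mk] with z hz
      rw [← hz]
    simp only [hcongr]
    -- The one place where the exponents must be finite: for an infinite exponent tails need not
    -- become small.
    refine tendsto_iteratedNorm_zero_of_dominated p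
      (H := fun z => ‖f.val (U z)‖ₑ * ENNReal.ofReal (hw.aemeasurable.mk w z))
      (fun i => ⟨fun h => by have := hp i; simp [h] at this, hp' i⟩)
      (fun k => (hfc.measurable.indicator (hBm k).compl).enorm.mul hwm.ennreal_ofReal)
      (hfc.measurable.enorm.mul hwm.ennreal_ofReal) (fun k z => ?_) ?_ fun z => ?_
    · exact mul_le_mul_left (enorm_indicator_le_enorm_self _ _) _
    · rw [← hcongr, ← mixedNorm_eq p hw.pos]
      exact f.val_lt_top.ne
    · refine tendsto_const_nhds.congr' ?_
      filter_upwards [hBmem z] with k hk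
      simp [hk]
  have hb : Filter.Tendsto b Filter.atTop (nhds ((A : ℂ) • f)) := by
    refine tendsto_iff_edist_tendsto_0.2 ?_
    have h2 : Filter.Tendsto (fun k => C' * iteratedNorm n p fun z =>
        ‖(B k)ᶜ.indicator (fun z => f.val (U z)) z‖ₑ * ENNReal.ofReal (w z)) Filter.atTop
        (nhds 0) := by
      simpa using ENNReal.Tendsto.const_mul hzero (Or.inr hC')
    refine tendsto_of_tendsto_of_tendsto_of_le_of_le tendsto_const_nhds h2 (fun _ => zero_le)
      fun k => ?_
    change edist (b k) ((A : ℂ) • f) ≤ _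
    rw [edist_comm, edist_eq_enorm_sub]
    exact hdiff k
  have := tendsto_nhds_unique ((l.continuous.tendsto _).comp hb) hlim
  rwa [map_smul, smul_eq_mul] at this

/-- Duality of coorbit spaces with finite exponents. -/
theorem exists_coorbit_duality (hU : IsReproducingFamily U A)
    (hw : IsTemperateWeight w) (hp : ∀ i, 1 ≤ p i) (hp' : ∀ i, p i ≠ ∞)
    (hpq : ∀ i, 1 / p i + 1 / q i = 1) (hq : ∀ i, 1 ≤ q i) :
    ∃ T : CoorbitSpace hU hw.one_div hq ≃SL[starRingEnd ℂ] StrongDual ℂ (CoorbitSpace hU hw hp),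
      ∀ g f, T g f = ∫ z, f.val (U z) * conj (g.val (U z)) := by
  have hint : ∀ (g : CoorbitSpace hU hw.one_div hq) (f : CoorbitSpace hU hw hp),
      Integrable fun z => f.val (U z) * conj (g.val (U z)) := fun g f =>
    integrable_mul_conj hU hw hpq f.val_lt_top g.val_lt_top
  have hbound : ∀ (g : CoorbitSpace hU hw.one_div hq) (f : CoorbitSpace hU hw hp),
      ‖∫ z, f.val (U z) * conj (g.val (U z))‖ ≤ 1 * ‖g‖ * ‖f‖ := by
    intro g f
    rw [one_mul, ← ENNReal.ofReal_le_ofReal_iff (by positivity), ofReal_norm,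
      ENNReal.ofReal_mul (norm_nonneg _), ofReal_norm, ofReal_norm, enorm_val, enorm_val, mul_comm]
    exact (enorm_integral_le_lintegral_enorm _).trans (lintegral_enorm_mul_le hU hw hpq _ _)
  let T₀ : CoorbitSpace hU hw.one_div hq →ₛₗ[starRingEnd ℂ] CoorbitSpace hU hw hp →ₗ[ℂ] ℂ :=
    LinearMap.mk₂'ₛₗ (starRingEnd ℂ) (RingHom.id ℂ)
      (fun g f => ∫ z, f.val (U z) * conj (g.val (U z)))
      (fun g g' f => by
        rw [← integral_add (hint g f) (hint g' f)]
        refine integral_congr_ae (Filter.Eventually.of_forall fun z => ?_)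
        change f.val (U z) * conj (g.val (U z) + g'.val (U z)) = _
        rw [map_add, mul_add])
      (fun a g f => by
        rw [smul_eq_mul, ← integral_const_mul]
        refine integral_congr_ae (Filter.Eventually.of_forall fun z => ?_)
        change f.val (U z) * conj (a * g.val (U z)) = _
        rw [map_mul, mul_left_comm])
      (fun g f f' => by
        rw [← integral_add (hint g f) (hint g f')]
        refine integral_congr_ae (Filter.Eventually.of_forall fun z => ?_)
        change (f.val (U z) + f'.val (U z)) * conj (g.val (U z)) = _
        rw [add_mul])
      (fun a g f => by
        rw [RingHom.id_apply, smul_eq_mul, ← integral_const_mul]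
        refine integral_congr_ae (Filter.Eventually.of_forall fun z => ?_)
        change a * f.val (U z) * conj (g.val (U z)) = _
        rw [mul_assoc])
  let T : CoorbitSpace hU hw.one_div hq →SL[starRingEnd ℂ] StrongDual ℂ (CoorbitSpace hU hw hp) :=
    LinearMap.mkContinuous₂ T₀ 1 hbound
  have hT : ∀ g f, T g f = ∫ z, f.val (U z) * conj (g.val (U z)) := fun g f => rfl
  have := completeSpace_coorbit hU hw.one_div hq
  -- Pairing with Schwartz functions already recovers `g` through the reproducing formula.
  have hker : T.ker = ⊥ := by
    refine LinearMap.ker_eq_bot'.2 fun g hg => Subtype.ext ?_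
    refine eq_zero_of_forall_integral_eq_zero hU fun ψ => ?_
    have h1 := hT g (CoorbitSpace.ofSchwartz hU hw hp ψ)
    rw [show T g = 0 from hg] at h1
    exact h1.symm
  have hrange : T.range = ⊤ := by
    refine LinearMap.range_eq_top.2 fun l => ?_
    obtain ⟨M, C, hC, h⟩ := CoorbitSpace.exists_norm_ofSchwartz_le hU hw hp
    -- `ofSchwartz` is antilinear, so the conjugate of `l` along it is linear and defines a
    -- distribution.
    let g₀ : 𝓢(𝔼, ℂ) →ₗ[ℂ] ℂ :=
      { toFun := fun ψ => conj (l (CoorbitSpace.ofSchwartz hU hw hp ψ))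
        map_add' := fun ψ χ => by rw [CoorbitSpace.ofSchwartz_add, map_add, map_add]
        map_smul' := fun a ψ => by
          rw [CoorbitSpace.ofSchwartz_smul, map_smul, smul_eq_mul, map_mul, Complex.conj_conj,
            RingHom.id_apply, smul_eq_mul] }
    let g : 𝓢'(𝔼, ℂ) := temperedOfBound g₀ M (‖l‖ * C) fun ψ => by
      change ‖conj (l (CoorbitSpace.ofSchwartz hU hw hp ψ))‖ ≤ _
      rw [RCLike.norm_conj, mul_assoc]
      exact (l.le_opNorm _).trans (mul_le_mul_of_nonneg_left (h ψ) (norm_nonneg _))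
    have hl : ∀ z, l (CoorbitSpace.ofSchwartz hU hw hp (U z)) = conj (g (U z)) := fun z =>
      (Complex.conj_conj _).symm
    let g' : CoorbitSpace hU hw.one_div hq := ⟨g, coorbitNorm_lt_top_of_strongDual hU hw hp hpq hl⟩
    have hA : (A : ℂ) ≠ 0 := by exact_mod_cast hU.pos.ne'
    -- The reproducing constant is removed here; it is real, so the antilinearity of `T` does not
    -- affect it.
    refine ⟨(A : ℂ)⁻¹ • g', ContinuousLinearMap.ext fun f => ?_⟩
    have h1 : T g' f = (A : ℂ) * l f :=
      (mul_strongDual_apply_eq_integral hU hw hp hp' hpq hq hl f).symm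
    change T ((A : ℂ)⁻¹ • g') f = l f
    rw [map_smulₛₗ, smul_apply, h1, map_inv₀, Complex.conj_ofReal, smul_eq_mul,
      inv_mul_cancel_left₀ hA]
  -- The open mapping theorem, which uses completeness of the domain, makes the inverse continuous.
  exact ⟨ContinuousLinearEquiv.ofBijective T hker hrange, fun g f => hT g f⟩

end CoorbitDuality

/-! ### Mixed modulation spaces as coorbit spaces -/

theorem IsModerateWeight.isTemperateWeight {n : ℕ} {v w : (Fin n → ℝ) → ℝ} (hv : IsWeight v)
    (hv_growth : HasPolynomialGrowth v) (hw : IsModerateWeight v w) (hw_ne : w ≠ 0) :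
    IsTemperateWeight w := by
  obtain ⟨C, hC⟩ := hw.exists_map_add_le
  have hC' : ∀ u z, w u ≤ C * v (u - z) * w z := fun u z => by
    simpa using hC (u - z) z
  obtain ⟨z₀, hz₀⟩ := Function.ne_iff.1 hw_ne
  refine ⟨hw.locallyIntegrable.aestronglyMeasurable.aemeasurable, fun z => ?_, ?_⟩
  -- Moderateness spreads a zero of `w` to every point, in particular to `z₀`.
  · refine lt_of_le_of_ne (hw.nonneg z) fun h0 => hz₀ (le_antisymm ?_ (hw.nonneg z₀))
    simpa [← h0] using hC' z₀ z
  · obtain ⟨K, s, hK, hs, hvK⟩ := hv_growth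
    -- The power of `n + 1` pays for passing from the Euclidean norm to the sup norm, and `|C|` for
    -- the unknown sign of `C`.
    refine ⟨|C| * (K * ((n : ℝ) + 1) ^ ⌈s⌉₊), ⌈s⌉₊, by positivity, fun u z => ?_⟩
    have h1 : 1 + ‖(WithLp.toLp 2 (u - z) : EuclideanSpace ℝ (Fin n))‖ ≤
        ((n : ℝ) + 1) * (1 + ‖u - z‖) := by
      have := euclidean_norm_le (u - z) fun i => norm_le_pi_norm (u - z) i
      nlinarith [norm_nonneg (u - z), (Nat.cast_nonneg n : (0 : ℝ) ≤ n)]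
    have h2 : v (u - z) ≤ K * (((n : ℝ) + 1) ^ ⌈s⌉₊ * (1 + ‖u - z‖) ^ ⌈s⌉₊) := by
      refine (hvK _).trans (mul_le_mul_of_nonneg_left ?_ hK)
      rw [← mul_pow, ← Real.rpow_natCast]
      refine (Real.rpow_le_rpow_of_exponent_le ?_ (Nat.le_ceil s)).trans
        (Real.rpow_le_rpow (by positivity) h1 (Nat.cast_nonneg _))
      exact le_add_of_nonneg_right (norm_nonneg _)
    refine (hC' u z).trans (mul_le_mul_of_nonneg_right ?_ (hw.nonneg z))
    calc C * v (u - z) ≤ |C| * v (u - z) :=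
          mul_le_mul_of_nonneg_right (le_abs_self C) (hv.nonneg _)
      _ ≤ |C| * (K * (((n : ℝ) + 1) ^ ⌈s⌉₊ * (1 + ‖u - z‖) ^ ⌈s⌉₊)) :=
          mul_le_mul_of_nonneg_left h2 (abs_nonneg C)
      _ = _ := by ring

theorem modulationNorm_eq_coorbitNorm {d : ℕ} (φ : 𝓢(EuclideanSpace ℝ (Fin d), ℂ))
    (c : Equiv.Perm (Fin (d + d))) (w : (Fin (d + d) → ℝ) → ℝ) (p : Fin (d + d) → ℝ≥0∞) :
    modulationNorm φ c w p = coorbitNorm (gaborAtom φ c) w p :=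
  funext fun f => congrArg (mixedNorm p w) (funext fun z => gaborTransform₂_comp φ c f z)

/-! ### Permuting coordinates preserves Lebesgue measure, so the pairing does not depend on `c`. -/

section Pairing

variable {d : ℕ} (φ : 𝓢(EuclideanSpace ℝ (Fin d), ℂ)) (c : Equiv.Perm (Fin (d + d)))
  (f g : 𝓢'(EuclideanSpace ℝ (Fin d), ℂ))

theorem gaborTransform₂_piCongrLeft (z : Fin (d + d) → ℝ) :
    gaborTransform₂ φ f (MeasurableEquiv.piCongrLeft (fun _ => ℝ) c.symm z) =
      f (gaborAtom φ c z) := by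
  rw [← gaborTransform₂_comp]
  congr 1
  funext i
  have := MeasurableEquiv.piCongrLeft_apply_apply (β := fun _ => ℝ) c.symm z (c i)
  simpa using this

theorem integrable_gaborTransform₂_mul_conj_iff :
    Integrable (fun z => gaborTransform₂ φ f z * conj (gaborTransform₂ φ g z)) ↔
      Integrable fun z => f (gaborAtom φ c z) * conj (g (gaborAtom φ c z)) := by
  rw [← (volume_measurePreserving_piCongrLeft (fun _ => ℝ) c.symm).integrable_comp_emb
    (MeasurableEquiv.piCongrLeft (fun _ => ℝ) c.symm).measurableEmbedding]
  simp only [Function.comp_def, gaborTransform₂_piCongrLeft]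

theorem integral_gaborTransform₂_mul_conj :
    ∫ z, gaborTransform₂ φ f z * conj (gaborTransform₂ φ g z) =
      ∫ z, f (gaborAtom φ c z) * conj (g (gaborAtom φ c z)) := by
  rw [← (volume_measurePreserving_piCongrLeft (fun _ => ℝ) c.symm).integral_comp']
  simp only [gaborTransform₂_piCongrLeft]

end Pairing

end MixedModulation

theorem theorem4p2 (d : ℕ) (v w : (Fin (d + d) → ℝ) → ℝ)
    (hv : IsSubmultiplicativeWeight v) (hv_growth : HasPolynomialGrowth v)
    (hv_symm : IsCoordinateSymmetric v) (hw : IsModerateWeight v w) (hw_ne : w ≠ 0)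
    (c : Equiv.Perm (Fin (d + d)))
    (φ : 𝓢(EuclideanSpace ℝ (Fin d), ℂ)) (hφ : φ ≠ 0) :
    (∀ p : Fin (d + d) → ℝ≥0∞, (∀ i, 1 ≤ p i) →
      ∃ h : IsExtendedNorm (modulationNorm φ c w p), CompleteSpace h.Space) ∧
    (∀ p p' : Fin (d + d) → ℝ≥0∞, (∀ i, 1 ≤ p i ∧ p i < ∞) → (∀ i, 1 / p i + 1 / p' i = 1) →
      ∃ (h : IsExtendedNorm (modulationNorm φ c w p))
        (h' : IsExtendedNorm (modulationNorm φ c (fun z => 1 / w z) p'))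
        (T : h'.Space ≃SL[starRingEnd ℂ] StrongDual ℂ h.Space),
        ∀ (g : h'.Space) (f : h.Space),
          Integrable (fun z => gaborTransform₂ φ f.val z * conj (gaborTransform₂ φ g.val z)) ∧
          T g f = ∫ z, gaborTransform₂ φ f.val z * conj (gaborTransform₂ φ g.val z)) := by
  have hw' : IsTemperateWeight w := hw.isTemperateWeight hv.toIsWeight hv_growth hw_ne
  have hU := isReproducingFamily_gaborAtom φ hφ c
  refine ⟨fun p hp => ?_, fun p p' hp hpp' => ?_⟩
  · rw [modulationNorm_eq_coorbitNorm]
    exact ⟨isExtendedNorm_coorbitNorm hU hw' hp, completeSpace_coorbit hU hw' hp⟩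
  · have hp' : ∀ i, 1 ≤ p' i := fun i => by
      have h1 : 1 / p' i ≤ 1 := le_add_self.trans (hpp' i).le
      rwa [one_div, ENNReal.inv_le_one] at h1
    obtain ⟨T, hT⟩ := exists_coorbit_duality hU hw' (fun i => (hp i).1) (fun i => (hp i).2.ne)
      hpp' hp'
    rw [modulationNorm_eq_coorbitNorm, modulationNorm_eq_coorbitNorm]
    refine ⟨_, _, T, fun g f => ⟨?_, ?_⟩⟩
    · rw [integrable_gaborTransform₂_mul_conj_iff φ c]
      exact integrable_mul_conj hU hw' hpp' f.val_lt_top g.val_lt_top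
    · rw [integral_gaborTransform₂_mul_conj φ c]
      exact hT g f
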